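/- **Theorem 1 (Efficient Influence Function).** Let $t\in\{0,1\}$, $\mathcal L\subseteq\mathbb R$, $p\in\mathbb N$, and let $\mathcal Y,\mathcal Z$ be standard Borel spaces. One unit has full data $(T,Y,Z,S,L,\tilde L)$: a predictor $T\in\{0,1\}$, a text $Y\in\mathcal Y$, controls $Z\in\mathcal Z$, a sampling indicator $S\in\{0,1\}$, a true concept $L\in\mathcal L$ and a human annotation $\tilde L\in\mathbb R$. The observed data are $O=(T,Y,Z,S,S\tilde L)$, so $\tilde L$ is seen only when $S=1$. The target parameter is $\Psi_t(P)=E_P\bigl[E_P[L\mid T=t,Z]\bigr]$. A measurable map $f:\mathcal Y\to\mathbb R^p$ is a *surrogate representation* under $P$ if $Y\perp\!\!\!\perp\{L,T\}\mid W,Z$, where $W=f(Y)$. *Perfect-annotation model:* the set of all laws $P$ of the full data such that 1. $L=g(Y)$ almost surely for some measurable $g:\mathcal Y\to\mathcal L$; 2. $\tilde L=L$ almost surely; 3. $\{T,Y,Z\}\perp\!\!\!\perp S$ and $P(S=1)>0$; 4. a surrogate representation $f:\mathcal Y\to\mathbb R^p$ exists; 5. for some $c_1<\infty$ and $c_2>0$,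 $E[\tilde L^2]^{1/2}\le c_1$ and $\pi_t(Z)=P(T=t\mid Z)\ge c_2$ almost surely. The maps $g$ and $f$ and the constants may vary with $P$. *Blind-annotation model:* the same conditions, except that 1 is replaced by $T\perp\!\!\!\perp L\mid Y,Z$ with $L\in\mathcal L$ almost surely (the coding of the text may be random but does not look at $T$), and the independence in 3 is replaced by $\{T,Y,Z,L\}\perp\!\!\!\perp S$. It contains the perfect-annotation model. A *regular submodel* through $P$ is a family $(P_\varepsilon)_{\varepsilon\in\mathbb R}$ of laws with $P_0=P$ that for all $\varepsilon$ near $0$ lie in the model with common constants $c_1,c_2$, and whose observed-data laws have, near $0$, densities $q_\varepsilon$ with respect to one $\sigma$-finite measure $\nu$ with, for some $s\in L^2$ of the law of $O$ under $P$ (the *score*), $$\int\Bigl(\frac{\sqrt{q_\varepsilon}-\sqrt{q_0}}{\varepsilon}-\tfrac12 s\sqrt{q_0}\Bigr)^2d\nu\to0\qquad(\varepsilon\to0).$$ The *tangent space* is the closed linear span in $L^2$ of the scores of all regular submodels through $P$. A function $\psi(O)\in L^2$ is the *efficient influence function* of $\Psi_t$ at $P$ if it lies in the tangent space and $\frac{d}{d\varepsilon}\Psi_t(P_\varepsilon)\big|_{\varepsilon=0}=E_P[\psi\,s]$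 for every regular submodel through $P$, with $s$ its score. Then, in the perfect-annotation model, at every law $P$ in it and for every surrogate representation $f$ under $P$, the efficient influence function of $\Psi_t$ is $$\psi_t=\frac{\mathbf 1\{S=1\}}{P(S=1)}\cdot\frac{\rho_t(W,Z)}{\pi_t(Z)}\bigl(\tilde L-\mu(W,Z)\bigr)+\frac{\mathbf 1\{T=t\}}{\pi_t(Z)}\bigl(\mu(W,Z)-\bar m_t(Z)\bigr)+\bar m_t(Z)-\Psi_t,$$ where $W=f(Y)$, $\rho_t(W,Z)=P(T=t\mid W,Z)$ is the surrogacy score, $\pi_t(Z)=P(T=t\mid Z)$ the propensity score, $\mu(W,Z)=E[\tilde L\mid W,Z]$ the outcome model, and $\bar m_t(Z)=\int\mu(f(y),Z)\,dF(y\mid Z,T=t)$ the regression of $\mu$ on $(T=t,Z)$. The same holds, with the same formula, in the blind-annotation model. -/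

import Mathlib

open MeasureTheory ProbabilityTheory Filter Topology
open scoped NNReal ENNReal

noncomputable section

namespace SRI

/-! ### Semiparametric theory: regular submodels, tangent space, efficient influence function -/

section Semiparametric

variable {Ω X κ : Type*} [MeasurableSpace Ω] [MeasurableSpace X]

/-- `γ` is a regular one-dimensional parametric submodel through `P` with score `s`.
`Ω` carries the full data and `obs` maps them to the observed data. The model is the union of the
classes `ℳ k`, where the index `k` holds the constants of the regularity bounds; a submodel must
satisfy these bounds uniformly near `ε = 0`. The observed-data laws have densities `q ε` with
respect to one `σ`-finite measure, and `√(q ε)` is differentiable in quadratic mean at `ε = 0`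
with derivative `s √(q 0) / 2`. -/
structure IsRegularSubmodel (ℳ : κ → Set (ProbabilityMeasure Ω)) (obs : Ω → X)
    (P : ProbabilityMeasure Ω) (γ : ℝ → ProbabilityMeasure Ω)
    (s : Lp ℝ 2 ((P : Measure Ω).map obs)) : Prop where
  base : γ 0 = P
  mem : ∃ k, ∀ᶠ ε in 𝓝 (0 : ℝ), γ ε ∈ ℳ k
  qmd : ∃ (ν : Measure X) (_ : SigmaFinite ν) (q : ℝ → X → ℝ≥0),
    (∀ ε, Measurable (q ε)) ∧
    (∀ᶠ ε in 𝓝 (0 : ℝ),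
      (γ ε : Measure Ω).map obs = ν.withDensity (fun x => (q ε x : ℝ≥0∞))) ∧
    Tendsto (fun ε : ℝ => ∫⁻ x, ENNReal.ofReal
      (((√(q ε x : ℝ) - √(q 0 x : ℝ)) / ε - s x * √(q 0 x : ℝ) / 2) ^ 2) ∂ν)
      (𝓝[≠] 0) (𝓝 0)

/-- The tangent space at `P`: the closed linear span in `L²` of the scores of all regular
parametric submodels through `P`. -/
def tangentSpace (ℳ : κ → Set (ProbabilityMeasure Ω)) (obs : Ω → X) (P : ProbabilityMeasure Ω) :
    Submodule ℝ (Lp ℝ 2 ((P : Measure Ω).map obs)) :=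
  (Submodule.span ℝ {s | ∃ γ, IsRegularSubmodel ℳ obs P γ s}).topologicalClosure

/-- `φ` is the efficient influence function (canonical gradient) at `P` of the parameter `Ψ`:
`Ψ` is pathwise differentiable along every regular submodel with gradient `φ`, and `φ` lies in the
tangent space. These properties determine `φ` up to almost sure equality. -/
structure IsEfficientInfluenceFunction (ℳ : κ → Set (ProbabilityMeasure Ω)) (obs : Ω → X)
    (Ψ : ProbabilityMeasure Ω → ℝ) (P : ProbabilityMeasure Ω) (φ : X → ℝ) : Prop where
  memLp : MemLp φ 2 ((P : Measure Ω).map obs)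
  gradient : ∀ (γ : ℝ → ProbabilityMeasure Ω) (s : Lp ℝ 2 ((P : Measure Ω).map obs)),
    IsRegularSubmodel ℳ obs P γ s →
      HasDerivAt (fun ε => Ψ (γ ε)) (∫ x, φ x * s x ∂((P : Measure Ω).map obs)) 0
  mem_tangentSpace : memLp.toLp φ ∈ tangentSpace ℳ obs P

end Semiparametric

/-! ### The data -/

/-- Full data of one unit, in the order `(T, Y, Z, S, L, L̃)`: binary predictor, text, controls,
sampling indicator, true concept, human annotation. -/
abbrev FullData (𝒴 𝒵 : Type*) := Fin 2 × 𝒴 × 𝒵 × Fin 2 × ℝ × ℝ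

/-- Observed data of one unit, in the order `(T, Y, Z, S, S · L̃)`. -/
abbrev ObsData (𝒴 𝒵 : Type*) := Fin 2 × 𝒴 × 𝒵 × Fin 2 × ℝ

section Data

variable {𝒴 𝒵 : Type*}

def predictor (x : FullData 𝒴 𝒵) : Fin 2 := x.1
def text (x : FullData 𝒴 𝒵) : 𝒴 := x.2.1
def controls (x : FullData 𝒴 𝒵) : 𝒵 := x.2.2.1
def sampled (x : FullData 𝒴 𝒵) : Fin 2 := x.2.2.2.1
def concept (x : FullData 𝒴 𝒵) : ℝ := x.2.2.2.2.1
def annotation (x : FullData 𝒴 𝒵) : ℝ := x.2.2.2.2.2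

/-- The observation map: the annotation is seen only when `S = 1`. -/
def observe (x : FullData 𝒴 𝒵) : ObsData 𝒴 𝒵 :=
  (predictor x, text x, controls x, sampled x, if sampled x = 1 then annotation x else 0)

/-- `(W, Z)` with `W = f(Y)`. -/
def reprControls {p : ℕ} (f : 𝒴 → EuclideanSpace ℝ (Fin p)) (x : FullData 𝒴 𝒵) :
    EuclideanSpace ℝ (Fin p) × 𝒵 := (f (text x), controls x)

variable [MeasurableSpace 𝒴] [MeasurableSpace 𝒵]

lemma measurable_text : Measurable (text : FullData 𝒴 𝒵 → 𝒴) := by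
  unfold text; fun_prop

lemma measurable_controls : Measurable (controls : FullData 𝒴 𝒵 → 𝒵) := by
  unfold controls; fun_prop

lemma measurable_reprControls {p : ℕ} {f : 𝒴 → EuclideanSpace ℝ (Fin p)} (hf : Measurable f) :
    Measurable (reprControls f : FullData 𝒴 𝒵 → _) :=
  (hf.comp measurable_text).prodMk measurable_controls

/-! ### Target parameter and nuisance functions -/

/-- `Ψ_t = E[E[L | T = t, Z]]`. -/
def targetParameter (t : Fin 2) (P : ProbabilityMeasure (FullData 𝒴 𝒵)) : ℝ :=
  ∫ x, (∫ l, l ∂(condDistrib concept (fun x => (predictor x, controls x))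
    (P : Measure (FullData 𝒴 𝒵)) (t, controls x))) ∂(P : Measure (FullData 𝒴 𝒵))

/-- Propensity score `π_t(z) = P(T = t | Z = z)`. -/
def propensityScore (t : Fin 2) (P : ProbabilityMeasure (FullData 𝒴 𝒵)) (z : 𝒵) : ℝ :=
  (condDistrib predictor controls (P : Measure (FullData 𝒴 𝒵)) z).real {t}

/-- Surrogacy score `ρ_t(w, z) = P(T = t | W = w, Z = z)`. -/
def surrogacyScore {p : ℕ} (t : Fin 2) (f : 𝒴 → EuclideanSpace ℝ (Fin p))
    (P : ProbabilityMeasure (FullData 𝒴 𝒵)) (w : EuclideanSpace ℝ (Fin p)) (z : 𝒵) : ℝ :=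
  (condDistrib predictor (reprControls f) (P : Measure (FullData 𝒴 𝒵)) (w, z)).real {t}

/-- Outcome model `μ(w, z) = E[L̃ | W = w, Z = z]`. -/
def outcomeModel {p : ℕ} (f : 𝒴 → EuclideanSpace ℝ (Fin p))
    (P : ProbabilityMeasure (FullData 𝒴 𝒵)) (w : EuclideanSpace ℝ (Fin p)) (z : 𝒵) : ℝ :=
  ∫ l, l ∂(condDistrib annotation (reprControls f) (P : Measure (FullData 𝒴 𝒵)) (w, z))

/-- `m̄_t(z) = ∫ μ(f(y), z) dF(y | Z = z, T = t)`. -/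
def meanOutcome [StandardBorelSpace 𝒴] [Nonempty 𝒴] {p : ℕ} (t : Fin 2)
    (f : 𝒴 → EuclideanSpace ℝ (Fin p)) (P : ProbabilityMeasure (FullData 𝒴 𝒵)) (z : 𝒵) : ℝ :=
  ∫ y, outcomeModel f P (f y) z ∂(condDistrib text (fun x => (predictor x, controls x))
    (P : Measure (FullData 𝒴 𝒵)) (t, z))

/-- The explicit influence function, evaluated at an observation `(T, Y, Z, S, S · L̃)`. -/
def influenceFunction [StandardBorelSpace 𝒴] [Nonempty 𝒴] {p : ℕ} (t : Fin 2)
    (f : 𝒴 → EuclideanSpace ℝ (Fin p)) (P : ProbabilityMeasure (FullData 𝒴 𝒵)) :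
    ObsData 𝒴 𝒵 → ℝ
  | (T, Y, Z, S, l) =>
    (if S = 1 then 1 else 0) / (P : Measure (FullData 𝒴 𝒵)).real {x | sampled x = 1}
        * (surrogacyScore t f P (f Y) Z / propensityScore t P Z) * (l - outcomeModel f P (f Y) Z)
      + (if T = t then 1 else 0) / propensityScore t P Z
        * (outcomeModel f P (f Y) Z - meanOutcome t f P Z)
      + meanOutcome t f P Z - targetParameter t P

/-! ### The models -/

variable [StandardBorelSpace 𝒴] [StandardBorelSpace 𝒵]

/-- `W = f(Y)` is a surrogate representation under `P`: `Y ⟂ {L, T} | W, Z`. -/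
def IsSurrogateRepresentation {p : ℕ} (P : ProbabilityMeasure (FullData 𝒴 𝒵))
    (f : 𝒴 → EuclideanSpace ℝ (Fin p)) : Prop :=
  ∃ hf : Measurable f,
    CondIndepFun (MeasurableSpace.comap (reprControls f) inferInstance)
      (measurable_reprControls hf).comap_le
      text (fun x => (concept x, predictor x)) (P : Measure (FullData 𝒴 𝒵))

/-- What the two models below share: error-free annotations, a positive labelling probability,
existence of a `p`-dimensional surrogate representation, and the regularity bounds
`E[L̃²]^{1/2} ≤ c₁` and `π_t(Z) ≥ c₂ > 0`. -/
structure CommonConditions (t : Fin 2) (p : ℕ) (c : ℝ≥0 × ℝ≥0)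
    (P : ProbabilityMeasure (FullData 𝒴 𝒵)) : Prop where
  perfect : ∀ᵐ x ∂(P : Measure (FullData 𝒴 𝒵)), annotation x = concept x
  sampled_pos : 0 < (P : Measure (FullData 𝒴 𝒵)) {x | sampled x = 1}
  sufficiency : ∃ f : 𝒴 → EuclideanSpace ℝ (Fin p), IsSurrogateRepresentation P f
  moment : eLpNorm annotation 2 (P : Measure (FullData 𝒴 𝒵)) ≤ c.1
  pos : 0 < c.2
  positivity : ∀ᵐ x ∂(P : Measure (FullData 𝒴 𝒵)), (c.2 : ℝ) ≤ propensityScore t P (controls x)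

/-- The perfect-annotation model: `L = g(Y)` for a deterministic coding rule `g` with values in
`𝓛`, and the labelled units are a random subset, `{T, Y, Z} ⟂ S`. -/
structure IsPerfectAnnotation (t : Fin 2) (𝓛 : Set ℝ) (p : ℕ) (c : ℝ≥0 × ℝ≥0)
    (P : ProbabilityMeasure (FullData 𝒴 𝒵)) : Prop extends CommonConditions t p c P where
  coding : ∃ g : 𝒴 → ℝ, Measurable g ∧ (∀ y, g y ∈ 𝓛) ∧
    ∀ᵐ x ∂(P : Measure (FullData 𝒴 𝒵)), concept x = g (text x)
  sampling : IndepFun (fun x => (predictor x, text x, controls x)) sampled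
    (P : Measure (FullData 𝒴 𝒵))

/-- The same model with a possibly random coding of the text that is blind to the predictor:
`T ⟂ L | Y, Z` in place of `L = g(Y)`, and `{T, Y, Z, L} ⟂ S`. -/
structure IsBlindAnnotation (t : Fin 2) (𝓛 : Set ℝ) (p : ℕ) (c : ℝ≥0 × ℝ≥0)
    (P : ProbabilityMeasure (FullData 𝒴 𝒵)) : Prop extends CommonConditions t p c P where
  support : ∀ᵐ x ∂(P : Measure (FullData 𝒴 𝒵)), concept x ∈ 𝓛
  blind : CondIndepFun
    (MeasurableSpace.comap (fun x : FullData 𝒴 𝒵 => (text x, controls x)) inferInstance)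
    (measurable_text.prodMk measurable_controls).comap_le
    predictor concept (P : Measure (FullData 𝒴 𝒵))
  sampling : IndepFun (fun x => (predictor x, text x, controls x, concept x)) sampled
    (P : Measure (FullData 𝒴 𝒵))

/-- The perfect-annotation model with regularity constants `c = (c₁, c₂)`. -/
def perfectAnnotationModel (𝒴 𝒵 : Type*) [MeasurableSpace 𝒴] [MeasurableSpace 𝒵]
    [StandardBorelSpace 𝒴] [StandardBorelSpace 𝒵] (t : Fin 2) (𝓛 : Set ℝ) (p : ℕ)
    (c : ℝ≥0 × ℝ≥0) : Set (ProbabilityMeasure (FullData 𝒴 𝒵)) :=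
  {P | IsPerfectAnnotation t 𝓛 p c P}

/-- The blind-annotation model with regularity constants `c = (c₁, c₂)`. -/
def blindAnnotationModel (𝒴 𝒵 : Type*) [MeasurableSpace 𝒴] [MeasurableSpace 𝒵]
    [StandardBorelSpace 𝒴] [StandardBorelSpace 𝒵] (t : Fin 2) (𝓛 : Set ℝ) (p : ℕ)
    (c : ℝ≥0 × ℝ≥0) : Set (ProbabilityMeasure (FullData 𝒴 𝒵)) :=
  {P | IsBlindAnnotation t 𝓛 p c P}

end Data

end SRI

end

/-!
The influence function is shown to be a gradient along every regular submodel of the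
blind-annotation model and to lie in the tangent space of each of the two models. Since a
deterministic coding is blind to the predictor (`IsPerfectAnnotation.isBlindAnnotation`), the
gradient property passes to the perfect-annotation model.

*Gradient.* Blindness and the surrogate property give `E[L | T, Y, Z] = μ(f(Y), Z)`, and sampling is
independent of `(T, Y, Z, L)`. Hence the functions that enter the formula are regressions of the
observed law, whatever surrogate representation they are computed from
(`IsBlindAnnotation.isNuisance`), and `Ψ_t` is the mean of `m̄_t(Z)`. The uncentred influence
function is a doubly robust moment: its bias at another law is a sum of products of errors in two
different nuisance parameters (`IsNuisance.integral_doublyRobust_sub`). Along a family that is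
differentiable in quadratic mean, the errors of `P(S = 1)`, `ρ_t` and `π_t` are `O(ε)` in `L²`,
because a bounded function that is conditionally centred at `ε = 0` has a conditional bias bounded
by the Hellinger distance (`integral_sq_le_hellinger`). As the model bounds second moments only, the
errors of the regressions `μ` and `m̄_t` are merely bounded in `L²` and small in `L¹`. This suffices
for the products to be `o(ε)`: the errors are small off an event of small probability, and on such an
event the bias itself is `o(ε)`, by uniform integrability of the squared score
(`IsDiffQuadraticMean.exists_forall_abs_integral_mul_le`). The regressions in the fixed moment are
truncated beforehand, which costs an arbitrarily small constant. What is left is the derivative of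
the mean of a fixed function, its covariance with the score (`hasDerivAt_of_isNuisance`). The laws
of a submodel may need different surrogate representations; this is harmless, as the argument only
sees the observed laws and their regressions.

*Tangent space.* The influence function is the sum of `S · (R - E[R | W, Z])`, where
`R = ρ_t L / (π_t P(S = 1))`, and of a mean-zero function of `(T, W, Z)`. For a bounded direction `b`
the linear tilts `(1 + ε b) P` form a regular submodel with score `E[b | O]`, as soon as they stay in
the model (`exists_isRegularSubmodel_tilt`). Conditional independence of `G` and `V` given `k`
survives weights in `(k, G)` (`condIndepFun_withDensity`), so directions in `(T, W, Z)` are admissible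
in both models and directions in `(L, W, Z)` in the blind-annotation model. The observed score of
`R - E[R | W, Z]` is this residual on the labelled units and zero on the others, since its conditional
mean given `(T, Y, Z)` vanishes (`IsBlindAnnotation.setIntegral_conceptResidual`). Truncation extends
both classes of scores to `L²`. Under perfect annotation `L` is a function of `Y` that does not depend
on `Y` given `(W, Z)`, hence a function of `(W, Z)` (`IsPerfectAnnotation.concept_ae_eq`); the first
summand vanishes, and the influence function is a function of `(T, W, Z)`.
-/

noncomputable section

namespace SRI

/-! ### Laws with square-root densities -/

section SqrtDensity

variable {X : Type*} [MeasurableSpace X] {ν : Measure X}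

/-- The measure with density `q` with respect to `ν`. -/
abbrev densityLaw (ν : Measure X) (q : X → ℝ≥0) : Measure X :=
  ν.withDensity (fun x => (q x : ℝ≥0∞))

lemma abs_integral_mul_le_sqrt {f g : X → ℝ} (hf : Measurable f) (hg : Measurable g)
    (hf2 : Integrable (fun x => f x ^ 2) ν) (hg2 : Integrable (fun x => g x ^ 2) ν) :
    |∫ x, f x * g x ∂ν| ≤ √(∫ x, f x ^ 2 ∂ν) * √(∫ x, g x ^ 2 ∂ν) := by
  have h1 : MemLp f 2 ν := (memLp_two_iff_integrable_sq hf.aestronglyMeasurable).2 hf2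
  have h2 : MemLp g 2 ν := (memLp_two_iff_integrable_sq hg.aestronglyMeasurable).2 hg2
  have h := integral_mul_norm_le_Lp_mul_Lq (μ := ν) (f := f) (g := g)
    (p := 2) (q := 2) (by constructor <;> norm_num) (by simpa using h1) (by simpa using h2)
  have h3 : |∫ x, f x * g x ∂ν| ≤ ∫ x, ‖f x‖ * ‖g x‖ ∂ν := by
    rw [← Real.norm_eq_abs]
    refine (norm_integral_le_integral_norm _).trans (le_of_eq ?_)
    simp
  refine h3.trans (h.trans (le_of_eq ?_))
  simp [Real.sqrt_eq_rpow]

lemma integrable_mul_of_sq {f g : X → ℝ} (hf : Measurable f) (hg : Measurable g)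
    (hf2 : Integrable (fun x => f x ^ 2) ν) (hg2 : Integrable (fun x => g x ^ 2) ν) :
    Integrable (fun x => f x * g x) ν :=
  ((memLp_two_iff_integrable_sq hf.aestronglyMeasurable).2 hf2).integrable_mul
    ((memLp_two_iff_integrable_sq hg.aestronglyMeasurable).2 hg2)

lemma integrable_of_sq [IsFiniteMeasure ν] {f : X → ℝ} (hf : Measurable f)
    (hf2 : Integrable (fun x => f x ^ 2) ν) : Integrable f ν :=
  ((memLp_two_iff_integrable_sq hf.aestronglyMeasurable).2 hf2).integrable (by norm_num)

lemma integral_densityLaw {q : X → ℝ≥0} (hq : Measurable q) (f : X → ℝ) :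
    ∫ x, f x ∂(densityLaw ν q) = ∫ x, f x * √(q x : ℝ) ^ 2 ∂ν := by
  rw [integral_withDensity_eq_integral_smul hq]
  refine integral_congr_ae (ae_of_all _ fun x => ?_)
  simp [NNReal.smul_def, mul_comm]

lemma integrable_densityLaw {q : X → ℝ≥0} (hq : Measurable q) (f : X → ℝ) :
    Integrable f (densityLaw ν q) ↔ Integrable (fun x => f x * √(q x : ℝ) ^ 2) ν := by
  rw [integrable_withDensity_iff_integrable_smul hq]
  refine integrable_congr (ae_of_all _ fun x => ?_)
  simp [NNReal.smul_def, mul_comm]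

lemma measurable_sqrt_density {q : X → ℝ≥0} (hq : Measurable q) :
    Measurable (fun x => √(q x : ℝ)) := hq.coe_nnreal_real.sqrt

lemma integrable_sqrt_density_sq {q : X → ℝ≥0} (hq : Measurable q)
    [IsFiniteMeasure (densityLaw ν q)] : Integrable (fun x => √(q x : ℝ) ^ 2) ν := by
  simpa using (integrable_densityLaw hq (fun _ => (1 : ℝ))).1 (integrable_const _)

lemma integrable_sub_sqrt_density_sq {q r : X → ℝ≥0} (hq : Measurable q) (hr : Measurable r)
    [IsFiniteMeasure (densityLaw ν q)] [IsFiniteMeasure (densityLaw ν r)] :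
    Integrable (fun x => (√(q x : ℝ) - √(r x : ℝ)) ^ 2) ν := by
  have h1 := (memLp_two_iff_integrable_sq (measurable_sqrt_density hq).aestronglyMeasurable).2
    (integrable_sqrt_density_sq (ν := ν) hq)
  have h2 := (memLp_two_iff_integrable_sq (measurable_sqrt_density hr).aestronglyMeasurable).2
    (integrable_sqrt_density_sq (ν := ν) hr)
  exact (h1.sub h2).integrable_sq

lemma integrable_mul_sqrt_density_sq {q : X → ℝ≥0} (hq : Measurable q) {f : X → ℝ}
    (hf : Integrable (fun x => f x ^ 2) (densityLaw ν q)) :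
    Integrable (fun x => (f x * √(q x : ℝ)) ^ 2) ν := by
  simpa [mul_pow] using (integrable_densityLaw hq _).1 hf

lemma integrable_indicator_sq {f : X → ℝ} {A : Set X} (hA : MeasurableSet A)
    (hf : Integrable (fun x => f x ^ 2) ν) :
    Integrable (fun x => (A.indicator f x) ^ 2) ν := by
  refine (hf.indicator hA).congr (ae_of_all _ fun x => ?_)
  by_cases hx : x ∈ A <;> simp [hx]

lemma integral_indicator_sq {f : X → ℝ} {A : Set X} (hA : MeasurableSet A) :
    ∫ x, (A.indicator f x) ^ 2 ∂ν = ∫ x in A, f x ^ 2 ∂ν := by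
  rw [← integral_indicator hA]
  refine integral_congr_ae (ae_of_all _ fun x => ?_)
  by_cases hx : x ∈ A <;> simp [hx]

/-- The means of `f` under two laws differ by at most the Hellinger distance on the support of `f`
times the sum of its `L²` norms. -/
lemma abs_integral_sub_integral_le {q r : X → ℝ≥0} (hq : Measurable q) (hr : Measurable r)
    [IsFiniteMeasure (densityLaw ν q)] [IsFiniteMeasure (densityLaw ν r)]
    {f : X → ℝ} (hf : Measurable f) {A : Set X} (hA : MeasurableSet A) (hfA : ∀ x, x ∉ A → f x = 0)
    (hfq : Integrable (fun x => f x ^ 2) (densityLaw ν q))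
    (hfr : Integrable (fun x => f x ^ 2) (densityLaw ν r)) :
    |∫ x, f x ∂(densityLaw ν q) - ∫ x, f x ∂(densityLaw ν r)| ≤
      (√(∫ x, f x ^ 2 ∂(densityLaw ν q)) + √(∫ x, f x ^ 2 ∂(densityLaw ν r))) *
        √(∫ x in A, (√(q x : ℝ) - √(r x : ℝ)) ^ 2 ∂ν) := by
  have hmq := measurable_sqrt_density hq
  have hmr := measurable_sqrt_density hr
  set d : X → ℝ := fun x => √(q x : ℝ) - √(r x : ℝ) with hd
  have hdm : Measurable (A.indicator d) := (hmq.sub hmr).indicator hA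
  have hd2 : Integrable (fun x => (A.indicator d x) ^ 2) ν :=
    integrable_indicator_sq hA (integrable_sub_sqrt_density_sq hq hr)
  have h1 := abs_integral_mul_le_sqrt (hf.mul hmq) hdm (integrable_mul_sqrt_density_sq hq hfq) hd2
  have h2 := abs_integral_mul_le_sqrt (hf.mul hmr) hdm (integrable_mul_sqrt_density_sq hr hfr) hd2
  have i1 := integrable_mul_of_sq (hf.mul hmq) hdm (integrable_mul_sqrt_density_sq hq hfq) hd2
  have i2 := integrable_mul_of_sq (hf.mul hmr) hdm (integrable_mul_sqrt_density_sq hr hfr) hd2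
  simp only [Pi.mul_apply] at h1 h2 i1 i2
  have e1 := (integrable_densityLaw hq f).1 (integrable_of_sq hf hfq)
  have e2 := (integrable_densityLaw hr f).1 (integrable_of_sq hf hfr)
  have key : ∫ x, f x ∂(densityLaw ν q) - ∫ x, f x ∂(densityLaw ν r) =
      (∫ x, (f x * √(q x : ℝ)) * A.indicator d x ∂ν) +
        ∫ x, (f x * √(r x : ℝ)) * A.indicator d x ∂ν := by
    rw [integral_densityLaw hq, integral_densityLaw hr, ← integral_sub e1 e2, ← integral_add i1 i2]
    refine integral_congr_ae (ae_of_all _ fun x => ?_)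
    by_cases hx : x ∈ A
    · simp only [Set.indicator_of_mem hx, hd]; ring
    · simp [hfA x hx, hx]
  have eq1 : ∫ x, (f x * √(q x : ℝ)) ^ 2 ∂ν = ∫ x, f x ^ 2 ∂(densityLaw ν q) := by
    rw [integral_densityLaw hq]; simp only [mul_pow]
  have eq2 : ∫ x, (f x * √(r x : ℝ)) ^ 2 ∂ν = ∫ x, f x ^ 2 ∂(densityLaw ν r) := by
    rw [integral_densityLaw hr]; simp only [mul_pow]
  rw [integral_indicator_sq hA] at h1 h2
  rw [eq1] at h1
  rw [eq2] at h2
  rw [key, add_mul]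
  exact (abs_add_le _ _).trans (add_le_add h1 h2)

lemma integrable_of_abs_le [IsFiniteMeasure ν] {f : X → ℝ} (hf : Measurable f) {C : ℝ}
    (h : ∀ x, |f x| ≤ C) : Integrable f ν :=
  Integrable.of_bound hf.aestronglyMeasurable C (ae_of_all _ h)

/-- A bounded function `e` that is centred along `w` under the base law has conditional bias of the
order of the Hellinger distance: if `w` acts as the conditional mean of `e` under the law with
density `q`, then its `L²` norm is controlled by the Hellinger distance on a set supporting `w`. -/
lemma integral_sq_le_hellinger {q r : X → ℝ≥0} (hq : Measurable q) (hr : Measurable r)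
    [IsFiniteMeasure (densityLaw ν q)] [IsFiniteMeasure (densityLaw ν r)]
    {e w : X → ℝ} (he : Measurable e) (hw : Measurable w) (he1 : ∀ x, |e x| ≤ 1)
    (hw1 : ∀ x, |w x| ≤ 1)
    {A : Set X} (hA : MeasurableSet A) (hwA : ∀ x, x ∉ A → w x = 0)
    (h0 : ∫ x, e x * w x ∂(densityLaw ν r) = 0)
    (h1 : ∫ x, e x * w x ∂(densityLaw ν q) = ∫ x, w x ^ 2 ∂(densityLaw ν q)) :
    ∫ x, w x ^ 2 ∂(densityLaw ν q) ≤ 6 * ∫ x in A, (√(q x : ℝ) - √(r x : ℝ)) ^ 2 ∂ν := by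
  have hew : ∀ x, |e x * w x| ≤ 1 := fun x => by
    rw [abs_mul]; exact mul_le_one₀ (he1 x) (abs_nonneg _) (hw1 x)
  have iw : Integrable (fun x => w x ^ 2) (densityLaw ν q) :=
    integrable_of_abs_le (hw.pow_const 2) (C := 1) fun x => by
      rw [abs_pow]; exact pow_le_one₀ (abs_nonneg _) (hw1 x)
  have iq : Integrable (fun x => e x * w x) (densityLaw ν q) :=
    integrable_of_abs_le (he.mul hw) hew
  have ir : Integrable (fun x => e x * w x) (densityLaw ν r) :=
    integrable_of_abs_le (he.mul hw) hew
  have iq' := (integrable_densityLaw hq _).1 iq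
  have ir' := (integrable_densityLaw hr _).1 ir
  have iw' := (integrable_densityLaw hq _).1 iw
  have id := (integrable_sub_sqrt_density_sq (ν := ν) hq hr).indicator hA
  have key : ∫ x, w x ^ 2 ∂(densityLaw ν q) =
      ∫ x, (e x * w x * √(q x : ℝ) ^ 2 - e x * w x * √(r x : ℝ) ^ 2) ∂ν := by
    rw [integral_sub iq' ir', ← integral_densityLaw hq, ← integral_densityLaw hr, h0, h1, sub_zero]
  have bound : ∫ x, (e x * w x * √(q x : ℝ) ^ 2 - e x * w x * √(r x : ℝ) ^ 2) ∂ν ≤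
      ∫ x, ((w x ^ 2 * √(q x : ℝ) ^ 2) / 2 +
        3 * A.indicator (fun x => (√(q x : ℝ) - √(r x : ℝ)) ^ 2) x) ∂ν := by
    refine integral_mono (iq'.sub ir') ((iw'.div_const 2).add (id.const_mul 3)) fun x => ?_
    by_cases hx : x ∈ A
    · simp only [Set.indicator_of_mem hx]
      set a := √(q x : ℝ)
      set b := √(r x : ℝ)
      have h3 : e x * w x * a ^ 2 - e x * w x * b ^ 2 =
          e x * (2 * (w x * a) * (a - b)) - (e x * w x) * (a - b) ^ 2 := by ring
      have h4 : e x * (2 * (w x * a) * (a - b)) ≤ |2 * (w x * a) * (a - b)| := by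
        refine (le_abs_self _).trans ?_
        rw [abs_mul]
        exact mul_le_of_le_one_left (abs_nonneg _) (he1 x)
      have h5 : |2 * (w x * a) * (a - b)| ≤ (w x * a) ^ 2 / 2 + 2 * (a - b) ^ 2 := by
        rw [abs_le]
        constructor <;> nlinarith [sq_nonneg (w x * a - 2 * (a - b)),
          sq_nonneg (w x * a + 2 * (a - b))]
      have h6 : -((e x * w x) * (a - b) ^ 2) ≤ (a - b) ^ 2 := by
        nlinarith [(abs_le.1 (hew x)).1, sq_nonneg (a - b)]
      rw [h3]
      nlinarith
    · simp only [hwA x hx, Set.indicator_of_notMem hx]; simp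
  rw [integral_add (iw'.div_const 2) (id.const_mul 3), integral_div, integral_const_mul,
    integral_indicator hA, ← integral_densityLaw hq, ← key] at bound
  linarith

end SqrtDensity

/-! ### Differentiability in quadratic mean -/

section QuadraticMean

variable {X : Type*} [MeasurableSpace X] {ν : Measure X} {q : ℝ → X → ℝ≥0} {s : X → ℝ}

/-- The family of laws with densities `q ε` with respect to `ν` is differentiable in quadratic mean
at `ε = 0` with score `s`. -/
structure IsDiffQuadraticMean (ν : Measure X) (q : ℝ → X → ℝ≥0) (s : X → ℝ) : Prop where
  measurable_density : ∀ ε, Measurable (q ε)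
  measurable_score : Measurable s
  prob_zero : IsProbabilityMeasure (densityLaw ν (q 0))
  prob : ∀ᶠ ε in 𝓝[≠] (0 : ℝ), IsProbabilityMeasure (densityLaw ν (q ε))
  score_sq : Integrable (fun x => s x ^ 2) (densityLaw ν (q 0))
  tendsto : Tendsto (fun ε : ℝ =>
    (∫ x, (√(q ε x : ℝ) - √(q 0 x : ℝ) - ε * (s x * √(q 0 x : ℝ) / 2)) ^ 2 ∂ν) / ε ^ 2)
        (𝓝[≠] 0) (𝓝 0)

lemma eventually_abs_lt_nhdsNE {r : ℝ} (hr : 0 < r) : ∀ᶠ ε in 𝓝[≠] (0 : ℝ), |ε| < r := by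
  have : ∀ᶠ ε in 𝓝 (0 : ℝ), |ε| < r := by
    have := (continuous_abs (G := ℝ)).tendsto 0
    rw [abs_zero] at this
    exact this.eventually (gt_mem_nhds hr)
  exact this.filter_mono nhdsWithin_le_nhds

lemma eventually_ne_zero_nhdsNE : ∀ᶠ ε in 𝓝[≠] (0 : ℝ), ε ≠ 0 := eventually_mem_nhdsWithin

namespace IsDiffQuadraticMean

lemma integrable_deriv_sq (H : IsDiffQuadraticMean ν q s) :
    Integrable (fun x => (s x * √(q 0 x : ℝ) / 2) ^ 2) ν := by
  refine ((integrable_mul_sqrt_density_sq (H.measurable_density 0) H.score_sq).div_const 4).congr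
    (ae_of_all _ fun x => ?_)
  simp only; ring

lemma measurable_deriv (H : IsDiffQuadraticMean ν q s) :
    Measurable (fun x => s x * √(q 0 x : ℝ) / 2) :=
  (H.measurable_score.mul (measurable_sqrt_density (H.measurable_density 0))).div_const 2

/-- The squared norm of the derivative `s √q₀ / 2` of the root density is a quarter of the Fisher
information. -/
lemma setIntegral_deriv_sq (H : IsDiffQuadraticMean ν q s) {A : Set X} (hA : MeasurableSet A) :
    ∫ x in A, (s x * √(q 0 x : ℝ) / 2) ^ 2 ∂ν = (∫ x in A, s x ^ 2 ∂(densityLaw ν (q 0))) / 4 := by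
  rw [← integral_indicator hA, ← integral_indicator hA,
      integral_densityLaw (H.measurable_density 0),
    ← integral_div]
  refine integral_congr_ae (ae_of_all _ fun x => ?_)
  by_cases hx : x ∈ A
  · simp only [hx, Set.indicator_of_mem]; ring
  · simp [hx]

/-- The increments of the root density are `O(ε)`, and locally they are of the size of the score. -/
lemma eventually_hellinger_le (H : IsDiffQuadraticMean ν q s) {η : ℝ} (hη : 0 < η) :
    ∀ᶠ ε in 𝓝[≠] (0 : ℝ), ∀ A : Set X, MeasurableSet A →
      ∫ x in A, (√(q ε x : ℝ) - √(q 0 x : ℝ)) ^ 2 ∂ν ≤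
        ε ^ 2 * (η + ∫ x in A, s x ^ 2 ∂(densityLaw ν (q 0))) := by
  have := H.prob_zero
  filter_upwards [H.tendsto.eventually (gt_mem_nhds (half_pos hη)), H.prob,
    eventually_ne_zero_nhdsNE] with ε h1 h2 h3 A hA
  have hε : 0 < ε ^ 2 := by positivity
  rw [div_lt_iff₀ hε] at h1
  have i0 := integrable_sub_sqrt_density_sq (ν := ν) (H.measurable_density ε)
      (H.measurable_density 0)
  have m0 := (measurable_sqrt_density (H.measurable_density ε)).sub
    (measurable_sqrt_density (H.measurable_density 0))
  have j1 := (memLp_two_iff_integrable_sq m0.aestronglyMeasurable).2 i0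
  have j2 := ((memLp_two_iff_integrable_sq H.measurable_deriv.aestronglyMeasurable).2
    H.integrable_deriv_sq).const_mul ε
  have i1 := (j1.sub j2).integrable_sq
  have i2 := H.integrable_deriv_sq
  simp only [Pi.sub_apply] at i1
  have h4 : ∫ x in A, (√(q ε x : ℝ) - √(q 0 x : ℝ)) ^ 2 ∂ν ≤
      ∫ x in A, (2 * (√(q ε x : ℝ) - √(q 0 x : ℝ) - ε * (s x * √(q 0 x : ℝ) / 2)) ^ 2 +
        2 * ε ^ 2 * (s x * √(q 0 x : ℝ) / 2) ^ 2) ∂ν := by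
    refine integral_mono i0.integrableOn
      ((i1.const_mul 2).add (i2.const_mul (2 * ε ^ 2))).integrableOn fun x => ?_
    simp only
    nlinarith [sq_nonneg (√(q ε x : ℝ) - √(q 0 x : ℝ) - 2 * (ε * (s x * √(q 0 x : ℝ) / 2)))]
  rw [integral_add (i1.const_mul 2).integrableOn (i2.const_mul (2 * ε ^ 2)).integrableOn,
    integral_const_mul, integral_const_mul, H.setIntegral_deriv_sq hA] at h4
  have h5 : ∫ x in A, (√(q ε x : ℝ) - √(q 0 x : ℝ) - ε * (s x * √(q 0 x : ℝ) / 2)) ^ 2 ∂ν ≤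
      ∫ x, (√(q ε x : ℝ) - √(q 0 x : ℝ) - ε * (s x * √(q 0 x : ℝ) / 2)) ^ 2 ∂ν :=
    setIntegral_le_integral i1 (ae_of_all _ fun x => sq_nonneg _)
  have h6 : 0 ≤ ∫ x in A, s x ^ 2 ∂(densityLaw ν (q 0)) :=
    setIntegral_nonneg hA fun x _ => sq_nonneg _
  nlinarith [mul_nonneg hε.le h6]

lemma exists_hellinger_le (H : IsDiffQuadraticMean ν q s) :
    ∃ C : ℝ, 0 < C ∧ ∀ᶠ ε in 𝓝[≠] (0 : ℝ),
      ∫ x, (√(q ε x : ℝ) - √(q 0 x : ℝ)) ^ 2 ∂ν ≤ (C * ε) ^ 2 := by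
  have h0 : 0 ≤ ∫ x, s x ^ 2 ∂(densityLaw ν (q 0)) := integral_nonneg fun x => sq_nonneg _
  refine ⟨√(1 + ∫ x, s x ^ 2 ∂(densityLaw ν (q 0))), by positivity, ?_⟩
  filter_upwards [H.eventually_hellinger_le one_pos] with ε h
  have := h Set.univ MeasurableSet.univ
  rw [setIntegral_univ, setIntegral_univ] at this
  rw [mul_pow, Real.sq_sqrt (by positivity)]
  linarith

/-- Uniformly over functions with second moments at most `K`, the means under the laws at `ε` and
at `0` differ by `O(ε)`. -/
lemma exists_abs_integral_sub_le (H : IsDiffQuadraticMean ν q s) :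
    ∃ C : ℝ, 0 < C ∧ ∀ᶠ ε in 𝓝[≠] (0 : ℝ), ∀ (K : ℝ) (f : X → ℝ), Measurable f →
      Integrable (fun x => f x ^ 2) (densityLaw ν (q ε)) →
      Integrable (fun x => f x ^ 2) (densityLaw ν (q 0)) →
      ∫ x, f x ^ 2 ∂(densityLaw ν (q ε)) ≤ K → ∫ x, f x ^ 2 ∂(densityLaw ν (q 0)) ≤ K →
      |∫ x, f x ∂(densityLaw ν (q ε)) - ∫ x, f x ∂(densityLaw ν (q 0))| ≤ C * √K * |ε| := by
  have := H.prob_zero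
  obtain ⟨C, hC, h⟩ := H.exists_hellinger_le
  refine ⟨2 * C, by positivity, ?_⟩
  filter_upwards [h, H.prob] with ε h hp K f hf i1 i2 b1 b2
  have h1 := abs_integral_sub_integral_le (ν := ν) (H.measurable_density ε) (H.measurable_density 0)
    hf MeasurableSet.univ (fun x hx => absurd (Set.mem_univ x) hx) i1 i2
  rw [setIntegral_univ] at h1
  have h2 : √(∫ x, (√(q ε x : ℝ) - √(q 0 x : ℝ)) ^ 2 ∂ν) ≤ C * |ε| := by
    refine (Real.sqrt_le_sqrt h).trans (le_of_eq ?_)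
    rw [Real.sqrt_sq_eq_abs, abs_mul, abs_of_pos hC]
  have h3 := Real.sqrt_le_sqrt b1
  have h4 := Real.sqrt_le_sqrt b2
  refine h1.trans ?_
  calc _ ≤ (√K + √K) * (C * |ε|) := by gcongr
    _ = _ := by ring

/-- Means of a fixed function with locally bounded second moments are differentiable along the
family, with derivative the integral against the score. Convergence in quadratic mean pairs directly
with bounded functions only; the part of `f` above a level `N` meets the derivative `D` of the root
density on the event `{|f| > N}`, where `D` is small in `L²`. -/
lemma tendsto_integral_sub_div (H : IsDiffQuadraticMean ν q s) {f : X → ℝ} (hf : Measurable f)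
    {K : ℝ} (hK : ∀ᶠ ε in 𝓝[≠] (0 : ℝ), Integrable (fun x => f x ^ 2) (densityLaw ν (q ε)) ∧
      ∫ x, f x ^ 2 ∂(densityLaw ν (q ε)) ≤ K)
    (hf0 : Integrable (fun x => f x ^ 2) (densityLaw ν (q 0)))
    (hK0 : ∫ x, f x ^ 2 ∂(densityLaw ν (q 0)) ≤ K) :
    Tendsto (fun ε => (∫ x, f x ∂(densityLaw ν (q ε)) - ∫ x, f x ∂(densityLaw ν (q 0))) / ε)
      (𝓝[≠] 0) (𝓝 (∫ x, f x * s x ∂(densityLaw ν (q 0)))) := by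
  have := H.prob_zero
  have hK00 : 0 ≤ K := (integral_nonneg fun x => sq_nonneg _).trans hK0
  set D : X → ℝ := fun x => s x * √(q 0 x : ℝ) / 2 with hD
  have hDm : Measurable D := H.measurable_deriv
  have hDi : Integrable (fun x => D x ^ 2) ν := H.integrable_deriv_sq
  set B : ℕ → Set X := fun N => {x | (N : ℝ) < |f x|} with hB
  have hBm : ∀ N, MeasurableSet (B N) := fun N => measurableSet_lt measurable_const hf.abs
  have hBlim : Tendsto (fun N => ∫ x in B N, D x ^ 2 ∂ν) atTop (𝓝 0) := by
    have hanti : Antitone B := fun a b hab x hx => by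
      simp only [hB, Set.mem_ofPred_eq] at hx ⊢
      exact lt_of_le_of_lt (by exact_mod_cast hab) hx
    have hempty : ⋂ N, B N = ∅ := by
      ext x
      simp only [hB, Set.mem_iInter, Set.mem_ofPred_eq, Set.mem_empty_iff_false, iff_false,
        not_forall, not_lt]
      exact exists_nat_ge _
    have := tendsto_setIntegral_of_antitone (μ := ν) hBm hanti ⟨0, hDi.integrableOn⟩
    simpa [hempty] using this
  rw [Metric.tendsto_nhds]
  intro η hη
  obtain ⟨N, hN⟩ : ∃ N, √(∫ x in B N, D x ^ 2 ∂ν) * √(4 * K) < η / 3 := by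
    have : Tendsto (fun N => √(∫ x in B N, D x ^ 2 ∂ν) * √(4 * K)) atTop (𝓝 0) := by
      have := (hBlim.sqrt).mul_const (√(4 * K))
      simpa using this
    exact (this.eventually (gt_mem_nhds (by positivity))).exists
  obtain ⟨C, hC, hCe⟩ := H.exists_hellinger_le
  set M : ℝ := N * √(∫ x, D x ^ 2 ∂ν) * C with hM
  have hM0 : 0 ≤ M := by positivity
  have hlim1 : ∀ᶠ ε in 𝓝[≠] (0 : ℝ),
      √((∫ x, (√(q ε x : ℝ) - √(q 0 x : ℝ) - ε * D x) ^ 2 ∂ν) / ε ^ 2)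
      * √(4 * K) < η / 3 := by
    have := (H.tendsto.sqrt).mul_const (√(4 * K))
    rw [Real.sqrt_zero, zero_mul] at this
    exact this.eventually (gt_mem_nhds (by positivity))
  have hlim2 : ∀ᶠ ε in 𝓝[≠] (0 : ℝ), M * |ε| < η / 3 := by
    filter_upwards [eventually_abs_lt_nhdsNE (r := η / 3 / (M + 1)) (by positivity)] with ε h
    rw [lt_div_iff₀ (by positivity)] at h
    nlinarith [abs_nonneg ε]
  filter_upwards [hlim1, hlim2, hCe, H.prob, hK, eventually_ne_zero_nhdsNE] with ε g1 g2 g3 g4 g5 hε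
  obtain ⟨hfε, hKε⟩ := g5
  have ha := measurable_sqrt_density (H.measurable_density ε)
  have hb := measurable_sqrt_density (H.measurable_density 0)
  set a : X → ℝ := fun x => √(q ε x : ℝ) with had
  set b : X → ℝ := fun x => √(q 0 x : ℝ) with hbd
  have ifa : Integrable (fun x => (f x * a x) ^ 2) ν :=
    integrable_mul_sqrt_density_sq (H.measurable_density ε) hfε
  have ifb : Integrable (fun x => (f x * b x) ^ 2) ν :=
    integrable_mul_sqrt_density_sq (H.measurable_density 0) hf0
  have efa : ∫ x, (f x * a x) ^ 2 ∂ν ≤ K := by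
    refine le_trans (le_of_eq ?_) hKε
    rw [integral_densityLaw (H.measurable_density ε)]; simp only [mul_pow, had]
  have efb : ∫ x, (f x * b x) ^ 2 ∂ν ≤ K := by
    refine le_trans (le_of_eq ?_) hK0
    rw [integral_densityLaw (H.measurable_density 0)]; simp only [mul_pow, hbd]
  have mfa : MemLp (fun x => f x * a x) 2 ν :=
    (memLp_two_iff_integrable_sq (hf.mul ha).aestronglyMeasurable).2 ifa
  have mfb : MemLp (fun x => f x * b x) 2 ν :=
    (memLp_two_iff_integrable_sq (hf.mul hb).aestronglyMeasurable).2 ifb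
  have isum : Integrable (fun x => (f x * a x + f x * b x) ^ 2) ν := (mfa.add mfb).integrable_sq
  have isub : Integrable (fun x => (f x * a x - f x * b x) ^ 2) ν := (mfa.sub mfb).integrable_sq
  have bsum : ∫ x, (f x * a x + f x * b x) ^ 2 ∂ν ≤ 4 * K := by
    calc _ ≤ ∫ x, (2 * (f x * a x) ^ 2 + 2 * (f x * b x) ^ 2) ∂ν :=
          integral_mono isum ((ifa.const_mul 2).add (ifb.const_mul 2)) fun x => by
            simp only; nlinarith [sq_nonneg (f x * a x - f x * b x)]
      _ ≤ _ := by
          rw [integral_add (ifa.const_mul 2) (ifb.const_mul 2), integral_const_mul,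
            integral_const_mul]; linarith
  have bsub : ∫ x, (f x * a x - f x * b x) ^ 2 ∂ν ≤ 4 * K := by
    calc _ ≤ ∫ x, (2 * (f x * a x) ^ 2 + 2 * (f x * b x) ^ 2) ∂ν :=
          integral_mono isub ((ifa.const_mul 2).add (ifb.const_mul 2)) fun x => by
            simp only; nlinarith [sq_nonneg (f x * a x + f x * b x)]
      _ ≤ _ := by
          rw [integral_add (ifa.const_mul 2) (ifb.const_mul 2), integral_const_mul,
            integral_const_mul]; linarith
  have id : Integrable (fun x => (a x - b x) ^ 2) ν :=
    integrable_sub_sqrt_density_sq (H.measurable_density ε) (H.measurable_density 0)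
  have jd := (memLp_two_iff_integrable_sq (ha.sub hb).aestronglyMeasurable).2 id
  have jD := ((memLp_two_iff_integrable_sq hDm.aestronglyMeasurable).2 hDi)
  have ir : Integrable (fun x => (a x - b x - ε * D x) ^ 2) ν :=
    (jd.sub (jD.const_mul ε)).integrable_sq
  have mr : Measurable (fun x => a x - b x - ε * D x) := (ha.sub hb).sub (hDm.const_mul ε)
  set g : X → ℝ := (B N)ᶜ.indicator f with hg
  have hgm : Measurable g := hf.indicator (hBm N).compl
  have hgN : ∀ x, |g x| ≤ N := fun x => by
    by_cases hx : x ∈ B N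
    · simp [hg, hx]
    · simp only [hg, Set.indicator_of_mem (Set.mem_compl hx)]
      simpa [hB] using hx
  have igd : Integrable (fun x => (g x * (a x - b x)) ^ 2) ν := by
    refine (id.const_mul ((N : ℝ) ^ 2)).mono'
      ((hgm.mul (ha.sub hb)).pow_const 2).aestronglyMeasurable (ae_of_all _ fun x => ?_)
    rw [Real.norm_eq_abs, abs_of_nonneg (sq_nonneg _), mul_pow, ← sq_abs (g x)]
    have := hgN x
    gcongr
  have bgd : √(∫ x, (g x * (a x - b x)) ^ 2 ∂ν) ≤ N * (C * |ε|) := by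
    have h1 : ∫ x, (g x * (a x - b x)) ^ 2 ∂ν ≤ (N * (C * ε)) ^ 2 := by
      calc _ ≤ ∫ x, (N : ℝ) ^ 2 * (a x - b x) ^ 2 ∂ν :=
          integral_mono igd (id.const_mul _) fun x => by
            simp only
            rw [mul_pow, ← sq_abs (g x)]
            have := hgN x
            gcongr
        _ ≤ _ := by
            rw [integral_const_mul, mul_pow]; gcongr
    refine (Real.sqrt_le_sqrt h1).trans (le_of_eq ?_)
    rw [Real.sqrt_sq_eq_abs, abs_mul, abs_mul, abs_of_pos hC, Nat.abs_cast]
  have mgd : Measurable fun x => g x * (a x - b x) := hgm.mul (ha.sub hb)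
  have mBD : Measurable ((B N).indicator D) := hDm.indicator (hBm N)
  have iBD := integrable_indicator_sq (hBm N) hDi
  have c1 := abs_integral_mul_le_sqrt mr ((hf.mul ha).add (hf.mul hb)) ir isum
  have c2 := abs_integral_mul_le_sqrt hDm mgd hDi igd
  have c3 := abs_integral_mul_le_sqrt mBD ((hf.mul ha).sub (hf.mul hb)) iBD isub
  have k1 := integrable_mul_of_sq mr ((hf.mul ha).add (hf.mul hb)) ir isum
  have k2 := integrable_mul_of_sq hDm mgd hDi igd
  have k3 := integrable_mul_of_sq mBD ((hf.mul ha).sub (hf.mul hb)) iBD isub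
  simp only [Pi.add_apply, Pi.sub_apply, Pi.mul_apply] at c1 c2 c3 k1 k2 k3
  rw [integral_indicator_sq (hBm N)] at c3
  have ifsb : Integrable (fun x => f x * s x) (densityLaw ν (q 0)) :=
    integrable_mul_of_sq hf H.measurable_score hf0 H.score_sq
  have e1 := (integrable_densityLaw (H.measurable_density ε) f).1 (integrable_of_sq hf hfε)
  have e2 := (integrable_densityLaw (H.measurable_density 0) f).1 (integrable_of_sq hf hf0)
  have e3 := (integrable_densityLaw (H.measurable_density 0) _).1 ifsb
  have e12 : Integrable (fun x => f x * √(q ε x : ℝ) ^ 2 - f x * √(q 0 x : ℝ) ^ 2) ν := e1.sub e2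
  have k23 : Integrable (fun x => ε * (D x * (g x * (a x - b x)) +
      (B N).indicator D x * (f x * a x - f x * b x))) ν := (k2.add k3).const_mul ε
  -- `q_ε - q_0 = (√q_ε - √q_0 - ε D)(√q_ε + √q_0) + ε D (√q_ε - √q_0) + 2 ε D √q_0`; in the middle
  -- term `f` is split at the level `N`
  have key : ∫ x, f x ∂(densityLaw ν (q ε)) - ∫ x, f x ∂(densityLaw ν (q 0))
      - ε * ∫ x, f x * s x ∂(densityLaw ν (q 0)) =
      (∫ x, (a x - b x - ε * D x) * (f x * a x + f x * b x) ∂ν) +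
        ε * ((∫ x, D x * (g x * (a x - b x)) ∂ν) +
          ∫ x, (B N).indicator D x * (f x * a x - f x * b x) ∂ν) := by
    rw [integral_densityLaw (H.measurable_density ε), integral_densityLaw (H.measurable_density 0),
      integral_densityLaw (H.measurable_density 0), ← integral_sub e1 e2, ← integral_const_mul,
      ← integral_sub e12 (e3.const_mul ε), ← integral_add k2 k3, ← integral_const_mul,
      ← integral_add k1 k23]
    refine integral_congr_ae (ae_of_all _ fun x => ?_)
    by_cases hx : x ∈ B N
    · simp only [hg, hx, Set.indicator_of_mem, Set.indicator_of_notMem, Set.mem_compl_iff,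
        not_true_eq_false, not_false_eq_true, hD]
      ring
    · simp only [hg, hx, Set.indicator_of_mem, Set.indicator_of_notMem, Set.mem_compl_iff,
        not_false_eq_true, hD]
      ring
  have hεp : 0 < |ε| := abs_pos.2 hε
  have d1 : |∫ x, (a x - b x - ε * D x) * (f x * a x + f x * b x) ∂ν| < |ε| * (η / 3) := by
    have : √(∫ x, (a x - b x - ε * D x) ^ 2 ∂ν) =
        |ε| * √((∫ x, (a x - b x - ε * D x) ^ 2 ∂ν) / ε ^ 2) := by
      rw [Real.sqrt_div' _ (sq_nonneg ε), Real.sqrt_sq_eq_abs]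
      field_simp
    calc _ ≤ _ := c1
      _ ≤ |ε| * √((∫ x, (a x - b x - ε * D x) ^ 2 ∂ν) / ε ^ 2) * √(4 * K) := by
          rw [this]; gcongr
      _ < _ := by rw [mul_assoc]; gcongr
  have d2 : |∫ x, D x * (g x * (a x - b x)) ∂ν| < η / 3 := by
    refine c2.trans_lt (lt_of_le_of_lt ?_ g2)
    calc _ ≤ √(∫ x, D x ^ 2 ∂ν) * (N * (C * |ε|)) := by gcongr
      _ = _ := by rw [hM]; ring
  have d3 : |∫ x, (B N).indicator D x * (f x * a x - f x * b x) ∂ν| < η / 3 := by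
    refine c3.trans_lt (lt_of_le_of_lt ?_ hN)
    gcongr
  rw [Real.dist_eq]
  have e4 : (∫ x, f x ∂(densityLaw ν (q ε)) - ∫ x, f x ∂(densityLaw ν (q 0))) / ε
      - ∫ x, f x * s x ∂(densityLaw ν (q 0)) =
      (∫ x, f x ∂(densityLaw ν (q ε)) - ∫ x, f x ∂(densityLaw ν (q 0))
      - ε * ∫ x, f x * s x ∂(densityLaw ν (q 0))) / ε := by field_simp
  rw [e4, key, abs_div, div_lt_iff₀ hεp]
  calc _ ≤ _ := abs_add_le _ _
    _ ≤ |∫ x, (a x - b x - ε * D x) * (f x * a x + f x * b x) ∂ν| +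
        |ε| * (|∫ x, D x * (g x * (a x - b x)) ∂ν| +
          |∫ x, (B N).indicator D x * (f x * a x - f x * b x) ∂ν|) := by
        rw [abs_mul]; gcongr; exact abs_add_le _ _
    _ < |ε| * (η / 3) + |ε| * (η / 3 + η / 3) := by gcongr
    _ = _ := by ring

/-- A product of a conditional bias `w`, which is of order `ε` in `L²`, with a function `κ` that is
bounded in `L²` but small only in `L¹` is `o(ε)`: on `{|κ| > δ}`, an event of small probability, the
bias is `o(ε)` because the squared score is uniformly integrable, and elsewhere `κ` is small. -/
lemma exists_forall_abs_integral_mul_le (H : IsDiffQuadraticMean ν q s) (K : ℝ) {η : ℝ}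
    (hη : 0 < η) :
    ∃ θ : ℝ, 0 < θ ∧ ∀ᶠ ε in 𝓝[≠] (0 : ℝ), ∀ e w κ : X → ℝ,
      Measurable e → Measurable w → Measurable κ → (∀ x, |e x| ≤ 1) → (∀ x, |w x| ≤ 1) →
      Integrable (fun x => κ x ^ 2) (densityLaw ν (q ε)) →
      ∫ x, κ x ^ 2 ∂(densityLaw ν (q ε)) ≤ K → ∫ x, |κ x| ∂(densityLaw ν (q ε)) ≤ θ →
      (∀ B : Set ℝ, MeasurableSet B →
        ∫ x, e x * (w x * B.indicator 1 (κ x)) ∂(densityLaw ν (q 0)) = 0) →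
      (∀ B : Set ℝ, MeasurableSet B →
        ∫ x, e x * (w x * B.indicator 1 (κ x)) ∂(densityLaw ν (q ε)) =
          ∫ x, w x * (w x * B.indicator 1 (κ x)) ∂(densityLaw ν (q ε))) →
      |∫ x, w x * κ x ∂(densityLaw ν (q ε))| ≤ η * |ε| := by
  have := H.prob_zero
  set I : ℝ := ∫ x, s x ^ 2 ∂(densityLaw ν (q 0)) with hI
  have hI0 : 0 ≤ I := integral_nonneg fun x => sq_nonneg _
  set R : ℝ := √(6 * (1 + I)) with hR
  have hR0 : 0 < R := by positivity
  -- the truncation level `δ` of `κ`, and the score mass `ζ` allowed on `{|κ| > δ}`, are chosen so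
  -- that each of the two events contributes at most `η |ε| / 2`
  set δ : ℝ := η / 2 / R with hδdef
  have hδ : 0 < δ := by positivity
  set ζ : ℝ := (η / 2) ^ 2 / (12 * (|K| + 1)) with hζdef
  have hζ : 0 < ζ := by positivity
  have hζK : √(12 * ζ) * √|K| ≤ η / 2 := by
    rw [← Real.sqrt_mul (by positivity)]
    refine (Real.sqrt_le_sqrt (y := (η / 2) ^ 2) ?_).trans (le_of_eq (Real.sqrt_sq (by positivity)))
    have : 12 * ζ * (|K| + 1) = (η / 2) ^ 2 := by rw [hζdef]; field_simp
    rw [← this]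
    gcongr
    linarith
  obtain ⟨τ, hτ, hτA⟩ : ∃ τ : ℝ, 0 < τ ∧ ∀ A : Set X, MeasurableSet A →
      (densityLaw ν (q 0)).real A < τ → ∫ x in A, s x ^ 2 ∂(densityLaw ν (q 0)) ≤ ζ := by
    have hfin : ∫⁻ x, ENNReal.ofReal (s x ^ 2) ∂(densityLaw ν (q 0)) ≠ ∞ := by
      have := H.score_sq.lintegral_lt_top
      exact this.ne
    obtain ⟨τ, hτ, h⟩ := exists_pos_setLIntegral_lt_of_measure_lt hfin
      (ε := ENNReal.ofReal ζ) (by simpa using hζ)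
    refine ⟨(min τ 1).toReal, ENNReal.toReal_pos (by simp [hτ.ne']) (by simp), fun A hA hlt => ?_⟩
    have h1 : densityLaw ν (q 0) A < τ := by
      rw [measureReal_def, ENNReal.toReal_lt_toReal (measure_ne_top _ _) (by simp)] at hlt
      exact hlt.trans_le (min_le_left _ _)
    have h2 := h A h1
    rw [integral_eq_lintegral_of_nonneg_ae (ae_of_all _ fun x => sq_nonneg _)
      (H.measurable_score.pow_const 2).aestronglyMeasurable]
    exact ENNReal.toReal_le_of_le_ofReal hζ.le h2.le
  obtain ⟨C, hC, hCe⟩ := H.exists_abs_integral_sub_le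
  refine ⟨δ * (τ / 4), by positivity, ?_⟩
  filter_upwards [hCe, H.prob, H.eventually_hellinger_le hζ, H.eventually_hellinger_le one_pos,
    eventually_abs_lt_nhdsNE (r := τ / 4 / C) (by positivity)] with ε h1 h2 h3 h4 h5
  intro e w κ he hw hκ he1 hw1 hκ2 hκK hκθ ho0 hoε
  have hmκ : ∀ {B : Set ℝ}, MeasurableSet B → Measurable fun x => B.indicator (1 : ℝ → ℝ) (κ x) :=
    fun hB => (measurable_one.indicator hB).comp hκ
  have hind : ∀ (B : Set ℝ) (y : ℝ), |B.indicator (1 : ℝ → ℝ) y| ≤ 1 := fun B y => by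
    by_cases hy : y ∈ B <;> simp [hy]
  -- the bias on the event `{κ ∈ B}`
  have bias : ∀ B : Set ℝ, MeasurableSet B →
      ∫ x, (w x * B.indicator 1 (κ x)) ^ 2 ∂(densityLaw ν (q ε)) ≤
        6 * ∫ x in κ ⁻¹' B, (√(q ε x : ℝ) - √(q 0 x : ℝ)) ^ 2 ∂ν := fun B hB => by
    refine integral_sq_le_hellinger (H.measurable_density ε) (H.measurable_density 0) he
      (hw.mul (hmκ hB)) he1 (fun x => ?_) (hκ hB) (fun x hx => ?_) (ho0 B hB) ?_
    · rw [Pi.mul_apply, abs_mul]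
      exact mul_le_one₀ (hw1 x) (abs_nonneg _) (hind _ _)
    · have : κ x ∉ B := hx
      simp [this]
    · refine (hoε B hB).trans (integral_congr_ae (ae_of_all _ fun x => ?_))
      by_cases hx : κ x ∈ B
      · simp [hx]; ring
      · simp [hx]
  set U : Set ℝ := {y | δ < |y|} with hU
  have hUm : MeasurableSet U := measurableSet_lt measurable_const measurable_id.abs
  have hw2 : ∀ B : Set ℝ, MeasurableSet B →
      Integrable (fun x => (w x * B.indicator 1 (κ x)) ^ 2) (densityLaw ν (q ε)) := fun B hB =>
    integrable_of_abs_le ((hw.mul (hmκ hB)).pow_const 2) (C := 1) fun x => by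
      rw [abs_pow, abs_mul]
      exact pow_le_one₀ (by positivity) (mul_le_one₀ (hw1 x) (abs_nonneg _) (hind _ _))
  have hκi : Integrable κ (densityLaw ν (q ε)) := integrable_of_sq hκ hκ2
  -- the event `{|κ| > δ}` has small probability, first at `ε` and then at `0`
  have hUε : (densityLaw ν (q ε)).real (κ ⁻¹' U) ≤ τ / 4 := by
    have hm : δ * (densityLaw ν (q ε)).real {x | δ ≤ |κ x|} ≤ ∫ x, |κ x| ∂(densityLaw ν (q ε)) :=
      mul_meas_ge_le_integral_of_nonneg (ae_of_all _ fun x => abs_nonneg _) hκi.abs δ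
    have hsub : (densityLaw ν (q ε)).real (κ ⁻¹' U) ≤
        (densityLaw ν (q ε)).real {x | δ ≤ |κ x|} :=
      measureReal_mono fun x (hx : δ < |κ x|) => hx.le
    have := hm.trans hκθ
    exact hsub.trans (le_of_mul_le_mul_left this hδ)
  have hU0 : (densityLaw ν (q 0)).real (κ ⁻¹' U) < τ := by
    have hm1 : Measurable ((κ ⁻¹' U).indicator (1 : X → ℝ)) := measurable_one.indicator (hκ hUm)
    have hsq : ∀ x, ((κ ⁻¹' U).indicator (1 : X → ℝ) x) ^ 2 = (κ ⁻¹' U).indicator 1 x := fun x => by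
      by_cases hx : x ∈ κ ⁻¹' U
      · rw [Set.indicator_of_mem hx]; simp
      · rw [Set.indicator_of_notMem hx]; simp
    have hle : ∀ x, |(κ ⁻¹' U).indicator (1 : X → ℝ) x| ≤ 1 := fun x => by
      by_cases hx : x ∈ κ ⁻¹' U
      · rw [Set.indicator_of_mem hx]; simp
      · rw [Set.indicator_of_notMem hx]; simp
    have hb := h1 1 ((κ ⁻¹' U).indicator 1) hm1
      (by simp only [hsq]; exact integrable_of_abs_le hm1 hle)
      (by simp only [hsq]; exact integrable_of_abs_le hm1 hle)
      (by simp only [hsq]; rw [integral_indicator_one (hκ hUm)]; exact measureReal_le_one)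
      (by simp only [hsq]; rw [integral_indicator_one (hκ hUm)]; exact measureReal_le_one)
    rw [integral_indicator_one (hκ hUm), integral_indicator_one (hκ hUm), Real.sqrt_one,
      mul_one] at hb
    rw [lt_div_iff₀ hC] at h5
    have := (abs_le.1 hb).1
    linarith
  have hd1 := h3 _ (hκ hUm)
  have hd2 := hτA _ (hκ hUm) hU0
  have hb1 : ∫ x, (w x * U.indicator 1 (κ x)) ^ 2 ∂(densityLaw ν (q ε)) ≤ 12 * ζ * ε ^ 2 := by
    have := bias U hUm
    have h6 : ε ^ 2 * (ζ + ∫ x in κ ⁻¹' U, s x ^ 2 ∂(densityLaw ν (q 0))) ≤ ε ^ 2 * (ζ + ζ) := by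
      gcongr
    linarith
  have hb2 : ∫ x, (w x * Uᶜ.indicator 1 (κ x)) ^ 2 ∂(densityLaw ν (q ε)) ≤
      6 * (1 + I) * ε ^ 2 := by
    have h7 := bias Uᶜ hUm.compl
    have h6 := h4 _ MeasurableSet.univ
    rw [setIntegral_univ, setIntegral_univ] at h6
    have h8 : ∫ x in κ ⁻¹' Uᶜ, (√(q ε x : ℝ) - √(q 0 x : ℝ)) ^ 2 ∂ν ≤
        ∫ x, (√(q ε x : ℝ) - √(q 0 x : ℝ)) ^ 2 ∂ν :=
      setIntegral_le_integral (integrable_sub_sqrt_density_sq (H.measurable_density ε)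
        (H.measurable_density 0)) (ae_of_all _ fun x => sq_nonneg _)
    linarith
  have hκc : Measurable fun x => κ x * Uᶜ.indicator 1 (κ x) := hκ.mul (hmκ hUm.compl)
  have hκcb : ∀ x, (κ x * Uᶜ.indicator 1 (κ x)) ^ 2 ≤ δ ^ 2 := fun x => by
    by_cases hx : κ x ∈ Uᶜ
    · have : |κ x| ≤ δ := by simpa [hU] using hx
      simp only [Set.indicator_of_mem hx, Pi.one_apply, mul_one]
      rw [← sq_abs]; gcongr
    · rw [Set.indicator_of_notMem hx]; nlinarith [sq_nonneg δ]
  have hκc2 : Integrable (fun x => (κ x * Uᶜ.indicator 1 (κ x)) ^ 2) (densityLaw ν (q ε)) :=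
    integrable_of_abs_le (hκc.pow_const 2) fun x => by
      rw [abs_of_nonneg (sq_nonneg _)]; exact hκcb x
  have hκcI : ∫ x, (κ x * Uᶜ.indicator 1 (κ x)) ^ 2 ∂(densityLaw ν (q ε)) ≤ δ ^ 2 := by
    refine (integral_mono hκc2 (integrable_const _) hκcb).trans (le_of_eq ?_)
    simp
  have c1 := abs_integral_mul_le_sqrt (hw.mul (hmκ hUm)) hκ (hw2 U hUm) hκ2
  have c2 := abs_integral_mul_le_sqrt (hw.mul (hmκ hUm.compl)) hκc (hw2 _ hUm.compl) hκc2
  have i1 := integrable_mul_of_sq (hw.mul (hmκ hUm)) hκ (hw2 U hUm) hκ2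
  have i2 := integrable_mul_of_sq (hw.mul (hmκ hUm.compl)) hκc (hw2 _ hUm.compl) hκc2
  simp only [Pi.mul_apply] at c1 c2 i1 i2
  have hsplit : ∫ x, w x * κ x ∂(densityLaw ν (q ε)) =
      (∫ x, w x * U.indicator 1 (κ x) * κ x ∂(densityLaw ν (q ε))) +
        ∫ x, w x * Uᶜ.indicator 1 (κ x) * (κ x * Uᶜ.indicator 1 (κ x)) ∂(densityLaw ν (q ε)) := by
    rw [← integral_add i1 i2]
    refine integral_congr_ae (ae_of_all _ fun x => ?_)
    by_cases hx : κ x ∈ U <;> simp [hx]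
  have d1 : |∫ x, w x * U.indicator 1 (κ x) * κ x ∂(densityLaw ν (q ε))| ≤ η / 2 * |ε| := by
    refine c1.trans ?_
    calc _ ≤ √(12 * ζ * ε ^ 2) * √|K| := by
          gcongr; exact hκK.trans (le_abs_self K)
      _ = √(12 * ζ) * √|K| * |ε| := by
          rw [Real.sqrt_mul (by positivity), Real.sqrt_sq_eq_abs]; ring
      _ ≤ _ := by gcongr
  have d2 : |∫ x, w x * Uᶜ.indicator 1 (κ x) * (κ x * Uᶜ.indicator 1 (κ x)) ∂(densityLaw ν (q ε))|
      ≤ η / 2 * |ε| := by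
    refine c2.trans ?_
    calc _ ≤ √(6 * (1 + I) * ε ^ 2) * √(δ ^ 2) := by gcongr
      _ = R * δ * |ε| := by
          rw [Real.sqrt_mul (by positivity), Real.sqrt_sq_eq_abs, Real.sqrt_sq hδ.le]; ring
      _ = _ := by rw [hδdef]; field_simp
  rw [hsplit]
  refine (abs_add_le _ _).trans ?_
  linarith

end IsDiffQuadraticMean
end QuadraticMean

/-! ### Nuisance functions of an observed law -/

section Nuisance

variable {𝒴 𝒵 : Type*}

/-- `(T, Y, Z)` as a function of the observation. -/
def obsDesign (o : ObsData 𝒴 𝒵) : Fin 2 × 𝒴 × 𝒵 := (o.1, o.2.1, o.2.2.1)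

/-- `(Y, Z)` as a function of the observation. -/
def obsTextControls (o : ObsData 𝒴 𝒵) : 𝒴 × 𝒵 := (o.2.1, o.2.2.1)

/-- `Z` as a function of the observation. -/
def obsControls (o : ObsData 𝒴 𝒵) : 𝒵 := o.2.2.1

/-- The recorded label `S · L̃`, which is `0` on the unlabelled units. -/
def obsLabel (o : ObsData 𝒴 𝒵) : ℝ := o.2.2.2.2

/-- The indicator of `S = 1`. -/
def obsSampled (o : ObsData 𝒴 𝒵) : ℝ := if o.2.2.2.1 = 1 then 1 else 0

/-- The indicator of `T = t`. -/
def obsArm (t : Fin 2) (o : ObsData 𝒴 𝒵) : ℝ := if o.1 = t then 1 else 0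

lemma abs_obsSampled_le (o : ObsData 𝒴 𝒵) : |obsSampled o| ≤ 1 := by
  unfold obsSampled; split_ifs <;> simp

lemma obsArm_nonneg (t : Fin 2) (o : ObsData 𝒴 𝒵) : 0 ≤ obsArm t o := by
  unfold obsArm; split_ifs <;> simp

lemma obsArm_le_one (t : Fin 2) (o : ObsData 𝒴 𝒵) : obsArm t o ≤ 1 := by
  unfold obsArm; split_ifs <;> simp

lemma abs_obsArm_le (t : Fin 2) (o : ObsData 𝒴 𝒵) : |obsArm t o| ≤ 1 := by
  rw [abs_of_nonneg (obsArm_nonneg t o)]; exact obsArm_le_one t o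

/-- The values of the nuisance parameters: `P(S = 1)`, `E[L | Y, Z]`, `P(T = t | Y, Z)`,
`P(T = t | Z)` and `E[L | T = t, Z]`. -/
structure NuisanceFunctions (𝒴 𝒵 : Type*) where
  labelProb : ℝ
  outcome : 𝒴 × 𝒵 → ℝ
  surrogacy : 𝒴 × 𝒵 → ℝ
  propensity : 𝒵 → ℝ
  armMean : 𝒵 → ℝ

variable [MeasurableSpace 𝒴] [MeasurableSpace 𝒵]

@[fun_prop] lemma measurable_obsDesign : Measurable (obsDesign : ObsData 𝒴 𝒵 → _) := by
  unfold obsDesign; fun_prop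

@[fun_prop] lemma measurable_obsTextControls :
    Measurable (obsTextControls : ObsData 𝒴 𝒵 → _) := by
  unfold obsTextControls; fun_prop

@[fun_prop] lemma measurable_obsControls : Measurable (obsControls : ObsData 𝒴 𝒵 → _) := by
  unfold obsControls; fun_prop

@[fun_prop] lemma measurable_obsLabel : Measurable (obsLabel : ObsData 𝒴 𝒵 → _) := by
  unfold obsLabel; fun_prop

@[fun_prop] lemma measurable_obsSampled : Measurable (obsSampled : ObsData 𝒴 𝒵 → _) :=
  Measurable.ite ((show Measurable fun o : ObsData 𝒴 𝒵 => o.2.2.2.1 by fun_prop)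
    (measurableSet_singleton 1)) measurable_const measurable_const

@[fun_prop] lemma measurable_obsArm (t : Fin 2) : Measurable (obsArm t : ObsData 𝒴 𝒵 → _) :=
  Measurable.ite ((show Measurable fun o : ObsData 𝒴 𝒵 => o.1 by fun_prop)
    (measurableSet_singleton t)) measurable_const measurable_const

/-- `N` holds the nuisance functions of the observed law `Q`, and `ψ` the value of the target
parameter. The conditional expectations are characterised by their integrals against test
functions. The constants `c` and `K` bound the propensity score from below and the second moments
from above. In contrast to a law of the full data, nothing here refers to a surrogate
representation. -/
structure IsNuisance (t : Fin 2) (c K : ℝ) (Q : Measure (ObsData 𝒴 𝒵))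
    (N : NuisanceFunctions 𝒴 𝒵) (ψ : ℝ) : Prop where
  measurable_outcome : Measurable N.outcome
  measurable_surrogacy : Measurable N.surrogacy
  measurable_propensity : Measurable N.propensity
  measurable_armMean : Measurable N.armMean
  labelProb_pos : 0 < N.labelProb
  surrogacy_nonneg : ∀ x, 0 ≤ N.surrogacy x
  surrogacy_le_one : ∀ x, N.surrogacy x ≤ 1
  le_propensity : ∀ z, c ≤ N.propensity z
  propensity_le_one : ∀ z, N.propensity z ≤ 1
  integral_sampled : ∀ τ : Fin 2 × 𝒴 × 𝒵 → ℝ, Measurable τ → (∃ C, ∀ x, |τ x| ≤ C) →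
    ∫ o, obsSampled o * τ (obsDesign o) ∂Q = N.labelProb * ∫ o, τ (obsDesign o) ∂Q
  integral_label : ∀ τ : Fin 2 × 𝒴 × 𝒵 → ℝ, Measurable τ → (∃ C, ∀ x, |τ x| ≤ C) →
    ∫ o, obsSampled o * obsLabel o * τ (obsDesign o) ∂Q =
      N.labelProb * ∫ o, N.outcome (obsTextControls o) * τ (obsDesign o) ∂Q
  integral_arm_text : ∀ τ : 𝒴 × 𝒵 → ℝ, Measurable τ →
    Integrable (fun o => τ (obsTextControls o)) Q →
    ∫ o, obsArm t o * τ (obsTextControls o) ∂Q =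
      ∫ o, N.surrogacy (obsTextControls o) * τ (obsTextControls o) ∂Q
  integral_arm : ∀ τ : 𝒵 → ℝ, Measurable τ → Integrable (fun o => τ (obsControls o)) Q →
    ∫ o, obsArm t o * τ (obsControls o) ∂Q = ∫ o, N.propensity (obsControls o) *
        τ (obsControls o) ∂Q
  integral_armMean : ∀ τ : 𝒵 → ℝ, Measurable τ → (∃ C, ∀ z, |τ z| ≤ C) →
    ∫ o, obsArm t o * N.outcome (obsTextControls o) * τ (obsControls o) ∂Q =
      ∫ o, obsArm t o * N.armMean (obsControls o) * τ (obsControls o) ∂Q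
  target : ψ = ∫ o, N.armMean (obsControls o) ∂Q
  label_sq : Integrable (fun o => obsLabel o ^ 2) Q
  label_sq_le : ∫ o, obsLabel o ^ 2 ∂Q ≤ K
  outcome_sq : Integrable (fun o => N.outcome (obsTextControls o) ^ 2) Q
  outcome_sq_le : ∫ o, N.outcome (obsTextControls o) ^ 2 ∂Q ≤ K
  armMean_sq : Integrable (fun o => N.armMean (obsControls o) ^ 2) Q
  armMean_sq_le : ∫ o, N.armMean (obsControls o) ^ 2 ∂Q ≤ K

/-- The uncentred influence function with the regressions `E[L | Y, Z]` and `E[L | T = t, Z]`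
replaced by `h` and `m`. -/
def doublyRobust (t : Fin 2) (N : NuisanceFunctions 𝒴 𝒵) (h : 𝒴 × 𝒵 → ℝ) (m : 𝒵 → ℝ)
    (o : ObsData 𝒴 𝒵) : ℝ :=
  obsSampled o / N.labelProb * (N.surrogacy (obsTextControls o) / N.propensity (obsControls o)) *
      (obsLabel o - h (obsTextControls o)) +
    obsArm t o / N.propensity (obsControls o) * (h (obsTextControls o) - m (obsControls o)) +
    m (obsControls o)

/-- The sign of a real number, with value `1` at `0`, so that its modulus is always `1`. -/
def signOne (x : ℝ) : ℝ := if 0 ≤ x then 1 else -1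

lemma measurable_signOne : Measurable signOne :=
  Measurable.ite measurableSet_Ici measurable_const measurable_const

lemma abs_signOne (x : ℝ) : |signOne x| = 1 := by unfold signOne; split_ifs <;> simp

lemma mul_signOne (x : ℝ) : x * signOne x = |x| := by
  unfold signOne
  split_ifs with h
  · rw [mul_one, abs_of_nonneg h]
  · rw [abs_of_neg (not_le.1 h)]; ring

lemma integrable_mul_of_abs_le {X : Type*} [MeasurableSpace X] {Q : Measure X} {f g : X → ℝ}
    (hf : Integrable f Q) (hg : Measurable g) {C : ℝ} (h : ∀ x, |g x| ≤ C) :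
    Integrable (fun x => f x * g x) Q :=
  hf.mul_bdd (c := C) hg.aestronglyMeasurable (ae_of_all _ h)

namespace IsNuisance

variable {t : Fin 2} {c K ψ ψ₀ : ℝ} {Q Q₀ : Measure (ObsData 𝒴 𝒵)} {N N₀ : NuisanceFunctions 𝒴 𝒵}

lemma integrable_outcome [IsFiniteMeasure Q] (H : IsNuisance t c K Q N ψ) :
    Integrable (fun o => N.outcome (obsTextControls o)) Q :=
  integrable_of_sq (H.measurable_outcome.comp measurable_obsTextControls) H.outcome_sq

lemma integrable_armMean [IsFiniteMeasure Q] (H : IsNuisance t c K Q N ψ) :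
    Integrable (fun o => N.armMean (obsControls o)) Q :=
  integrable_of_sq (H.measurable_armMean.comp measurable_obsControls) H.armMean_sq

lemma integrable_label [IsFiniteMeasure Q] (H : IsNuisance t c K Q N ψ) :
    Integrable obsLabel Q := integrable_of_sq measurable_obsLabel H.label_sq

lemma abs_inv_propensity_le (H : IsNuisance t c K Q N ψ) (hc : 0 < c) (z : 𝒵) :
    |(N.propensity z)⁻¹| ≤ c⁻¹ := by
  have := H.le_propensity z
  rw [abs_of_pos (inv_pos.2 (hc.trans_le this))]
  gcongr

/-- The bias at `Q` of the doubly robust moment that takes its weights from `N₀` and its regressions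
from `h` and `m` is a sum of products of errors in two different nuisance parameters. -/
lemma integral_doublyRobust_sub [IsProbabilityMeasure Q]
    (H : IsNuisance t c K Q N ψ) (H₀ : IsNuisance t c K Q₀ N₀ ψ₀) (hc : 0 < c)
    {h : 𝒴 × 𝒵 → ℝ} {m : 𝒵 → ℝ} (hh : Measurable h) (hm : Measurable m) {C : ℝ}
    (hhC : ∀ x, |h x| ≤ C) (hmC : ∀ z, |m z| ≤ C) :
    ∫ o, doublyRobust t N₀ h m o ∂Q - ψ =
      (N.labelProb - N₀.labelProb) / N₀.labelProb * (∫ o, N₀.surrogacy (obsTextControls o) *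
          ((N.outcome (obsTextControls o) - h (obsTextControls o)) / N₀.propensity (obsControls o))
          ∂Q) +
      (∫ o, (N₀.surrogacy (obsTextControls o) - N.surrogacy (obsTextControls o)) *
          ((N.outcome (obsTextControls o) - h (obsTextControls o)) / N₀.propensity (obsControls o))
          ∂Q) +
      ∫ o, (N.propensity (obsControls o) - N₀.propensity (obsControls o)) *
          ((N.armMean (obsControls o) - m (obsControls o)) / N₀.propensity (obsControls o)) ∂Q := by
  have hα := H₀.labelProb_pos.ne'
  have hpos : ∀ z, N₀.propensity z ≠ 0 := fun z => (hc.trans_le (H₀.le_propensity z)).ne'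
  have mH := H.measurable_outcome
  have mM := H.measurable_armMean
  have mR := H.measurable_surrogacy
  have mP := H.measurable_propensity
  have mR₀ := H₀.measurable_surrogacy
  have mP₀ := H₀.measurable_propensity
  have bR : ∀ x, |N.surrogacy x| ≤ 1 := fun x => by
    rw [abs_of_nonneg (H.surrogacy_nonneg x)]; exact H.surrogacy_le_one x
  have bR₀ : ∀ x, |N₀.surrogacy x| ≤ 1 := fun x => by
    rw [abs_of_nonneg (H₀.surrogacy_nonneg x)]; exact H₀.surrogacy_le_one x
  have bP : ∀ x, |N.propensity x| ≤ 1 := fun x => by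
    rw [abs_of_nonneg (hc.le.trans (H.le_propensity x))]; exact H.propensity_le_one x
  have bP₀ : ∀ x, |N₀.propensity x| ≤ 1 := fun x => by
    rw [abs_of_nonneg (hc.le.trans (H₀.le_propensity x))]; exact H₀.propensity_le_one x
  have bI := H₀.abs_inv_propensity_le hc
  set u : 𝒴 × 𝒵 → ℝ := fun x => N₀.surrogacy x * (N₀.propensity x.2)⁻¹ with hu
  have um : Measurable u := by fun_prop
  have ub : ∀ x, |u x| ≤ c⁻¹ := fun x => by
    rw [hu, abs_mul]
    calc _ ≤ 1 * c⁻¹ := mul_le_mul (bR₀ x) (bI _) (abs_nonneg _) zero_le_one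
      _ = _ := one_mul _
  have ihq : Integrable (fun o => h (obsTextControls o)) Q :=
    integrable_of_abs_le (hh.comp measurable_obsTextControls) fun o => hhC _
  have imq : Integrable (fun o => m (obsControls o)) Q :=
    integrable_of_abs_le (hm.comp measurable_obsControls) fun o => hmC _
  set κ : 𝒴 × 𝒵 → ℝ := fun x => (N.outcome x - h x) / N₀.propensity x.2 with hκ
  have κm : Measurable κ := by fun_prop
  set l : 𝒵 → ℝ := fun z => (N.armMean z - m z) / N₀.propensity z with hl
  have lm : Measurable l := by fun_prop
  have iκ : Integrable (fun o => κ (obsTextControls o)) Q := by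
    have := integrable_mul_of_abs_le (H.integrable_outcome.sub ihq)
      ((mP₀.inv).comp measurable_obsControls) (fun o => bI (obsControls o))
    exact this
  have il : Integrable (fun o => l (obsControls o)) Q := by
    have := integrable_mul_of_abs_le (H.integrable_armMean.sub imq)
      ((mP₀.inv).comp measurable_obsControls) (fun o => bI (obsControls o))
    exact this
  -- the conditional moment identities at `Q`
  have e1 := H.integral_label (fun x => u x.2) (by fun_prop) ⟨_, fun x => ub x.2⟩
  have e2 := H.integral_sampled (fun x => h x.2 * u x.2) (by fun_prop) ⟨C * c⁻¹, fun x => by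
    rw [abs_mul]; exact mul_le_mul (hhC _) (ub _) (abs_nonneg _) ((abs_nonneg _).trans (hhC x.2))⟩
  have e3 := H.integral_arm_text κ κm iκ
  have e4 := H.integral_arm l lm il
  have e5 := H.integral_armMean (fun z => (N₀.propensity z)⁻¹) mP₀.inv ⟨_, bI⟩
  have e6 := H.target
  have i1 : Integrable (fun o => obsSampled o * obsLabel o * u (obsTextControls o)) Q := by
    refine integrable_mul_of_abs_le ?_ (um.comp measurable_obsTextControls) fun o => ub _
    exact (integrable_mul_of_abs_le H.integrable_label measurable_obsSampled
      abs_obsSampled_le).congr (ae_of_all _ fun o => mul_comm _ _)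
  have i2 : Integrable (fun o => obsSampled o * (h (obsTextControls o) * u (obsTextControls o)))
      Q := by
    refine (integrable_mul_of_abs_le (integrable_mul_of_abs_le ihq
      (um.comp measurable_obsTextControls) fun o => ub _) measurable_obsSampled
      abs_obsSampled_le).congr (ae_of_all _ fun o => mul_comm _ _)
  have i3 : Integrable (fun o => obsArm t o * κ (obsTextControls o)) Q :=
    (integrable_mul_of_abs_le iκ (measurable_obsArm t) (abs_obsArm_le t)).congr
      (ae_of_all _ fun o => mul_comm _ _)
  have i4 : Integrable (fun o => obsArm t o * l (obsControls o)) Q :=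
    (integrable_mul_of_abs_le il (measurable_obsArm t) (abs_obsArm_le t)).congr
      (ae_of_all _ fun o => mul_comm _ _)
  have i5 : Integrable (fun o => obsArm t o * N.outcome (obsTextControls o) *
      (N₀.propensity (obsControls o))⁻¹) Q :=
    integrable_mul_of_abs_le ((integrable_mul_of_abs_le H.integrable_outcome (measurable_obsArm t)
      (abs_obsArm_le t)).congr (ae_of_all _ fun o => mul_comm _ _))
      (mP₀.inv.comp measurable_obsControls) fun o => bI _
  have i6 : Integrable (fun o => obsArm t o * N.armMean (obsControls o) *
      (N₀.propensity (obsControls o))⁻¹) Q :=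
    integrable_mul_of_abs_le ((integrable_mul_of_abs_le H.integrable_armMean (measurable_obsArm t)
      (abs_obsArm_le t)).congr (ae_of_all _ fun o => mul_comm _ _))
      (mP₀.inv.comp measurable_obsControls) fun o => bI _
  have i7 : Integrable (fun o => N.outcome (obsTextControls o) * u (obsTextControls o)) Q :=
    integrable_mul_of_abs_le H.integrable_outcome (um.comp measurable_obsTextControls) fun o => ub _
  have i8 : Integrable (fun o => h (obsTextControls o) * u (obsTextControls o)) Q :=
    integrable_mul_of_abs_le ihq (um.comp measurable_obsTextControls) fun o => ub _
  have i9 : Integrable (fun o => N₀.surrogacy (obsTextControls o) * κ (obsTextControls o)) Q :=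
    (integrable_mul_of_abs_le iκ (mR₀.comp measurable_obsTextControls) fun o => bR₀ _).congr
      (ae_of_all _ fun o => mul_comm _ _)
  have i10 : Integrable (fun o => N.surrogacy (obsTextControls o) * κ (obsTextControls o)) Q :=
    (integrable_mul_of_abs_le iκ (mR.comp measurable_obsTextControls) fun o => bR _).congr
      (ae_of_all _ fun o => mul_comm _ _)
  have i11 : Integrable (fun o => N₀.propensity (obsControls o) * l (obsControls o)) Q :=
    (integrable_mul_of_abs_le il (mP₀.comp measurable_obsControls) fun o => bP₀ _).congr
      (ae_of_all _ fun o => mul_comm _ _)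
  have i12 : Integrable (fun o => N.propensity (obsControls o) * l (obsControls o)) Q :=
    (integrable_mul_of_abs_le il (mP.comp measurable_obsControls) fun o => bP _).congr
      (ae_of_all _ fun o => mul_comm _ _)
  -- decomposition of the moment function
  have s1 : ∫ o, doublyRobust t N₀ h m o ∂Q =
      N₀.labelProb⁻¹ * ((∫ o, obsSampled o * obsLabel o * u (obsTextControls o) ∂Q) -
        ∫ o, obsSampled o * (h (obsTextControls o) * u (obsTextControls o)) ∂Q) +
      (((∫ o, obsArm t o * N.outcome (obsTextControls o) * (N₀.propensity (obsControls o))⁻¹ ∂Q) -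
        ∫ o, obsArm t o * κ (obsTextControls o) ∂Q) -
        ((∫ o, obsArm t o * N.armMean (obsControls o) * (N₀.propensity (obsControls o))⁻¹ ∂Q) -
        ∫ o, obsArm t o * l (obsControls o) ∂Q)) + ∫ o, m (obsControls o) ∂Q := by
    rw [← integral_sub i1 i2, ← integral_const_mul, ← integral_sub i5 i3, ← integral_sub i6 i4,
      ← integral_sub (by exact i5.sub i3) (by exact i6.sub i4),
      ← integral_add (by exact (i1.sub i2).const_mul _) (by exact (i5.sub i3).sub (i6.sub i4)),
      ← integral_add (by exact ((i1.sub i2).const_mul _).add ((i5.sub i3).sub (i6.sub i4))) imq]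
    refine integral_congr_ae (ae_of_all _ fun o => ?_)
    have := hpos (obsControls o)
    have hx2 : (obsTextControls o).2 = obsControls o := rfl
    simp only [doublyRobust, hu, hκ, hl, hx2]
    field_simp
    ring
  have s2 : ∫ o, N₀.surrogacy (obsTextControls o) * κ (obsTextControls o) ∂Q =
      (∫ o, N.outcome (obsTextControls o) * u (obsTextControls o) ∂Q) -
        ∫ o, h (obsTextControls o) * u (obsTextControls o) ∂Q := by
    rw [← integral_sub i7 i8]
    refine integral_congr_ae (ae_of_all _ fun o => ?_)
    simp only [hu, hκ]; ring
  have s3 : ∫ o, N₀.propensity (obsControls o) * l (obsControls o) ∂Q =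
      (∫ o, N.armMean (obsControls o) ∂Q) - ∫ o, m (obsControls o) ∂Q := by
    rw [← integral_sub H.integrable_armMean imq]
    refine integral_congr_ae (ae_of_all _ fun o => ?_)
    have := hpos (obsControls o)
    simp only [hl]; field_simp
  have s4 : ∫ o, (N₀.surrogacy (obsTextControls o) - N.surrogacy (obsTextControls o)) *
      κ (obsTextControls o) ∂Q = (∫ o, N₀.surrogacy (obsTextControls o) * κ (obsTextControls o) ∂Q)
        - ∫ o, N.surrogacy (obsTextControls o) * κ (obsTextControls o) ∂Q := by
    rw [← integral_sub i9 i10]; simp only [sub_mul]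
  have s5 : ∫ o, (N.propensity (obsControls o) - N₀.propensity (obsControls o)) *
      l (obsControls o) ∂Q = (∫ o, N.propensity (obsControls o) * l (obsControls o) ∂Q)
        - ∫ o, N₀.propensity (obsControls o) * l (obsControls o) ∂Q := by
    rw [← integral_sub i12 i11]; simp only [sub_mul]
  have e1' : ∫ o, obsSampled o * obsLabel o * u (obsTextControls o) ∂Q =
      N.labelProb * ∫ o, N.outcome (obsTextControls o) * u (obsTextControls o) ∂Q := e1
  have e2' : ∫ o, obsSampled o * (h (obsTextControls o) * u (obsTextControls o)) ∂Q =
      N.labelProb * ∫ o, h (obsTextControls o) * u (obsTextControls o) ∂Q := e2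
  change _ = (N.labelProb - N₀.labelProb) / N₀.labelProb *
      (∫ o, N₀.surrogacy (obsTextControls o) * κ (obsTextControls o) ∂Q) +
      (∫ o, (N₀.surrogacy (obsTextControls o) - N.surrogacy (obsTextControls o)) *
      κ (obsTextControls o) ∂Q) + ∫ o, (N.propensity (obsControls o) -
        N₀.propensity (obsControls o)) * l (obsControls o) ∂Q
  rw [s4, s5, s1, s2, s3, e1', e2', e3, e4, e5, e6]
  field_simp
  ring

end IsNuisance
end Nuisance

/-! ### Convergence of the nuisance parameters along a family -/

/-- Truncation of a real number to `[-n, n]`. -/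
def clamp (n : ℕ) (x : ℝ) : ℝ := max (-n) (min n x)

lemma measurable_clamp (n : ℕ) : Measurable (clamp n) := by unfold clamp; fun_prop

lemma abs_clamp_le (n : ℕ) (x : ℝ) : |clamp n x| ≤ n := by
  have : (0 : ℝ) ≤ n := n.cast_nonneg
  unfold clamp
  rw [abs_le]
  exact ⟨le_max_left _ _, max_le (by linarith) (min_le_left _ _)⟩

lemma clamp_eq_self {n : ℕ} {x : ℝ} (h : |x| ≤ n) : clamp n x = x := by
  unfold clamp
  rw [min_eq_right (abs_le.1 h).2, max_eq_right (abs_le.1 h).1]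

lemma abs_clamp_le_abs (n : ℕ) (x : ℝ) : |clamp n x| ≤ |x| := by
  by_cases h : |x| ≤ n
  · rw [clamp_eq_self h]
  · exact (abs_clamp_le n x).trans (not_le.1 h).le

lemma eventually_clamp_eq (x : ℝ) : ∀ᶠ n : ℕ in atTop, clamp n x = x := by
  filter_upwards [eventually_ge_atTop ⌈|x|⌉₊] with n hn
  exact clamp_eq_self ((Nat.le_ceil _).trans (by exact_mod_cast hn))

section Pathwise

variable {𝒴 𝒵 : Type*} [MeasurableSpace 𝒴] [MeasurableSpace 𝒵]

namespace IsNuisance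

variable {t : Fin 2} {c K ψ ψ₀ : ℝ} {Q Q₀ : Measure (ObsData 𝒴 𝒵)} {N N₀ : NuisanceFunctions 𝒴 𝒵}

/-- The sampled residual identifies the outcome error, because sampling is independent of
`(T, Y, Z)`. -/
lemma integral_residual_mul [IsProbabilityMeasure Q] (H : IsNuisance t c K Q N ψ)
    {h : 𝒴 × 𝒵 → ℝ} (hh : Measurable h) {C : ℝ} (hhC : ∀ x, |h x| ≤ C)
    {τ : Fin 2 × 𝒴 × 𝒵 → ℝ} (hτ : Measurable τ) (hτ1 : ∀ x, |τ x| ≤ 1) :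
    ∫ o, obsSampled o * (obsLabel o - h (obsTextControls o)) * τ (obsDesign o) ∂Q =
      N.labelProb * ∫ o, (N.outcome (obsTextControls o) - h (obsTextControls o)) *
        τ (obsDesign o) ∂Q := by
  have e1 := H.integral_label τ hτ ⟨1, hτ1⟩
  have e2 := H.integral_sampled (fun x => h x.2 * τ x) (by fun_prop) ⟨C * 1, fun x => by
    rw [abs_mul]; exact mul_le_mul (hhC _) (hτ1 x) (abs_nonneg _)
      ((abs_nonneg _).trans (hhC x.2))⟩
  have ihq : Integrable (fun o => h (obsTextControls o)) Q :=
    integrable_of_abs_le (hh.comp measurable_obsTextControls) fun o => hhC _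
  have mτ : Measurable fun o : ObsData 𝒴 𝒵 => τ (obsDesign o) := hτ.comp measurable_obsDesign
  have i1 : Integrable (fun o => obsSampled o * obsLabel o * τ (obsDesign o)) Q :=
    integrable_mul_of_abs_le ((integrable_mul_of_abs_le H.integrable_label measurable_obsSampled
      abs_obsSampled_le).congr (ae_of_all _ fun o => mul_comm _ _)) mτ fun o => hτ1 _
  have i3 : Integrable (fun o => h (obsTextControls o) * τ (obsDesign o)) Q :=
    integrable_mul_of_abs_le ihq mτ fun o => hτ1 _
  have i2 : Integrable (fun o => obsSampled o * (h (obsTextControls o) * τ (obsDesign o))) Q :=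
    (integrable_mul_of_abs_le i3 measurable_obsSampled abs_obsSampled_le).congr
      (ae_of_all _ fun o => mul_comm _ _)
  have i4 : Integrable (fun o => N.outcome (obsTextControls o) * τ (obsDesign o)) Q :=
    integrable_mul_of_abs_le H.integrable_outcome mτ fun o => hτ1 _
  have e2' : ∫ o, obsSampled o * (h (obsTextControls o) * τ (obsDesign o)) ∂Q =
      N.labelProb * ∫ o, h (obsTextControls o) * τ (obsDesign o) ∂Q := e2
  calc _ = ∫ o, (obsSampled o * obsLabel o * τ (obsDesign o) -
        obsSampled o * (h (obsTextControls o) * τ (obsDesign o))) ∂Q :=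
        integral_congr_ae (ae_of_all _ fun o => by ring)
    _ = _ := by
        rw [integral_sub i1 i2, e1, e2', ← mul_sub, ← integral_sub i4 i3]
        simp only [sub_mul]

lemma integral_arm_residual [IsProbabilityMeasure Q] (H : IsNuisance t c K Q N ψ)
    {m : 𝒵 → ℝ} (hm : Measurable m) {C : ℝ} (hmC : ∀ x, |m x| ≤ C)
    {τ : 𝒵 → ℝ} (hτ : Measurable τ) (hτ1 : ∀ x, |τ x| ≤ 1) :
    ∫ o, (N.outcome (obsTextControls o) - m (obsControls o)) *
        (obsArm t o * τ (obsControls o)) ∂Q =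
      ∫ o, obsArm t o * ((N.armMean (obsControls o) - m (obsControls o)) * τ (obsControls o))
          ∂Q := by
  have e := H.integral_armMean τ hτ ⟨1, hτ1⟩
  have mτ : Measurable fun o : ObsData 𝒴 𝒵 => obsArm t o * τ (obsControls o) :=
    (measurable_obsArm t).mul (hτ.comp measurable_obsControls)
  have bτ : ∀ o : ObsData 𝒴 𝒵, |obsArm t o * τ (obsControls o)| ≤ 1 := fun o => by
    rw [abs_mul]; exact mul_le_one₀ (abs_obsArm_le t o) (abs_nonneg _) (hτ1 _)
  have imq : Integrable (fun o => m (obsControls o)) Q :=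
    integrable_of_abs_le (hm.comp measurable_obsControls) fun o => hmC _
  have i1 := integrable_mul_of_abs_le H.integrable_outcome mτ bτ
  have i2 := integrable_mul_of_abs_le imq mτ bτ
  have i3 := integrable_mul_of_abs_le H.integrable_armMean mτ bτ
  have e' : ∫ o, N.outcome (obsTextControls o) * (obsArm t o * τ (obsControls o)) ∂Q =
      ∫ o, N.armMean (obsControls o) * (obsArm t o * τ (obsControls o)) ∂Q := by
    refine Eq.trans (integral_congr_ae (ae_of_all _ fun o => ?_))
      (e.trans (integral_congr_ae (ae_of_all _ fun o => ?_))) <;> simp only <;> ring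
  calc _ = (∫ o, N.outcome (obsTextControls o) * (obsArm t o * τ (obsControls o)) ∂Q) -
        ∫ o, m (obsControls o) * (obsArm t o * τ (obsControls o)) ∂Q := by
        rw [← integral_sub i1 i2]; simp only [sub_mul]
    _ = _ := by
        rw [e', ← integral_sub i3 i2]
        exact integral_congr_ae (ae_of_all _ fun o => by ring)

lemma labelProb_eq [IsProbabilityMeasure Q] (H : IsNuisance t c K Q N ψ) :
    N.labelProb = ∫ o, obsSampled o ∂Q := by
  have := H.integral_sampled (fun _ => 1) measurable_const ⟨1, fun _ => by simp⟩
  simpa using this.symm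

lemma le_integral_arm_mul [IsProbabilityMeasure Q] (H : IsNuisance t c K Q N ψ)
    {τ : 𝒵 → ℝ} (hτ : Measurable τ) (hτ0 : ∀ z, 0 ≤ τ z)
    (hi : Integrable (fun o => τ (obsControls o)) Q) (hc : 0 < c) :
    c * ∫ o, τ (obsControls o) ∂Q ≤ ∫ o, obsArm t o * τ (obsControls o) ∂Q := by
  rw [H.integral_arm τ hτ hi, ← integral_const_mul]
  refine integral_mono (hi.const_mul c) ?_ fun o =>
    mul_le_mul_of_nonneg_right (H.le_propensity _) (hτ0 _)
  refine (integrable_mul_of_abs_le hi (H.measurable_propensity.comp measurable_obsControls)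
    (C := 1) fun o => ?_).congr (ae_of_all _ fun o => mul_comm _ _)
  rw [Function.comp_apply, abs_of_nonneg (hc.le.trans (H.le_propensity _))]
  exact H.propensity_le_one _

lemma abs_doublyRobust_le (H : IsNuisance t c K Q N ψ) (hc : 0 < c) (h : 𝒴 × 𝒵 → ℝ) (m : 𝒵 → ℝ)
    (o : ObsData 𝒴 𝒵) :
    |doublyRobust t N h m o| ≤ (N.labelProb⁻¹ * c⁻¹ + c⁻¹ + 1) *
      (|obsLabel o| + |h (obsTextControls o)| + |m (obsControls o)|) := by
  have hα := H.labelProb_pos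
  have h1 : |obsSampled o / N.labelProb * (N.surrogacy (obsTextControls o) /
      N.propensity (obsControls o)) * (obsLabel o - h (obsTextControls o))| ≤
      N.labelProb⁻¹ * c⁻¹ * (|obsLabel o| + |h (obsTextControls o)|) := by
    rw [abs_mul, abs_mul]
    have a1 : |obsSampled o / N.labelProb| ≤ N.labelProb⁻¹ := by
      rw [abs_div, abs_of_pos hα, div_eq_mul_inv]
      exact mul_le_of_le_one_left (by positivity) (abs_obsSampled_le o)
    have a2 : |N.surrogacy (obsTextControls o) / N.propensity (obsControls o)| ≤ c⁻¹ := by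
      rw [div_eq_mul_inv, abs_mul]
      calc _ ≤ 1 * c⁻¹ := by
            refine mul_le_mul ?_ (H.abs_inv_propensity_le hc _) (abs_nonneg _) zero_le_one
            rw [abs_of_nonneg (H.surrogacy_nonneg _)]; exact H.surrogacy_le_one _
        _ = _ := one_mul _
    have a3 := abs_sub (obsLabel o) (h (obsTextControls o))
    gcongr
  have h2 : |obsArm t o / N.propensity (obsControls o) *
      (h (obsTextControls o) - m (obsControls o))| ≤
      c⁻¹ * (|h (obsTextControls o)| + |m (obsControls o)|) := by
    rw [abs_mul, div_eq_mul_inv, abs_mul]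
    have a1 := abs_obsArm_le t o
    have a2 := H.abs_inv_propensity_le hc (obsControls o)
    have a3 := abs_sub (h (obsTextControls o)) (m (obsControls o))
    calc _ ≤ 1 * c⁻¹ * (|h (obsTextControls o)| + |m (obsControls o)|) := by gcongr
      _ = _ := by rw [one_mul]
  have h3 : 0 ≤ N.labelProb⁻¹ * c⁻¹ := by positivity
  have h4 : 0 ≤ c⁻¹ := by positivity
  unfold doublyRobust
  refine (abs_add_le _ _).trans ((add_le_add_left (abs_add_le _ _) _).trans ?_)
  have p1 := mul_nonneg h3 (abs_nonneg (m (obsControls o)))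
  have p2 := mul_nonneg h4 (abs_nonneg (obsLabel o))
  have p3 := abs_nonneg (obsLabel o)
  have p4 := abs_nonneg (h (obsTextControls o))
  nlinarith

lemma measurable_doublyRobust (H : IsNuisance t c K Q N ψ) {h : 𝒴 × 𝒵 → ℝ} {m : 𝒵 → ℝ}
    (hh : Measurable h) (hm : Measurable m) : Measurable (doublyRobust t N h m) := by
  have := H.measurable_surrogacy
  have := H.measurable_propensity
  unfold doublyRobust
  fun_prop

end IsNuisance

variable {t : Fin 2} {c K : ℝ} {ν : Measure (ObsData 𝒴 𝒵)} {q : ℝ → ObsData 𝒴 𝒵 → ℝ≥0}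
  {s : ObsData 𝒴 𝒵 → ℝ} {N : ℝ → NuisanceFunctions 𝒴 𝒵} {Ψ : ℝ → ℝ}

lemma exists_abs_labelProb_sub_le (D : IsDiffQuadraticMean ν q s)
    (h₀ : IsNuisance t c K (densityLaw ν (q 0)) (N 0) (Ψ 0))
    (hN : ∀ᶠ ε in 𝓝[≠] (0 : ℝ), IsNuisance t c K (densityLaw ν (q ε)) (N ε) (Ψ ε)) :
    ∃ C : ℝ, 0 < C ∧ ∀ᶠ ε in 𝓝[≠] (0 : ℝ), |(N ε).labelProb - (N 0).labelProb| ≤ C * |ε| := by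
  have := D.prob_zero
  obtain ⟨C, hC, h⟩ := D.exists_abs_integral_sub_le
  refine ⟨C, hC, ?_⟩
  filter_upwards [h, hN, D.prob] with ε h hε hp
  have hb : ∀ o : ObsData 𝒴 𝒵, |obsSampled o ^ 2| ≤ 1 := fun o => by
    rw [abs_pow]; exact pow_le_one₀ (abs_nonneg _) (abs_obsSampled_le o)
  have hm := (measurable_obsSampled (𝒴 := 𝒴) (𝒵 := 𝒵)).pow_const 2
  have hI : ∀ (Q : Measure (ObsData 𝒴 𝒵)) [IsProbabilityMeasure Q],
      ∫ o, obsSampled o ^ 2 ∂Q ≤ 1 := fun Q _ => by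
    refine (integral_mono (integrable_of_abs_le hm hb) (integrable_const 1)
      fun o => (abs_le.1 (hb o)).2).trans (le_of_eq ?_)
    simp
  have := h 1 obsSampled measurable_obsSampled (integrable_of_abs_le hm hb)
    (integrable_of_abs_le hm hb) (hI _) (hI _)
  rw [hε.labelProb_eq, h₀.labelProb_eq]
  simpa using this

/-- Conditional moments of the residual at `ε` and at `0` differ by `O(ε)`, uniformly over bounded
test functions. -/
lemma exists_abs_residual_sub_le (D : IsDiffQuadraticMean ν q s)
    (h₀ : IsNuisance t c K (densityLaw ν (q 0)) (N 0) (Ψ 0))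
    (hN : ∀ᶠ ε in 𝓝[≠] (0 : ℝ), IsNuisance t c K (densityLaw ν (q ε)) (N ε) (Ψ ε))
    {h : 𝒴 × 𝒵 → ℝ} (hh : Measurable h) {C : ℝ} (hhC : ∀ x, |h x| ≤ C) :
    ∃ B : ℝ, 0 < B ∧ ∀ᶠ ε in 𝓝[≠] (0 : ℝ), ∀ τ : Fin 2 × 𝒴 × 𝒵 → ℝ, Measurable τ →
      (∀ x, |τ x| ≤ 1) →
      |(N ε).labelProb * ∫ o, ((N ε).outcome (obsTextControls o) - h (obsTextControls o)) *
          τ (obsDesign o) ∂(densityLaw ν (q ε)) -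
        (N 0).labelProb * ∫ o, ((N 0).outcome (obsTextControls o) - h (obsTextControls o)) *
          τ (obsDesign o) ∂(densityLaw ν (q 0))| ≤ B * |ε| := by
  have := D.prob_zero
  obtain ⟨B, hB, hBe⟩ := D.exists_abs_integral_sub_le
  refine ⟨B * (√(2 * K + 2 * C ^ 2) + 1), by positivity, ?_⟩
  filter_upwards [hBe, hN, D.prob] with ε h1 hε hp τ hτ hτ1
  rw [← hε.integral_residual_mul hh hhC hτ hτ1, ← h₀.integral_residual_mul hh hhC hτ hτ1]
  set f : ObsData 𝒴 𝒵 → ℝ := fun o =>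
    obsSampled o * (obsLabel o - h (obsTextControls o)) * τ (obsDesign o) with hf
  have fm : Measurable f := by fun_prop
  have fb : ∀ o, f o ^ 2 ≤ 2 * obsLabel o ^ 2 + 2 * C ^ 2 := fun o => by
    have a1 : |f o| ≤ |obsLabel o - h (obsTextControls o)| := by
      rw [hf, abs_mul, abs_mul]
      calc _ ≤ 1 * |obsLabel o - h (obsTextControls o)| * 1 := by
            gcongr
            · exact abs_obsSampled_le o
            · exact hτ1 _
        _ = _ := by ring
    have a2 : f o ^ 2 ≤ (obsLabel o - h (obsTextControls o)) ^ 2 := sq_le_sq.2 a1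
    have a3 : h (obsTextControls o) ^ 2 ≤ C ^ 2 := by
      rw [← sq_abs]; have := hhC (obsTextControls o); gcongr
    nlinarith [sq_nonneg (obsLabel o + h (obsTextControls o))]
  have key : ∀ {Q : Measure (ObsData 𝒴 𝒵)} [IsProbabilityMeasure Q],
      Integrable (fun o => obsLabel o ^ 2) Q → ∫ o, obsLabel o ^ 2 ∂Q ≤ K →
      Integrable (fun o => f o ^ 2) Q ∧ ∫ o, f o ^ 2 ∂Q ≤ 2 * K + 2 * C ^ 2 := by
    intro Q _ hi hle
    have hd : Integrable (fun o => 2 * obsLabel o ^ 2 + 2 * C ^ 2) Q :=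
      (hi.const_mul 2).add (integrable_const _)
    have hfi : Integrable (fun o => f o ^ 2) Q :=
      hd.mono' (fm.pow_const 2).aestronglyMeasurable (ae_of_all _ fun o => by
        rw [Real.norm_eq_abs, abs_of_nonneg (sq_nonneg _)]; exact fb o)
    refine ⟨hfi, (integral_mono hfi hd fb).trans ?_⟩
    rw [integral_add (hi.const_mul 2) (integrable_const _), integral_const_mul]
    simp
    linarith
  obtain ⟨a1, a2⟩ := key hε.label_sq hε.label_sq_le
  obtain ⟨b1, b2⟩ := key h₀.label_sq h₀.label_sq_le
  refine (h1 _ f fm a1 b1 a2 b2).trans ?_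
  gcongr
  linarith

lemma eventually_half_le_labelProb (D : IsDiffQuadraticMean ν q s)
    (h₀ : IsNuisance t c K (densityLaw ν (q 0)) (N 0) (Ψ 0))
    (hN : ∀ᶠ ε in 𝓝[≠] (0 : ℝ), IsNuisance t c K (densityLaw ν (q ε)) (N ε) (Ψ ε)) :
    ∀ᶠ ε in 𝓝[≠] (0 : ℝ), (N 0).labelProb / 2 ≤ (N ε).labelProb := by
  obtain ⟨C, hC, h⟩ := exists_abs_labelProb_sub_le D h₀ hN
  have hα := h₀.labelProb_pos
  filter_upwards [h, eventually_abs_lt_nhdsNE (r := (N 0).labelProb / 2 / C) (by positivity)]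
    with ε h1 h2
  rw [lt_div_iff₀ hC] at h2
  linarith [(abs_le.1 h1).1]

/-- Since only second moments of the labels are bounded along the submodel, the outcome regressions
need not converge in `L²`; they do converge in `L¹`. -/
lemma eventually_integral_abs_outcome_sub_le (D : IsDiffQuadraticMean ν q s)
    (h₀ : IsNuisance t c K (densityLaw ν (q 0)) (N 0) (Ψ 0))
    (hN : ∀ᶠ ε in 𝓝[≠] (0 : ℝ), IsNuisance t c K (densityLaw ν (q ε)) (N ε) (Ψ ε))
    {h : 𝒴 × 𝒵 → ℝ} (hh : Measurable h) {C : ℝ} (hhC : ∀ x, |h x| ≤ C) {ι : ℝ} (hι : 0 < ι)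
    (hle : ∫ o, |(N 0).outcome (obsTextControls o) - h (obsTextControls o)|
      ∂(densityLaw ν (q 0)) ≤ ι) :
    ∀ᶠ ε in 𝓝[≠] (0 : ℝ), ∫ o, |(N ε).outcome (obsTextControls o) - h (obsTextControls o)|
      ∂(densityLaw ν (q ε)) ≤ 4 * ι := by
  have := D.prob_zero
  obtain ⟨B, hB, hBe⟩ := exists_abs_residual_sub_le D h₀ hN hh hhC
  have hα := h₀.labelProb_pos
  filter_upwards [hBe, hN, eventually_half_le_labelProb D h₀ hN,
    eventually_abs_lt_nhdsNE (r := (N 0).labelProb * ι / B) (by positivity)] with ε h1 hε h2 h3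
  have mε := hε.measurable_outcome
  -- the sign of the error as a test function turns the conditional moment into an `L¹` norm
  have h4 := h1 (fun x => signOne ((N ε).outcome x.2 - h x.2))
    (measurable_signOne.comp (by fun_prop)) fun x => (abs_signOne _).le
  have h5 : ∫ o, ((N ε).outcome (obsTextControls o) - h (obsTextControls o)) *
      signOne ((N ε).outcome (obsDesign o).2 - h (obsDesign o).2) ∂(densityLaw ν (q ε)) =
      ∫ o, |(N ε).outcome (obsTextControls o) - h (obsTextControls o)| ∂(densityLaw ν (q ε)) :=
    integral_congr_ae (ae_of_all _ fun o => mul_signOne _)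
  have h6 : ∫ o, ((N 0).outcome (obsTextControls o) - h (obsTextControls o)) *
      signOne ((N ε).outcome (obsDesign o).2 - h (obsDesign o).2) ∂(densityLaw ν (q 0)) ≤
      ∫ o, |(N 0).outcome (obsTextControls o) - h (obsTextControls o)| ∂(densityLaw ν (q 0)) := by
    refine (le_abs_self _).trans (abs_integral_le_integral_abs.trans (le_of_eq ?_))
    refine integral_congr_ae (ae_of_all _ fun o => ?_)
    simp only [abs_mul, abs_signOne, mul_one]
  rw [h5] at h4
  rw [lt_div_iff₀ hB] at h3
  set J := ∫ o, |(N ε).outcome (obsTextControls o) - h (obsTextControls o)| ∂(densityLaw ν (q ε))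
  have hJ : 0 ≤ J := integral_nonneg fun o => abs_nonneg _
  have h7 := (abs_le.1 h4).2
  have h8 := mul_le_mul_of_nonneg_left (h6.trans hle) hα.le
  have h9 := mul_le_mul_of_nonneg_right h2 hJ
  have h10 : (N 0).labelProb * J ≤ (N 0).labelProb * (4 * ι) := by linarith
  exact le_of_mul_le_mul_left h10 hα

/-- The regression on the arm `T = t` converges in `L¹` too. The factor `c` is the price of positivity:
the arm sees the controls with weight at least `c`. -/
lemma eventually_integral_abs_armMean_sub_le (D : IsDiffQuadraticMean ν q s) (hc : 0 < c)
    (h₀ : IsNuisance t c K (densityLaw ν (q 0)) (N 0) (Ψ 0))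
    (hN : ∀ᶠ ε in 𝓝[≠] (0 : ℝ), IsNuisance t c K (densityLaw ν (q ε)) (N ε) (Ψ ε))
    {m : 𝒵 → ℝ} (hm : Measurable m) {C : ℝ} (hmC : ∀ x, |m x| ≤ C) {ι : ℝ} (hι : 0 < ι)
    (hle : ∫ o, |(N 0).armMean (obsControls o) - m (obsControls o)|
      ∂(densityLaw ν (q 0)) ≤ ι) :
    ∀ᶠ ε in 𝓝[≠] (0 : ℝ), c * ∫ o, |(N ε).armMean (obsControls o) - m (obsControls o)|
      ∂(densityLaw ν (q ε)) ≤ 4 * ι := by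
  have := D.prob_zero
  obtain ⟨B, hB, hBe⟩ := exists_abs_residual_sub_le D h₀ hN (h := fun x => m x.2) (by fun_prop)
    (C := C) fun x => hmC _
  have hα := h₀.labelProb_pos
  filter_upwards [hBe, hN, eventually_half_le_labelProb D h₀ hN, D.prob,
    eventually_abs_lt_nhdsNE (r := (N 0).labelProb * ι / B) (by positivity)] with ε h1 hε h2 hp h3
  have mε := hε.measurable_armMean
  have m0 := h₀.measurable_armMean
  set τ : 𝒵 → ℝ := fun z => signOne ((N ε).armMean z - m z) with hτ
  have τm : Measurable τ := measurable_signOne.comp (by fun_prop)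
  have τ1 : ∀ z, |τ z| ≤ 1 := fun z => (abs_signOne _).le
  have h4 := h1 (fun x => (if x.1 = t then 1 else 0) * τ x.2.2)
    ((Measurable.ite (measurable_fst (measurableSet_singleton t)) measurable_const
      measurable_const).mul (τm.comp (by fun_prop))) fun x => by
      rw [abs_mul]
      exact mul_le_one₀ (by split_ifs <;> simp) (abs_nonneg _) (τ1 _)
  have h5 := hε.integral_arm_residual hm hmC τm τ1
  have h5' := h₀.integral_arm_residual hm hmC τm τ1
  change |(N ε).labelProb * (∫ o, ((N ε).outcome (obsTextControls o) - m (obsControls o)) *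
    (obsArm t o * τ (obsControls o)) ∂(densityLaw ν (q ε))) - (N 0).labelProb *
    (∫ o, ((N 0).outcome (obsTextControls o) - m (obsControls o)) *
    (obsArm t o * τ (obsControls o)) ∂(densityLaw ν (q 0)))| ≤ B * |ε| at h4
  rw [h5, h5'] at h4
  have i0 : Integrable (fun o => |(N 0).armMean (obsControls o) - m (obsControls o)|)
      (densityLaw ν (q 0)) := (h₀.integrable_armMean.sub
        (integrable_of_abs_le (hm.comp measurable_obsControls) fun o => hmC _)).abs
  have iε : Integrable (fun o => |(N ε).armMean (obsControls o) - m (obsControls o)|)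
      (densityLaw ν (q ε)) := (hε.integrable_armMean.sub
        (integrable_of_abs_le (hm.comp measurable_obsControls) fun o => hmC _)).abs
  have h6 : ∫ o, obsArm t o * (((N 0).armMean (obsControls o) - m (obsControls o)) *
      τ (obsControls o)) ∂(densityLaw ν (q 0)) ≤
      ∫ o, |(N 0).armMean (obsControls o) - m (obsControls o)| ∂(densityLaw ν (q 0)) := by
    refine (le_abs_self _).trans (abs_integral_le_integral_abs.trans ?_)
    refine integral_mono_of_nonneg (ae_of_all _ fun o => abs_nonneg _) i0 (ae_of_all _ fun o => ?_)
    simp only [abs_mul, hτ, abs_signOne, mul_one]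
    exact mul_le_of_le_one_left (abs_nonneg _) (abs_obsArm_le t o)
  have h7 : c * ∫ o, |(N ε).armMean (obsControls o) - m (obsControls o)| ∂(densityLaw ν (q ε)) ≤
      ∫ o, obsArm t o * (((N ε).armMean (obsControls o) - m (obsControls o)) *
      τ (obsControls o)) ∂(densityLaw ν (q ε)) := by
    refine (hε.le_integral_arm_mul (τ := fun z => |(N ε).armMean z - m z|) (by fun_prop)
      (fun z => abs_nonneg _) iε hc).trans (le_of_eq ?_)
    refine integral_congr_ae (ae_of_all _ fun o => ?_)
    simp only [hτ, mul_signOne]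
  rw [lt_div_iff₀ hB] at h3
  set J := ∫ o, |(N ε).armMean (obsControls o) - m (obsControls o)| ∂(densityLaw ν (q ε))
  have hJ : 0 ≤ c * J := mul_nonneg hc.le (integral_nonneg fun o => abs_nonneg _)
  have h8 := (abs_le.1 h4).2
  have h9 := mul_le_mul_of_nonneg_left (h6.trans hle) hα.le
  have h10 := mul_le_mul_of_nonneg_right h2 hJ
  have h12 := mul_le_mul_of_nonneg_left h7 hε.labelProb_pos.le
  have h11 : (N 0).labelProb * (c * J) ≤ (N 0).labelProb * (4 * ι) := by linarith
  exact le_of_mul_le_mul_left h11 hα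

end Pathwise

/-! ### The derivative of the target parameter -/

section Derivative

variable {𝒴 𝒵 : Type*} [MeasurableSpace 𝒴] [MeasurableSpace 𝒵]

lemma tendsto_integral_abs_sub_clamp {X : Type*} [MeasurableSpace X] {Q : Measure X}
    {f : X → ℝ} (hf : Measurable f) (hi : Integrable f Q) :
    Tendsto (fun n : ℕ => ∫ x, |f x - clamp n (f x)| ∂Q) atTop (𝓝 0) := by
  have : Tendsto (fun n : ℕ => ∫ x, |f x - clamp n (f x)| ∂Q) atTop (𝓝 (∫ x, 0 ∂Q)) := by
    refine tendsto_integral_of_dominated_convergence (fun x => 2 * |f x|) (fun n => ?_)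
      (hi.abs.const_mul 2) (fun n => ae_of_all _ fun x => ?_) (ae_of_all _ fun x => ?_)
    · exact ((hf.sub ((measurable_clamp n).comp hf)).abs).aestronglyMeasurable
    · rw [Real.norm_eq_abs, abs_abs]
      have := abs_sub (f x) (clamp n (f x))
      have := abs_clamp_le_abs n (f x)
      linarith
    · refine tendsto_const_nhds.congr' ?_
      filter_upwards [eventually_clamp_eq (f x)] with n hn
      simp [hn]
  simpa using this

variable {t : Fin 2} {c K : ℝ} {ν : Measure (ObsData 𝒴 𝒵)} {q : ℝ → ObsData 𝒴 𝒵 → ℝ≥0}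
  {s : ObsData 𝒴 𝒵 → ℝ} {N : ℝ → NuisanceFunctions 𝒴 𝒵} {Ψ : ℝ → ℝ}

/-- The regressions at the base law can be replaced by bounded ones at an `L¹` cost, and at a cost in
the covariance of the doubly robust moment with the score, of at most `ι`. Bounded regressions keep
the doubly robust moment square integrable along the family. -/
lemma exists_truncation (D : IsDiffQuadraticMean ν q s) (hc : 0 < c)
    (h₀ : IsNuisance t c K (densityLaw ν (q 0)) (N 0) (Ψ 0)) {ι : ℝ} (hι : 0 < ι) :
    ∃ n : ℕ, (∫ o, |(N 0).outcome (obsTextControls o) - clamp n ((N 0).outcome (obsTextControls o))|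
        ∂(densityLaw ν (q 0)) ≤ ι) ∧
      (∫ o, |(N 0).armMean (obsControls o) - clamp n ((N 0).armMean (obsControls o))|
        ∂(densityLaw ν (q 0)) ≤ ι) ∧
      |(∫ o, doublyRobust t (N 0) (fun x => clamp n ((N 0).outcome x))
          (fun z => clamp n ((N 0).armMean z)) o * s o ∂(densityLaw ν (q 0))) -
        ∫ o, doublyRobust t (N 0) (N 0).outcome (N 0).armMean o * s o ∂(densityLaw ν (q 0))| ≤
            ι := by
  have := D.prob_zero
  have mH := h₀.measurable_outcome
  have mM := h₀.measurable_armMean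
  have l1 := tendsto_integral_abs_sub_clamp (mH.comp measurable_obsTextControls)
    h₀.integrable_outcome
  have l2 := tendsto_integral_abs_sub_clamp (mM.comp measurable_obsControls)
    h₀.integrable_armMean
  have hs : ∀ {f : ObsData 𝒴 𝒵 → ℝ}, Measurable f →
      Integrable (fun o => f o ^ 2) (densityLaw ν (q 0)) →
      Integrable (fun o => |f o| * |s o|) (densityLaw ν (q 0)) := fun hf hf2 => by
    refine integrable_mul_of_sq hf.abs D.measurable_score.abs ?_ ?_
    · simpa using hf2
    · simpa using D.score_sq
  set M := ((N 0).labelProb⁻¹ * c⁻¹ + c⁻¹ + 1) with hM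
  have hM0 : 0 ≤ M := by have := h₀.labelProb_pos; positivity
  have l3 : Tendsto (fun n : ℕ => ∫ o, doublyRobust t (N 0) (fun x => clamp n ((N 0).outcome x))
      (fun z => clamp n ((N 0).armMean z)) o * s o ∂(densityLaw ν (q 0))) atTop
      (𝓝 (∫ o, doublyRobust t (N 0) (N 0).outcome (N 0).armMean o *
          s o ∂(densityLaw ν (q 0)))) := by
    refine tendsto_integral_of_dominated_convergence (fun o => M * (|obsLabel o| * |s o| +
      |(N 0).outcome (obsTextControls o)| * |s o| + |(N 0).armMean (obsControls o)| * |s o|))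
      (fun n => ?_) ?_ (fun n => ae_of_all _ fun o => ?_) (ae_of_all _ fun o => ?_)
    · exact ((h₀.measurable_doublyRobust ((measurable_clamp n).comp mH)
        ((measurable_clamp n).comp mM)).mul D.measurable_score).aestronglyMeasurable
    · exact (((hs measurable_obsLabel h₀.label_sq).add
        (hs (mH.comp measurable_obsTextControls) h₀.outcome_sq)).add
        (hs (mM.comp measurable_obsControls) h₀.armMean_sq)).const_mul M
    · rw [Real.norm_eq_abs, abs_mul]
      have h1 := h₀.abs_doublyRobust_le hc (fun x => clamp n ((N 0).outcome x))
          (fun z => clamp n ((N 0).armMean z)) o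
      have h2 := abs_clamp_le_abs n ((N 0).outcome (obsTextControls o))
      have h3 := abs_clamp_le_abs n ((N 0).armMean (obsControls o))
      calc _ ≤ M * (|obsLabel o| + |(N 0).outcome (obsTextControls o)| +
            |(N 0).armMean (obsControls o)|) * |s o| := by
            refine mul_le_mul_of_nonneg_right (h1.trans ?_) (abs_nonneg _)
            gcongr
        _ = _ := by ring
    · refine Tendsto.mul_const _ (tendsto_const_nhds.congr' ?_)
      filter_upwards [eventually_clamp_eq ((N 0).outcome (obsTextControls o)),
        eventually_clamp_eq ((N 0).armMean (obsControls o))] with n h1 h2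
      simp only [doublyRobust, h1, h2]
  have l3' : ∀ᶠ n : ℕ in atTop, |(∫ o, doublyRobust t (N 0) (fun x => clamp n ((N 0).outcome x))
          (fun z => clamp n ((N 0).armMean z)) o * s o ∂(densityLaw ν (q 0))) -
        ∫ o, doublyRobust t (N 0) (N 0).outcome (N 0).armMean o * s o ∂(densityLaw ν (q 0))| ≤
            ι := by
    filter_upwards [Metric.tendsto_nhds.1 l3 ι hι] with n hn
    rw [Real.dist_eq] at hn
    exact hn.le
  obtain ⟨n, h1, h2, h3⟩ := ((l1.eventually (gt_mem_nhds hι)).and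
    ((l2.eventually (gt_mem_nhds hι)).and l3')).exists
  exact ⟨n, h1.le, h2.le, h3⟩

lemma integral_sub_sq_div_le {X : Type*} [MeasurableSpace X] {Q : Measure X}
    {f g π : X → ℝ} (hf : Measurable f) (hg : Measurable g) (hπ : Measurable π)
    (hc : 0 < c) (hπc : ∀ x, c ≤ π x)
    (hf2 : Integrable (fun x => f x ^ 2) Q) (hg2 : Integrable (fun x => g x ^ 2) Q) :
    Integrable (fun x => ((f x - g x) / π x) ^ 2) Q ∧
      ∫ x, ((f x - g x) / π x) ^ 2 ∂Q ≤
        c⁻¹ ^ 2 * (2 * (∫ x, f x ^ 2 ∂Q) + 2 * ∫ x, g x ^ 2 ∂Q) := by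
  have hb : ∀ x, ((f x - g x) / π x) ^ 2 ≤ c⁻¹ ^ 2 * (2 * f x ^ 2 + 2 * g x ^ 2) := fun x => by
    rw [div_eq_inv_mul, mul_pow]
    have hπ0 : 0 < π x := hc.trans_le (hπc x)
    have h1 : (π x)⁻¹ ≤ c⁻¹ := by have := hπc x; gcongr
    have h2 : (f x - g x) ^ 2 ≤ 2 * f x ^ 2 + 2 * g x ^ 2 := by
      nlinarith [sq_nonneg (f x + g x)]
    have h3 : 0 ≤ (π x)⁻¹ := by positivity
    gcongr
  have hi : Integrable (fun x => c⁻¹ ^ 2 * (2 * f x ^ 2 + 2 * g x ^ 2)) Q :=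
    ((hf2.const_mul 2).add (hg2.const_mul 2)).const_mul _
  have hi' : Integrable (fun x => ((f x - g x) / π x) ^ 2) Q :=
    hi.mono' (((hf.sub hg).div hπ).pow_const 2).aestronglyMeasurable (ae_of_all _ fun x => by
      rw [Real.norm_eq_abs, abs_of_nonneg (sq_nonneg _)]; exact hb x)
  refine ⟨hi', (integral_mono hi' hi hb).trans (le_of_eq ?_)⟩
  rw [integral_const_mul, integral_add (hf2.const_mul 2) (hg2.const_mul 2), integral_const_mul,
    integral_const_mul]

lemma integral_abs_div_le {X : Type*} [MeasurableSpace X] {Q : Measure X}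
    {f π : X → ℝ} (hc : 0 < c) (hπc : ∀ x, c ≤ π x) (hf : Integrable f Q) :
    ∫ x, |f x / π x| ∂Q ≤ c⁻¹ * ∫ x, |f x| ∂Q := by
  rw [← integral_const_mul]
  refine integral_mono_of_nonneg (ae_of_all _ fun x => abs_nonneg _) (hf.abs.const_mul _)
    (ae_of_all _ fun x => ?_)
  have hπ0 : 0 < π x := hc.trans_le (hπc x)
  simp only
  rw [abs_div, abs_of_pos hπ0, div_eq_inv_mul]
  have := hπc x
  gcongr

/-- For bounded functions, second moments along the family are eventually at most one above their
value at `0`. -/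
lemma IsDiffQuadraticMean.eventually_integral_sq_le (D : IsDiffQuadraticMean ν q s)
    {f : ObsData 𝒴 𝒵 → ℝ} (hf : Measurable f) {C : ℝ} (hfC : ∀ x, |f x| ≤ C) :
    ∀ᶠ ε in 𝓝[≠] (0 : ℝ), ∫ x, f x ^ 2 ∂(densityLaw ν (q ε)) ≤
      (∫ x, f x ^ 2 ∂(densityLaw ν (q 0))) + 1 := by
  have := D.prob_zero
  obtain ⟨B, hB, h⟩ := D.exists_abs_integral_sub_le
  have hb : ∀ x, |(f x ^ 2) ^ 2| ≤ (C ^ 2) ^ 2 := fun x => by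
    rw [abs_pow, abs_pow]
    have := hfC x
    gcongr
  have hI : ∀ (Q : Measure (ObsData 𝒴 𝒵)) [IsProbabilityMeasure Q],
      ∫ x, (f x ^ 2) ^ 2 ∂Q ≤ (C ^ 2) ^ 2 := fun Q _ => by
    refine (integral_mono (integrable_of_abs_le ((hf.pow_const 2).pow_const 2) hb)
      (integrable_const _) fun o => (abs_le.1 (hb o)).2).trans (le_of_eq ?_)
    simp
  set R := B * √((C ^ 2) ^ 2) with hR
  have hR0 : 0 ≤ R := by positivity
  filter_upwards [h, D.prob, eventually_abs_lt_nhdsNE (r := 1 / (R + 1)) (by positivity)]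
    with ε h1 hp h2
  have h3 := h1 _ (fun x => f x ^ 2) (hf.pow_const 2)
    (integrable_of_abs_le ((hf.pow_const 2).pow_const 2) hb)
    (integrable_of_abs_le ((hf.pow_const 2).pow_const 2) hb) (hI _) (hI _)
  rw [lt_div_iff₀ (by positivity)] at h2
  have := (abs_le.1 h3).2
  nlinarith [abs_nonneg ε]

/-- Along a family that is differentiable in quadratic mean and has nuisance functions with common
bounds, the target parameter is differentiable, and its derivative is the covariance of the score
with the doubly robust moment function. -/
theorem hasDerivAt_of_isNuisance (D : IsDiffQuadraticMean ν q s) (hc : 0 < c)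
    (h₀ : IsNuisance t c K (densityLaw ν (q 0)) (N 0) (Ψ 0))
    (hN : ∀ᶠ ε in 𝓝[≠] (0 : ℝ), IsNuisance t c K (densityLaw ν (q ε)) (N ε) (Ψ ε)) :
    HasDerivAt Ψ (∫ o, doublyRobust t (N 0) (N 0).outcome (N 0).armMean o * s o
      ∂(densityLaw ν (q 0))) 0 := by
  have := D.prob_zero
  rw [hasDerivAt_iff_tendsto_slope, Metric.tendsto_nhds]
  intro η hη
  have hα := h₀.labelProb_pos
  have mH := h₀.measurable_outcome
  have mM := h₀.measurable_armMean
  have mR := h₀.measurable_surrogacy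
  have mP := h₀.measurable_propensity
  obtain ⟨C₁, hC₁, hlab⟩ := exists_abs_labelProb_sub_le D h₀ hN
  -- `K'` bounds the second moments of the regression errors `κ` and `l` below, divided by the
  -- propensity score: `K` for the regression at `ε`, `K + 1` for the truncated regression of the base law
  set K' : ℝ := c⁻¹ ^ 2 * (2 * K + 2 * (K + 1)) with hK'
  obtain ⟨θ₁, hθ₁, hprod⟩ := D.exists_forall_abs_integral_mul_le K' (η := η / 8) (by positivity)
  set α : ℝ := (N 0).labelProb with hαdef
  set θ : ℝ := min θ₁ (η / 8 * (α / C₁)) with hθdef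
  have hθ : 0 < θ := by positivity
  -- `4 ι / c` and `4 ι / c²` bound the `L¹` norms of `κ` and `l`, which must be at most `θ`
  set ι : ℝ := min (η / 8) (min (θ * c / 4) (θ * (c * c) / 4)) with hιdef
  have hι : 0 < ι := by positivity
  have hι1 : ι ≤ η / 8 := min_le_left _ _
  have hι2 : 4 * ι ≤ θ * c := by
    have : ι ≤ θ * c / 4 := (min_le_right _ _).trans (min_le_left _ _)
    linarith
  have hι3 : 4 * ι ≤ θ * (c * c) := by
    have : ι ≤ θ * (c * c) / 4 := (min_le_right _ _).trans (min_le_right _ _)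
    linarith
  obtain ⟨n, hn1, hn2, hn3⟩ := exists_truncation D hc h₀ hι
  set h : 𝒴 × 𝒵 → ℝ := fun x => clamp n ((N 0).outcome x) with hh
  set m : 𝒵 → ℝ := fun z => clamp n ((N 0).armMean z) with hm
  have hhm : Measurable h := (measurable_clamp n).comp mH
  have hmm : Measurable m := (measurable_clamp n).comp mM
  have hhC : ∀ x, |h x| ≤ n := fun x => abs_clamp_le n _
  have hmC : ∀ x, |m x| ≤ n := fun x => abs_clamp_le n _
  set f : ObsData 𝒴 𝒵 → ℝ := doublyRobust t (N 0) h m with hf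
  have fm : Measurable f := h₀.measurable_doublyRobust hhm hmm
  set M := (α⁻¹ * c⁻¹ + c⁻¹ + 1) with hM
  have hM0 : 0 ≤ M := by positivity
  have fb : ∀ o, f o ^ 2 ≤ M ^ 2 * (2 * obsLabel o ^ 2 + 8 * (n : ℝ) ^ 2) := fun o => by
    have h1 := h₀.abs_doublyRobust_le hc h m o
    have h2 : |f o| ≤ M * (|obsLabel o| + 2 * n) := by
      refine h1.trans ?_
      have := hhC (obsTextControls o)
      have := hmC (obsControls o)
      exact mul_le_mul_of_nonneg_left (by linarith) hM0
    rw [← sq_abs (f o)]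
    calc _ ≤ (M * (|obsLabel o| + 2 * n)) ^ 2 := by gcongr
      _ = M ^ 2 * (|obsLabel o| + 2 * n) ^ 2 := by ring
      _ ≤ _ := by
        gcongr
        nlinarith [sq_nonneg (|obsLabel o| - 2 * n), sq_abs (obsLabel o)]
  have fK : ∀ {Q : Measure (ObsData 𝒴 𝒵)} [IsProbabilityMeasure Q],
      Integrable (fun o => obsLabel o ^ 2) Q → ∫ o, obsLabel o ^ 2 ∂Q ≤ K →
      Integrable (fun o => f o ^ 2) Q ∧ ∫ o, f o ^ 2 ∂Q ≤ M ^ 2 * (2 * K + 8 * (n : ℝ) ^ 2) := by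
    intro Q _ hi hle
    have hd : Integrable (fun o => M ^ 2 * (2 * obsLabel o ^ 2 + 8 * (n : ℝ) ^ 2)) Q :=
      ((hi.const_mul 2).add (integrable_const _)).const_mul _
    have hfi : Integrable (fun o => f o ^ 2) Q :=
      hd.mono' (fm.pow_const 2).aestronglyMeasurable (ae_of_all _ fun o => by
        rw [Real.norm_eq_abs, abs_of_nonneg (sq_nonneg _)]; exact fb o)
    refine ⟨hfi, (integral_mono hfi hd fb).trans ?_⟩
    rw [integral_const_mul, integral_add (hi.const_mul 2) (integrable_const _), integral_const_mul]
    simp only [integral_const, probReal_univ, one_smul]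
    gcongr
  obtain ⟨f0i, f0K⟩ := fK h₀.label_sq h₀.label_sq_le
  have hfix := D.tendsto_integral_sub_div fm (K := M ^ 2 * (2 * K + 8 * (n : ℝ) ^ 2))
    (by filter_upwards [hN, D.prob] with ε hε hp using fK hε.label_sq hε.label_sq_le) f0i f0K
  have hfix' := Metric.tendsto_nhds.1 hfix (η / 8) (by positivity)
  have ev1 := eventually_integral_abs_outcome_sub_le D h₀ hN hhm hhC hι hn1
  have ev2 := eventually_integral_abs_armMean_sub_le D hc h₀ hN hmm hmC hι hn2
  have ev3 := D.eventually_integral_sq_le (hhm.comp measurable_obsTextControls) (C := n)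
    fun o => hhC _
  have ev4 := D.eventually_integral_sq_le (hmm.comp measurable_obsControls) (C := n)
    fun o => hmC _
  have hh0 : ∫ o, h (obsTextControls o) ^ 2 ∂(densityLaw ν (q 0)) ≤ K := by
    refine le_trans (integral_mono (integrable_of_abs_le ((hhm.comp
      measurable_obsTextControls).pow_const 2) (C := (n : ℝ) ^ 2) fun o => ?_) h₀.outcome_sq
      fun o => ?_) h₀.outcome_sq_le
    · rw [abs_pow]; have := hhC (obsTextControls o); gcongr
    · exact sq_le_sq.2 (abs_clamp_le_abs _ _)
  have hm0 : ∫ o, m (obsControls o) ^ 2 ∂(densityLaw ν (q 0)) ≤ K := by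
    refine le_trans (integral_mono (integrable_of_abs_le ((hmm.comp
      measurable_obsControls).pow_const 2) (C := (n : ℝ) ^ 2) fun o => ?_) h₀.armMean_sq
      fun o => ?_) h₀.armMean_sq_le
    · rw [abs_pow]; have := hmC (obsControls o); gcongr
    · exact sq_le_sq.2 (abs_clamp_le_abs _ _)
  filter_upwards [hfix', ev1, ev2, ev3, ev4, hN, D.prob, hlab, hprod, eventually_ne_zero_nhdsNE]
    with ε g0 g1 g2 g3 g4 hε hp g5 g6 hε0
  have mHε := hε.measurable_outcome
  have mMε := hε.measurable_armMean
  have mRε := hε.measurable_surrogacy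
  have mPε := hε.measurable_propensity
  have hεp : 0 < |ε| := abs_pos.2 hε0
  simp only [Function.comp_apply] at g3 g4
  -- the doubly robust moment is biased at `ε` by products of errors only, and unbiased at `0`
  have hexp := hε.integral_doublyRobust_sub h₀ hc hhm hmm hhC hmC
  have hexp0 := h₀.integral_doublyRobust_sub h₀ hc hhm hmm hhC hmC
  simp only [sub_self, zero_div, zero_mul, integral_zero, add_zero] at hexp0
  set κ : ObsData 𝒴 𝒵 → ℝ := fun o =>
    ((N ε).outcome (obsTextControls o) - h (obsTextControls o)) / (N 0).propensity (obsControls o)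
    with hκ
  set l : ObsData 𝒴 𝒵 → ℝ := fun o =>
    ((N ε).armMean (obsControls o) - m (obsControls o)) / (N 0).propensity (obsControls o) with hl
  have κm : Measurable κ := by fun_prop
  have lm : Measurable l := by fun_prop
  have hπ : ∀ o : ObsData 𝒴 𝒵, c ≤ (N 0).propensity (obsControls o) := fun o => h₀.le_propensity _
  have hsqb : ∀ {u : ObsData 𝒴 𝒵 → ℝ}, Measurable u → (∀ o, |u o| ≤ n) →
      Integrable (fun o => u o ^ 2) (densityLaw ν (q ε)) := fun hu hb =>
    integrable_of_abs_le (hu.pow_const 2) (C := (n : ℝ) ^ 2) fun o => by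
      rw [abs_pow]; have := hb o; gcongr
  obtain ⟨κi, κK⟩ := integral_sub_sq_div_le (mHε.comp measurable_obsTextControls)
    (hhm.comp measurable_obsTextControls) (mP.comp measurable_obsControls) hc hπ hε.outcome_sq
    (hsqb (hhm.comp measurable_obsTextControls) fun o => hhC _)
  obtain ⟨li, lK⟩ := integral_sub_sq_div_le (mMε.comp measurable_obsControls)
    (hmm.comp measurable_obsControls) (mP.comp measurable_obsControls) hc hπ hε.armMean_sq
    (hsqb (hmm.comp measurable_obsControls) fun o => hmC _)
  simp only [Function.comp_apply] at κi κK li lK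
  have κK' : ∫ o, κ o ^ 2 ∂(densityLaw ν (q ε)) ≤ K' := by
    refine κK.trans ?_
    have := hε.outcome_sq_le
    rw [hK']
    gcongr
    linarith
  have lK' : ∫ o, l o ^ 2 ∂(densityLaw ν (q ε)) ≤ K' := by
    refine lK.trans ?_
    have := hε.armMean_sq_le
    rw [hK']
    gcongr
    linarith
  have iHh : Integrable (fun o => (N ε).outcome (obsTextControls o) - h (obsTextControls o))
      (densityLaw ν (q ε)) := hε.integrable_outcome.sub
        (integrable_of_abs_le (hhm.comp measurable_obsTextControls) fun o => hhC _)
  have iMm : Integrable (fun o => (N ε).armMean (obsControls o) - m (obsControls o))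
      (densityLaw ν (q ε)) := hε.integrable_armMean.sub
        (integrable_of_abs_le (hmm.comp measurable_obsControls) fun o => hmC _)
  have κθ : ∫ o, |κ o| ∂(densityLaw ν (q ε)) ≤ θ := by
    refine (integral_abs_div_le hc hπ iHh).trans ?_
    rw [inv_mul_le_iff₀ hc]
    linarith
  have lθ : ∫ o, |l o| ∂(densityLaw ν (q ε)) ≤ θ := by
    refine (integral_abs_div_le hc hπ iMm).trans ?_
    rw [inv_mul_le_iff₀ hc]
    refine le_of_mul_le_mul_left ?_ hc
    linarith
  have θle : θ ≤ θ₁ := min_le_left _ _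
  have bR : ∀ {ε' : ℝ}, IsNuisance t c K (densityLaw ν (q ε')) (N ε') (Ψ ε') → ∀ x,
      0 ≤ (N ε').surrogacy x ∧ (N ε').surrogacy x ≤ 1 := fun H x =>
    ⟨H.surrogacy_nonneg x, H.surrogacy_le_one x⟩
  have bP : ∀ {ε' : ℝ}, IsNuisance t c K (densityLaw ν (q ε')) (N ε') (Ψ ε') → ∀ x,
      0 ≤ (N ε').propensity x ∧ (N ε').propensity x ≤ 1 := fun H x =>
    ⟨hc.le.trans (H.le_propensity x), H.propensity_le_one x⟩
  have hind : ∀ (B : Set ℝ) (y : ℝ), |B.indicator (1 : ℝ → ℝ) y| ≤ 1 := fun B y => by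
    by_cases hy : y ∈ B <;> simp [hy]
  -- `1{T = t}` has the conditional mean `ρ_ε` at `ε`, so `ρ_0 - ρ_ε` is the conditional bias at `ε` of
  -- a function that is conditionally centred at `0`
  have p1 : |∫ o, ((N 0).surrogacy (obsTextControls o) - (N ε).surrogacy (obsTextControls o)) * κ o
      ∂(densityLaw ν (q ε))| ≤ η / 8 * |ε| := by
    have orth : ∀ {ε' : ℝ}, IsProbabilityMeasure (densityLaw ν (q ε')) →
        IsNuisance t c K (densityLaw ν (q ε')) (N ε') (Ψ ε') → ∀ B : Set ℝ, MeasurableSet B →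
        ∫ o, ((N 0).surrogacy (obsTextControls o) - obsArm t o) *
          (((N 0).surrogacy (obsTextControls o) - (N ε).surrogacy (obsTextControls o)) *
            B.indicator 1 (κ o)) ∂(densityLaw ν (q ε')) =
        ∫ o, ((N 0).surrogacy (obsTextControls o) - (N ε').surrogacy (obsTextControls o)) *
          (((N 0).surrogacy (obsTextControls o) - (N ε).surrogacy (obsTextControls o)) *
            B.indicator 1 (κ o)) ∂(densityLaw ν (q ε')) := by
      intro ε' hp' H B hB
      have mRε' := H.measurable_surrogacy
      set τ : 𝒴 × 𝒵 → ℝ := fun x => ((N 0).surrogacy x - (N ε).surrogacy x) *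
        B.indicator 1 (((N ε).outcome x - h x) / (N 0).propensity x.2) with hτ
      have τm : Measurable τ := (mR.sub mRε).mul
        ((measurable_one.indicator hB).comp (by fun_prop))
      have τb : ∀ x, |τ x| ≤ 1 := fun x => by
        rw [hτ, abs_mul]
        refine mul_le_one₀ ?_ (abs_nonneg _) (hind _ _)
        have h1 := bR h₀ x
        have h2 := bR hε x
        rw [abs_le]; constructor <;> linarith
      have iτ : Integrable (fun o => τ (obsTextControls o)) (densityLaw ν (q ε')) :=
        integrable_of_abs_le (τm.comp measurable_obsTextControls) fun o => τb _
      have e := H.integral_arm_text τ τm iτ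
      have i1 := integrable_mul_of_abs_le iτ (mR.comp measurable_obsTextControls) (C := 1)
        fun o => by
          rw [Function.comp_apply, abs_of_nonneg (bR h₀ _).1]; exact (bR h₀ _).2
      have i2 := integrable_mul_of_abs_le iτ (mRε'.comp measurable_obsTextControls) (C := 1)
        fun o => by
          rw [Function.comp_apply, abs_of_nonneg (bR H _).1]; exact (bR H _).2
      have i3 := integrable_mul_of_abs_le iτ (measurable_obsArm t) (abs_obsArm_le t)
      simp only [mul_comm (τ _), Function.comp_apply] at i1 i2 i3
      change ∫ o, ((N 0).surrogacy (obsTextControls o) - obsArm t o) * τ (obsTextControls o)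
          ∂(densityLaw ν (q ε')) =
        ∫ o, ((N 0).surrogacy (obsTextControls o) - (N ε').surrogacy (obsTextControls o)) *
          τ (obsTextControls o) ∂(densityLaw ν (q ε'))
      simp only [sub_mul]
      rw [integral_sub i1 i3, integral_sub i1 i2, e]
    refine g6 (fun o => (N 0).surrogacy (obsTextControls o) - obsArm t o) _ κ (by fun_prop)
      (by fun_prop) κm (fun o => ?_) (fun o => ?_) κi κK' (κθ.trans θle) (fun B hB => ?_)
      (fun B hB => orth hp hε B hB)
    · have h1 := bR h₀ (obsTextControls o)
      have h2 := obsArm_nonneg t o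
      have h3 := obsArm_le_one t o
      rw [abs_le]; constructor <;> linarith
    · have h1 := bR h₀ (obsTextControls o)
      have h2 := bR hε (obsTextControls o)
      rw [abs_le]; constructor <;> linarith
    · rw [orth D.prob_zero h₀ B hB]; simp
  -- the same for the propensity scores
  have p2 : |∫ o, ((N ε).propensity (obsControls o) - (N 0).propensity (obsControls o)) * l o
      ∂(densityLaw ν (q ε))| ≤ η / 8 * |ε| := by
    have orth : ∀ {ε' : ℝ}, IsProbabilityMeasure (densityLaw ν (q ε')) →
        IsNuisance t c K (densityLaw ν (q ε')) (N ε') (Ψ ε') → ∀ B : Set ℝ, MeasurableSet B →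
        ∫ o, (obsArm t o - (N 0).propensity (obsControls o)) *
          (((N ε).propensity (obsControls o) - (N 0).propensity (obsControls o)) *
            B.indicator 1 (l o)) ∂(densityLaw ν (q ε')) =
        ∫ o, ((N ε').propensity (obsControls o) - (N 0).propensity (obsControls o)) *
          (((N ε).propensity (obsControls o) - (N 0).propensity (obsControls o)) *
            B.indicator 1 (l o)) ∂(densityLaw ν (q ε')) := by
      intro ε' hp' H B hB
      have mPε' := H.measurable_propensity
      set τ : 𝒵 → ℝ := fun x => ((N ε).propensity x - (N 0).propensity x) *
        B.indicator 1 (((N ε).armMean x - m x) / (N 0).propensity x) with hτ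
      have τm : Measurable τ := (mPε.sub mP).mul
        ((measurable_one.indicator hB).comp (by fun_prop))
      have τb : ∀ x, |τ x| ≤ 1 := fun x => by
        rw [hτ, abs_mul]
        refine mul_le_one₀ ?_ (abs_nonneg _) (hind _ _)
        have h1 := bP h₀ x
        have h2 := bP hε x
        rw [abs_le]; constructor <;> linarith
      have iτ : Integrable (fun o => τ (obsControls o)) (densityLaw ν (q ε')) :=
        integrable_of_abs_le (τm.comp measurable_obsControls) fun o => τb _
      have e := H.integral_arm τ τm iτ
      have i1 := integrable_mul_of_abs_le iτ (mP.comp measurable_obsControls) (C := 1)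
        fun o => by
          rw [Function.comp_apply, abs_of_nonneg (bP h₀ _).1]; exact (bP h₀ _).2
      have i2 := integrable_mul_of_abs_le iτ (mPε'.comp measurable_obsControls) (C := 1)
        fun o => by
          rw [Function.comp_apply, abs_of_nonneg (bP H _).1]; exact (bP H _).2
      have i3 := integrable_mul_of_abs_le iτ (measurable_obsArm t) (abs_obsArm_le t)
      simp only [mul_comm (τ _), Function.comp_apply] at i1 i2 i3
      change ∫ o, (obsArm t o - (N 0).propensity (obsControls o)) * τ (obsControls o)
          ∂(densityLaw ν (q ε')) =
        ∫ o, ((N ε').propensity (obsControls o) - (N 0).propensity (obsControls o)) *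
          τ (obsControls o) ∂(densityLaw ν (q ε'))
      simp only [sub_mul]
      rw [integral_sub i3 i1, integral_sub i2 i1, e]
    refine g6 (fun o => obsArm t o - (N 0).propensity (obsControls o)) _ l (by fun_prop)
      (by fun_prop) lm (fun o => ?_) (fun o => ?_) li lK' (lθ.trans θle) (fun B hB => ?_)
      (fun B hB => orth hp hε B hB)
    · have h1 := bP h₀ (obsControls o)
      have h2 := obsArm_nonneg t o
      have h3 := obsArm_le_one t o
      rw [abs_le]; constructor <;> linarith
    · have h1 := bP h₀ (obsControls o)
      have h2 := bP hε (obsControls o)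
      rw [abs_le]; constructor <;> linarith
    · rw [orth D.prob_zero h₀ B hB]; simp
  have iκ : Integrable κ (densityLaw ν (q ε)) := integrable_of_sq κm κi
  have p0 : |((N ε).labelProb - α) / α * ∫ o, (N 0).surrogacy (obsTextControls o) * κ o
      ∂(densityLaw ν (q ε))| ≤ η / 8 * |ε| := by
    have h1 : |∫ o, (N 0).surrogacy (obsTextControls o) * κ o ∂(densityLaw ν (q ε))| ≤ θ := by
      refine abs_integral_le_integral_abs.trans (le_trans ?_ κθ)
      refine integral_mono_of_nonneg (ae_of_all _ fun o => abs_nonneg _) iκ.abs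
        (ae_of_all _ fun o => ?_)
      simp only [abs_mul]
      refine mul_le_of_le_one_left (abs_nonneg _) ?_
      rw [abs_of_nonneg (bR h₀ _).1]; exact (bR h₀ _).2
    rw [abs_mul, abs_div, abs_of_pos hα]
    have h2 : θ ≤ η / 8 * (α / C₁) := min_le_right _ _
    calc _ ≤ C₁ * |ε| / α * (η / 8 * (α / C₁)) := by
          gcongr
          exact h1.trans h2
      _ = _ := by field_simp
  -- the slope is the difference quotient of a fixed moment function, up to the bias divided by `ε`
  rw [Real.dist_eq] at g0 ⊢
  set E₀ := ∫ o, f o ∂(densityLaw ν (q 0))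
  set Eε := ∫ o, f o ∂(densityLaw ν (q ε))
  set I₁ := ∫ o, f o * s o ∂(densityLaw ν (q 0))
  set I₂ := ∫ o, doublyRobust t (N 0) (N 0).outcome (N 0).armMean o * s o ∂(densityLaw ν (q 0))
  have hR : |Eε - Ψ ε| ≤ 3 * (η / 8) * |ε| := by
    rw [hexp]
    refine (abs_add_le _ _).trans ((add_le_add_left (abs_add_le _ _) _).trans ?_)
    linarith
  have hsl : slope Ψ 0 ε - I₂ = ((Eε - E₀) / ε - I₁) + (I₁ - I₂) - (Eε - Ψ ε) / ε := by
    rw [slope_def_field, sub_zero]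
    have : Ψ 0 = E₀ := by linarith
    rw [this]
    field_simp
    ring
  have hR' : |(Eε - Ψ ε) / ε| ≤ 3 * (η / 8) := by
    rw [abs_div, div_le_iff₀ hεp]; exact hR
  rw [hsl]
  calc _ ≤ |(Eε - E₀) / ε - I₁| + |I₁ - I₂| + |(Eε - Ψ ε) / ε| :=
        (abs_sub _ _).trans (add_le_add_left (abs_add_le _ _) _)
    _ < η := by linarith [hn3.trans hι1]

end Derivative

/-! ### Conditional means as integrals against regular conditional distributions -/

section CondMean

variable {Ω β β' γ : Type*} [MeasurableSpace Ω] {μ : Measure Ω}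
  [MeasurableSpace β] [MeasurableSpace β'] [MeasurableSpace γ] [StandardBorelSpace γ] [Nonempty γ]

lemma integral_condDistrib_uncurry [IsFiniteMeasure μ] {X : Ω → β} {Y : Ω → γ} (hX : Measurable X)
    (hY : Measurable Y) {F : β × γ → ℝ} (hF : Measurable F)
    (hi : Integrable (fun ω => F (X ω, Y ω)) μ) :
    ∫ ω, F (X ω, Y ω) ∂μ = ∫ ω, (∫ y, F (X ω, y) ∂(condDistrib Y X μ (X ω))) ∂μ := by
  rw [← integral_condExp hX.comap_le]
  exact integral_congr_ae (condExp_prod_ae_eq_integral_condDistrib hX hY.aemeasurable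
    hF.stronglyMeasurable hi)

lemma integrable_condMean [IsFiniteMeasure μ] {X : Ω → β} {Y : Ω → γ} (hX : Measurable X)
    (hY : Measurable Y) {F : β × γ → ℝ} (hF : Measurable F)
    (hi : Integrable (fun ω => F (X ω, Y ω)) μ) :
    Integrable (fun ω => ∫ y, F (X ω, y) ∂(condDistrib Y X μ (X ω))) μ :=
  Integrable.integral_condDistrib hX.aemeasurable hY.aemeasurable
    ((integrable_map_measure hF.aestronglyMeasurable (hX.prodMk hY).aemeasurable).2 hi)

/-- Conditional means contract the `L²` norm. -/
lemma condMean_sq [IsFiniteMeasure μ] {X : Ω → β} {Y : Ω → γ} (hX : Measurable X)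
    (hY : Measurable Y) {F : β × γ → ℝ} (hF : Measurable F)
    (hi : Integrable (fun ω => F (X ω, Y ω) ^ 2) μ) :
    Integrable (fun ω => (∫ y, F (X ω, y) ∂(condDistrib Y X μ (X ω))) ^ 2) μ ∧
      ∫ ω, (∫ y, F (X ω, y) ∂(condDistrib Y X μ (X ω))) ^ 2 ∂μ ≤ ∫ ω, F (X ω, Y ω) ^ 2 ∂μ := by
  have hi' : Integrable (fun x => F x ^ 2) (μ.map fun ω => (X ω, Y ω)) :=
    (integrable_map_measure (hF.pow_const 2).aestronglyMeasurable
      (hX.prodMk hY).aemeasurable).2 hi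
  have hae : ∀ᵐ ω ∂μ, Integrable (fun y => F (X ω, y) ^ 2) (condDistrib Y X μ (X ω)) :=
    hi'.condDistrib_ae hX.aemeasurable hY.aemeasurable
  have hle : ∀ᵐ ω ∂μ, (∫ y, F (X ω, y) ∂(condDistrib Y X μ (X ω))) ^ 2 ≤
      ∫ y, F (X ω, y) ^ 2 ∂(condDistrib Y X μ (X ω)) := by
    filter_upwards [hae] with ω hω
    have := abs_integral_mul_le_sqrt (ν := condDistrib Y X μ (X ω)) (f := fun y => F (X ω, y))
      (g := fun _ => 1) (by fun_prop) measurable_const hω (by simp)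
    simp only [mul_one, one_pow, integral_const, probReal_univ, smul_eq_mul, Real.sqrt_one] at this
    rw [← sq_abs]
    calc _ ≤ √(∫ y, F (X ω, y) ^ 2 ∂(condDistrib Y X μ (X ω))) ^ 2 := by gcongr
      _ = _ := Real.sq_sqrt (integral_nonneg fun y => sq_nonneg _)
  have hint := integrable_condMean hX hY (hF.pow_const 2) hi
  have hm : AEStronglyMeasurable (fun ω => ∫ y, F (X ω, y) ∂(condDistrib Y X μ (X ω))) μ :=
    (hF.stronglyMeasurable.integral_condDistrib.comp_measurable hX).aestronglyMeasurable
  have hint2 : Integrable (fun ω => (∫ y, F (X ω, y) ∂(condDistrib Y X μ (X ω))) ^ 2) μ := by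
    refine hint.mono' (hm.pow 2) ?_
    filter_upwards [hle] with ω hω
    rwa [Real.norm_eq_abs, abs_of_nonneg (sq_nonneg _)]
  refine ⟨hint2, (integral_mono_ae hint2 hint hle).trans (le_of_eq ?_)⟩
  exact (integral_condDistrib_uncurry hX hY (hF.pow_const 2) hi).symm

/-- If `V` is conditionally independent of `G` given `k`, then the conditional mean of `φ(V)` given
`(k, G)` is its conditional mean given `k`. -/
lemma integral_mul_of_condIndepFun [StandardBorelSpace Ω] [IsFiniteMeasure μ]
    [StandardBorelSpace β'] [Nonempty β']
    {k : Ω → β} {G : Ω → β'} {V : Ω → γ} (hk : Measurable k) (hG : Measurable G)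
    (hV : Measurable V)
    (h : CondIndepFun (MeasurableSpace.comap k inferInstance) hk.comap_le G V μ)
    {φ : γ → ℝ} (hφ : Measurable φ) {τ : β × β' → ℝ} (hτ : Measurable τ)
    (hi : Integrable (fun ω => φ (V ω) * τ (k ω, G ω)) μ) :
    ∫ ω, φ (V ω) * τ (k ω, G ω) ∂μ =
      ∫ ω, (∫ v, φ v ∂(condDistrib V k μ (k ω))) * τ (k ω, G ω) ∂μ := by
  have hae := (condIndepFun_iff_condDistrib_prod_ae_eq_prodMkRight hV hG hk).1 h
  have hae' := ae_of_ae_map (hk.prodMk hG).aemeasurable hae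
  rw [integral_condDistrib_uncurry (X := fun ω => (k ω, G ω)) (hk.prodMk hG) hV
    (F := fun x => φ x.2 * τ x.1) (by fun_prop) hi]
  refine integral_congr_ae ?_
  filter_upwards [hae'] with ω hω
  rw [hω, integral_mul_const, Kernel.prodMkRight_apply]

end CondMean

/-! ### Measurability and positivity on the full data -/

section Blind

variable {𝒴 𝒵 : Type*}

lemma obsDesign_observe (x : FullData 𝒴 𝒵) :
    obsDesign (observe x) = (predictor x, text x, controls x) := rfl

lemma obsControls_observe (x : FullData 𝒴 𝒵) : obsControls (observe x) = controls x := rfl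

/-- The indicator of `T = t` on the full data. -/
def arm (t : Fin 2) (x : FullData 𝒴 𝒵) : ℝ := if predictor x = t then 1 else 0

lemma abs_arm_le (t : Fin 2) (x : FullData 𝒴 𝒵) : |arm t x| ≤ 1 := by
  unfold arm; split_ifs <;> simp

lemma obsSampled_observe (x : FullData 𝒴 𝒵) :
    obsSampled (observe x) = if sampled x = 1 then 1 else 0 := rfl

lemma obsLabel_observe (x : FullData 𝒴 𝒵) :
    obsLabel (observe x) = if sampled x = 1 then annotation x else 0 := rfl

variable [MeasurableSpace 𝒴] [MeasurableSpace 𝒵]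

@[fun_prop] lemma measurable_predictor : Measurable (predictor : FullData 𝒴 𝒵 → _) := by
  unfold predictor; fun_prop

@[fun_prop] lemma measurable_text_fullData : Measurable (text : FullData 𝒴 𝒵 → _) := measurable_text

@[fun_prop] lemma measurable_controls_fullData : Measurable (controls : FullData 𝒴 𝒵 → _) :=
  measurable_controls

@[fun_prop] lemma measurable_sampled : Measurable (sampled : FullData 𝒴 𝒵 → _) := by
  unfold sampled; fun_prop

@[fun_prop] lemma measurable_concept : Measurable (concept : FullData 𝒴 𝒵 → _) := by
  unfold concept; fun_prop

@[fun_prop] lemma measurable_annotation : Measurable (annotation : FullData 𝒴 𝒵 → _) := by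
  unfold annotation; fun_prop

@[fun_prop] lemma measurable_observe : Measurable (observe : FullData 𝒴 𝒵 → _) := by
  unfold observe
  have h : Measurable fun x : FullData 𝒴 𝒵 => if sampled x = 1 then annotation x else (0 : ℝ) :=
    Measurable.ite (measurable_sampled (measurableSet_singleton 1)) measurable_annotation
      measurable_const
  fun_prop

@[fun_prop] lemma measurable_arm (t : Fin 2) : Measurable (arm t : FullData 𝒴 𝒵 → _) :=
  Measurable.ite (measurable_predictor (measurableSet_singleton t)) measurable_const
    measurable_const

section Measurability

variable {p : ℕ} {t : Fin 2} {f : 𝒴 → EuclideanSpace ℝ (Fin p)}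
  {P : ProbabilityMeasure (FullData 𝒴 𝒵)}

lemma measurable_outcomeModel :
    Measurable fun x : EuclideanSpace ℝ (Fin p) × 𝒵 => outcomeModel f P x.1 x.2 := by
  unfold outcomeModel
  exact (StronglyMeasurable.integral_condDistrib (f := fun x : (EuclideanSpace ℝ (Fin p) × 𝒵) × ℝ
    => x.2) (by fun_prop)).measurable

lemma measurable_surrogacyScore :
    Measurable fun x : EuclideanSpace ℝ (Fin p) × 𝒵 => surrogacyScore t f P x.1 x.2 := by
  unfold surrogacyScore
  exact (Kernel.measurable_coe _ (measurableSet_singleton t)).ennreal_toReal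

lemma measurable_propensityScore : Measurable (propensityScore t P) := by
  unfold propensityScore
  exact (Kernel.measurable_coe _ (measurableSet_singleton t)).ennreal_toReal

lemma measurable_meanOutcome [StandardBorelSpace 𝒴] [Nonempty 𝒴] (hf : Measurable f) :
    Measurable (meanOutcome t f P) := by
  have h := (StronglyMeasurable.integral_condDistrib (Y := (text : FullData 𝒴 𝒵 → 𝒴))
    (X := fun x => (predictor x, controls x)) (μ := (P : Measure (FullData 𝒴 𝒵)))
    (f := fun x : (Fin 2 × 𝒵) × 𝒴 => outcomeModel f P (f x.2) x.1.2)
    (measurable_outcomeModel.comp (by fun_prop :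
      Measurable fun x : (Fin 2 × 𝒵) × 𝒴 => (f x.2, x.1.2))).stronglyMeasurable).measurable
  exact h.comp (by fun_prop : Measurable fun z : 𝒵 => (t, z))

end Measurability

/-- Positivity, stated for events. -/
lemma positivity_iff {t : Fin 2} {P : ProbabilityMeasure (FullData 𝒴 𝒵)} {c : ℝ≥0} :
    (∀ᵐ x ∂(P : Measure (FullData 𝒴 𝒵)), (c : ℝ) ≤ propensityScore t P (controls x)) ↔
      ∀ C : Set 𝒵, MeasurableSet C → (c : ℝ≥0∞) * (P : Measure (FullData 𝒴 𝒵)) (controls ⁻¹' C) ≤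
        (P : Measure (FullData 𝒴 𝒵)) (controls ⁻¹' C ∩ predictor ⁻¹' {t}) := by
  set μ := (P : Measure (FullData 𝒴 𝒵))
  have hiff : ∀ z : 𝒵, (c : ℝ) ≤ propensityScore t P z ↔
      (c : ℝ≥0∞) ≤ condDistrib predictor controls μ z {t} := fun z => by
    rw [propensityScore, measureReal_def, ← ENNReal.ofReal_le_iff_le_toReal (measure_ne_top _ _),
      ENNReal.ofReal_coe_nnreal]
  have hset : ∀ C : Set 𝒵, MeasurableSet C →
      ∫⁻ z in C, condDistrib predictor controls μ z {t} ∂(μ.map controls) =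
        μ (controls ⁻¹' C ∩ predictor ⁻¹' {t}) := fun C hC => by
    rw [setLIntegral_map hC (Kernel.measurable_coe _ (measurableSet_singleton t))
      measurable_controls]
    exact setLIntegral_preimage_condDistrib measurable_controls
      measurable_predictor.aemeasurable (measurableSet_singleton t) hC
  constructor
  · intro h C hC
    rw [← hset C hC, ← Measure.map_apply measurable_controls hC, ← setLIntegral_const]
    refine setLIntegral_mono_ae (Kernel.measurable_coe _
        (measurableSet_singleton t)).aemeasurable ?_
    have h' : ∀ᵐ z ∂(μ.map controls), (c : ℝ≥0∞) ≤ condDistrib predictor controls μ z {t} := by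
      refine (ae_map_iff measurable_controls.aemeasurable (measurableSet_le measurable_const
        (Kernel.measurable_coe _ (measurableSet_singleton t)))).2 ?_
      filter_upwards [h] with x hx using (hiff _).1 hx
    filter_upwards [h'] with z hz _ using hz
  · intro h
    have h' : (fun _ => (c : ℝ≥0∞)) ≤ᵐ[μ.map controls]
        fun z => condDistrib predictor controls μ z {t} := by
      have : IsFiniteMeasure (μ.map controls) := Measure.isFiniteMeasure_map _ _
      refine ae_le_of_forall_setLIntegral_le_of_sigmaFinite measurable_const fun C hC _ => ?_
      rw [hset C hC, setLIntegral_const, Measure.map_apply measurable_controls hC]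
      exact h C hC
    filter_upwards [ae_of_ae_map measurable_controls.aemeasurable h'] with x hx using (hiff _).2 hx

/-- Under positivity, moments of functions of the controls are controlled by the arm `T = t`. -/
lemma mul_lintegral_controls_le {t : Fin 2} {P : ProbabilityMeasure (FullData 𝒴 𝒵)} {c : ℝ≥0}
    (h : ∀ᵐ x ∂(P : Measure (FullData 𝒴 𝒵)), (c : ℝ) ≤ propensityScore t P (controls x))
    {F : 𝒵 → ℝ≥0∞} (hF : Measurable F) :
    (c : ℝ≥0∞) * ∫⁻ x, F (controls x) ∂(P : Measure (FullData 𝒴 𝒵)) ≤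
      ∫⁻ x, ENNReal.ofReal (arm t x) * F (controls x) ∂(P : Measure (FullData 𝒴 𝒵)) := by
  set μ := (P : Measure (FullData 𝒴 𝒵))
  have hle : (c : ℝ≥0∞) • μ.map controls ≤ (μ.restrict (predictor ⁻¹' {t})).map controls := by
    refine Measure.le_iff.2 fun C hC => ?_
    rw [Measure.smul_apply, Measure.map_apply measurable_controls hC,
      Measure.map_apply measurable_controls hC, Measure.restrict_apply (measurable_controls hC)]
    exact positivity_iff.1 h C hC
  calc _ = ∫⁻ z, F z ∂((c : ℝ≥0∞) • μ.map controls) := by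
        rw [lintegral_smul_measure, lintegral_map hF measurable_controls, smul_eq_mul]
    _ ≤ ∫⁻ z, F z ∂((μ.restrict (predictor ⁻¹' {t})).map controls) := lintegral_mono' hle le_rfl
    _ = _ := by
        rw [lintegral_map hF measurable_controls,
          ← lintegral_indicator (measurable_predictor (measurableSet_singleton t))]
        refine lintegral_congr fun x => ?_
        by_cases hx : predictor x = t
        · simp [arm, hx]
        · have : x ∉ predictor ⁻¹' {t} := hx
          simp [arm, hx, this]

variable [StandardBorelSpace 𝒴] [StandardBorelSpace 𝒵]

/-- A deterministic coding of the text is blind to the predictor. -/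
lemma IsPerfectAnnotation.isBlindAnnotation {t : Fin 2} {𝓛 : Set ℝ} {p : ℕ} {c : ℝ≥0 × ℝ≥0}
    {P : ProbabilityMeasure (FullData 𝒴 𝒵)} (h : IsPerfectAnnotation t 𝓛 p c P) :
    IsBlindAnnotation t 𝓛 p c P := by
  obtain ⟨g, hg, hg𝓛, hgL⟩ := h.coding
  have hgm : Measurable fun x : FullData 𝒴 𝒵 => g (text x) := hg.comp measurable_text
  refine { h.toCommonConditions with support := ?_, blind := ?_, sampling := ?_ }
  · filter_upwards [hgL] with x hx
    rw [hx]; exact hg𝓛 _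
  · have hk : Measurable fun x : FullData 𝒴 𝒵 => (text x, controls x) := by fun_prop
    have h1 : CondIndepFun
        (MeasurableSpace.comap (fun x : FullData 𝒴 𝒵 => (text x, controls x)) inferInstance)
        hk.comap_le predictor (fun x => g (text x)) (P : Measure (FullData 𝒴 𝒵)) := by
      refine condIndepFun_of_measurable_right measurable_predictor ?_
      exact (show Measurable fun y : 𝒴 × 𝒵 => g y.1 by fun_prop).comp (comap_measurable _)
    rw [condIndepFun_iff_condDistrib_prod_ae_eq_prodMkRight hgm measurable_predictor hk] at h1
    rw [condIndepFun_iff_condDistrib_prod_ae_eq_prodMkRight measurable_concept measurable_predictor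
      hk]
    rwa [condDistrib_congr_left hgL, condDistrib_congr_left hgL]
  · have h1 := h.sampling.comp (φ := fun y : Fin 2 × 𝒴 × 𝒵 => (y.1, y.2.1, y.2.2, g y.2.1))
      (ψ := id) (by fun_prop) measurable_id
    refine h1.congr ?_ (ae_of_all _ fun x => rfl)
    filter_upwards [hgL] with x hx
    simp [hx]

end Blind

/-! ### Nuisance functions under blind annotation -/

/-- Two functions of `X` with the same integrals against bounded functions of `X` agree almost surely:
the sign of their difference is such a test function. -/
lemma ae_eq_of_forall_integral_mul_eq {Ω β : Type*} [MeasurableSpace Ω] [MeasurableSpace β]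
    {μ : Measure Ω} [IsFiniteMeasure μ] {X : Ω → β} (hX : Measurable X) {u v : β → ℝ}
    (hu : Measurable u) (hv : Measurable v) (hui : Integrable (fun ω => u (X ω)) μ)
    (hvi : Integrable (fun ω => v (X ω)) μ)
    (h : ∀ τ : β → ℝ, Measurable τ → (∀ x, |τ x| ≤ 1) →
      ∫ ω, u (X ω) * τ (X ω) ∂μ = ∫ ω, v (X ω) * τ (X ω) ∂μ) :
    ∀ᵐ ω ∂μ, u (X ω) = v (X ω) := by
  have hτ : Measurable fun x => signOne (u x - v x) := measurable_signOne.comp (hu.sub hv)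
  have hτ1 : ∀ x, |signOne (u x - v x)| ≤ 1 := fun x => (abs_signOne _).le
  have h1 := h _ hτ hτ1
  have i1 := integrable_mul_of_abs_le hui (hτ.comp hX) fun ω => hτ1 (X ω)
  have i2 := integrable_mul_of_abs_le hvi (hτ.comp hX) fun ω => hτ1 (X ω)
  simp only [Function.comp_apply] at i1 i2
  have h2 : ∫ ω, |u (X ω) - v (X ω)| ∂μ = 0 := by
    rw [← sub_eq_zero, ← integral_sub i1 i2] at h1
    rw [← h1]
    refine integral_congr_ae (ae_of_all _ fun ω => ?_)
    simp only
    rw [← mul_signOne]; ring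
  have i3 : Integrable (fun ω => |u (X ω) - v (X ω)|) μ := (hui.sub hvi).abs
  rw [integral_eq_zero_iff_of_nonneg (fun ω => abs_nonneg _) i3] at h2
  filter_upwards [h2] with ω hω
  exact sub_eq_zero.1 (abs_eq_zero.1 hω)

section BlindNuisance

lemma integral_ite_eq {t : Fin 2} {κ : Measure (Fin 2)} :
    ∫ i, (if i = t then (1 : ℝ) else 0) ∂κ = κ.real {t} := by
  have : (fun i : Fin 2 => if i = t then (1 : ℝ) else 0) = ({t} : Set (Fin 2)).indicator 1 := by
    ext i; simp [Set.indicator_apply]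
  rw [this, integral_indicator_one (measurableSet_singleton t)]

variable {𝒴 𝒵 : Type*} [MeasurableSpace 𝒴] [MeasurableSpace 𝒵] {t : Fin 2}
  {P : ProbabilityMeasure (FullData 𝒴 𝒵)}

lemma integral_arm_mul_controls {τ : 𝒵 → ℝ} (hτ : Measurable τ)
    (hi : Integrable (fun x => τ (controls x)) (P : Measure (FullData 𝒴 𝒵))) :
    ∫ x, arm t x * τ (controls x) ∂(P : Measure (FullData 𝒴 𝒵)) =
      ∫ x, propensityScore t P (controls x) * τ (controls x) ∂(P : Measure (FullData 𝒴 𝒵)) := by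
  have hm : Measurable fun i : Fin 2 => if i = t then (1 : ℝ) else 0 := measurable_of_finite _
  have := integral_condDistrib_uncurry (μ := (P : Measure (FullData 𝒴 𝒵))) measurable_controls
    measurable_predictor (F := fun x : 𝒵 × Fin 2 => (if x.2 = t then (1 : ℝ) else 0) * τ x.1)
    ((hm.comp measurable_snd).mul (hτ.comp measurable_fst))
    ((integrable_mul_of_abs_le hi (measurable_arm t) (abs_arm_le t)).congr
      (ae_of_all _ fun x => mul_comm _ _))
  refine this.trans (integral_congr_ae (ae_of_all _ fun x => ?_))
  simp only [integral_mul_const, integral_ite_eq]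
  rfl

/-- On the arm `T = t`, conditioning on `(T, Z)` is evaluation of the conditional law at `(t, Z)`. -/
lemma integral_arm_mul_condMean {γ : Type*} [MeasurableSpace γ] [StandardBorelSpace γ]
    [Nonempty γ] {V : FullData 𝒴 𝒵 → γ} (hV : Measurable V) {F : γ × 𝒵 → ℝ} (hF : Measurable F)
    (hi : Integrable (fun x => F (V x, controls x)) (P : Measure (FullData 𝒴 𝒵)))
    {τ : Fin 2 × 𝒵 → ℝ} (hτ : Measurable τ) {C : ℝ} (hτC : ∀ x, |τ x| ≤ C) :
    ∫ x, arm t x * F (V x, controls x) * τ (predictor x, controls x)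
        ∂(P : Measure (FullData 𝒴 𝒵)) =
      ∫ x, arm t x * (∫ v, F (v, controls x) ∂(condDistrib V (fun x => (predictor x, controls x))
        (P : Measure (FullData 𝒴 𝒵)) (t, controls x))) * τ (predictor x, controls x)
        ∂(P : Measure (FullData 𝒴 𝒵)) := by
  have hX : Measurable fun x : FullData 𝒴 𝒵 => (predictor x, controls x) := by fun_prop
  have hm : Measurable fun i : Fin 2 => if i = t then (1 : ℝ) else 0 := measurable_of_finite _
  have h1 : Integrable (fun x => arm t x * F (V x, controls x) * τ (predictor x, controls x))
      (P : Measure (FullData 𝒴 𝒵)) :=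
    integrable_mul_of_abs_le ((integrable_mul_of_abs_le hi (measurable_arm t)
      (abs_arm_le t)).congr (ae_of_all _ fun x => mul_comm _ _)) (hτ.comp hX) fun x => hτC _
  have := integral_condDistrib_uncurry hX hV
    (F := fun x : (Fin 2 × 𝒵) × γ => (if x.1.1 = t then (1 : ℝ) else 0) * F (x.2, x.1.2) * τ x.1)
    (((hm.comp (measurable_fst.comp measurable_fst)).mul (hF.comp (by fun_prop))).mul
      (hτ.comp measurable_fst)) h1
  refine this.trans (integral_congr_ae (ae_of_all _ fun x => ?_))
  simp only [integral_mul_const]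
  by_cases hx : predictor x = t
  · simp [arm, hx]
  · simp [arm, hx]

/-- The nuisance functions of a law with surrogate representation `f`. The propensity score is
truncated from below at its almost sure lower bound `c`, so that the bound holds everywhere. -/
def nuisanceOf [StandardBorelSpace 𝒴] [Nonempty 𝒴] {p : ℕ} (t : Fin 2)
    (f : 𝒴 → EuclideanSpace ℝ (Fin p)) (c : ℝ≥0)
    (P : ProbabilityMeasure (FullData 𝒴 𝒵)) : NuisanceFunctions 𝒴 𝒵 where
  labelProb := (P : Measure (FullData 𝒴 𝒵)).real {x | sampled x = 1}
  outcome x := outcomeModel f P (f x.1) x.2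
  surrogacy x := surrogacyScore t f P (f x.1) x.2
  propensity z := max c (propensityScore t P z)
  armMean := meanOutcome t f P

variable [StandardBorelSpace 𝒴] [StandardBorelSpace 𝒵] {𝓛 : Set ℝ} {p : ℕ} {c : ℝ≥0 × ℝ≥0}
  {f : 𝒴 → EuclideanSpace ℝ (Fin p)}

lemma CommonConditions.annotation_sq (h : CommonConditions t p c P) :
    Integrable (fun x => annotation x ^ 2) (P : Measure (FullData 𝒴 𝒵)) ∧
      ∫ x, annotation x ^ 2 ∂(P : Measure (FullData 𝒴 𝒵)) ≤ (c.1 : ℝ) ^ 2 := by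
  have hm : MemLp annotation 2 (P : Measure (FullData 𝒴 𝒵)) :=
    ⟨measurable_annotation.aestronglyMeasurable, h.moment.trans_lt ENNReal.coe_lt_top⟩
  refine ⟨hm.integrable_sq, ?_⟩
  rw [integral_eq_lintegral_of_nonneg_ae (ae_of_all _ fun x => sq_nonneg _)
    (measurable_annotation.pow_const 2).aestronglyMeasurable]
  refine ENNReal.toReal_le_of_le_ofReal (by positivity) ?_
  have h1 := eLpNorm_nnreal_pow_eq_lintegral (f := (annotation : FullData 𝒴 𝒵 → ℝ)) (p := 2)
    (μ := (P : Measure (FullData 𝒴 𝒵))) (by norm_num)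
  have h2 : ∫⁻ x, ENNReal.ofReal (annotation x ^ 2) ∂(P : Measure (FullData 𝒴 𝒵)) =
      eLpNorm annotation 2 (P : Measure (FullData 𝒴 𝒵)) ^ (2 : ℝ) := by
    refine Eq.trans (lintegral_congr fun x => ?_) h1.symm
    rw [← sq_abs, ENNReal.ofReal_pow (abs_nonneg _), ← Real.enorm_eq_ofReal_abs]
    simp
  rw [h2]
  calc _ ≤ (c.1 : ℝ≥0∞) ^ (2 : ℝ) := by gcongr; exact h.moment
    _ = _ := by
      rw [ENNReal.ofReal_pow c.1.coe_nonneg, ENNReal.ofReal_coe_nnreal]; simp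

lemma CommonConditions.pos_le_one (h : CommonConditions t p c P) : (c.2 : ℝ) ≤ 1 := by
  obtain ⟨x, hx⟩ := h.positivity.exists
  exact hx.trans measureReal_le_one

lemma IsSurrogateRepresentation.condIndepFun_concept (h : IsSurrogateRepresentation P f) :
    CondIndepFun (MeasurableSpace.comap (reprControls f) inferInstance)
      (measurable_reprControls h.choose).comap_le text concept
      (P : Measure (FullData 𝒴 𝒵)) :=
  h.choose_spec.comp measurable_id measurable_fst

lemma IsSurrogateRepresentation.condIndepFun_predictor (h : IsSurrogateRepresentation P f) :
    CondIndepFun (MeasurableSpace.comap (reprControls f) inferInstance)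
      (measurable_reprControls h.choose).comap_le text predictor
      (P : Measure (FullData 𝒴 𝒵)) :=
  h.choose_spec.comp measurable_id measurable_snd

lemma CommonConditions.outcomeModel_eq (h : CommonConditions t p c P)
    (w : EuclideanSpace ℝ (Fin p)) (z : 𝒵) :
    outcomeModel f P w z = ∫ l, l ∂(condDistrib concept (reprControls f)
      (P : Measure (FullData 𝒴 𝒵)) (w, z)) := by
  rw [outcomeModel, condDistrib_congr_left h.perfect]

lemma CommonConditions.concept_sq (h : CommonConditions t p c P) :
    Integrable (fun x => concept x ^ 2) (P : Measure (FullData 𝒴 𝒵)) ∧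
      ∫ x, concept x ^ 2 ∂(P : Measure (FullData 𝒴 𝒵)) ≤ (c.1 : ℝ) ^ 2 := by
  have hae : (fun x => annotation x ^ 2) =ᵐ[(P : Measure (FullData 𝒴 𝒵))]
      fun x => concept x ^ 2 := by
    filter_upwards [h.perfect] with x hx
    rw [hx]
  obtain ⟨h1, h2⟩ := h.annotation_sq
  exact ⟨h1.congr hae, (integral_congr_ae hae).symm.trans_le h2⟩

lemma CommonConditions.integrable_concept (h : CommonConditions t p c P) :
    Integrable concept (P : Measure (FullData 𝒴 𝒵)) :=
  integrable_of_sq measurable_concept h.concept_sq.1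

lemma CommonConditions.outcomeModel_sq (h : CommonConditions t p c P) (hf : Measurable f) :
    Integrable (fun x => outcomeModel f P (f (text x)) (controls x) ^ 2)
      (P : Measure (FullData 𝒴 𝒵)) ∧
    ∫ x, outcomeModel f P (f (text x)) (controls x) ^ 2 ∂(P : Measure (FullData 𝒴 𝒵)) ≤
      (c.1 : ℝ) ^ 2 := by
  obtain ⟨h1, h2⟩ := condMean_sq (measurable_reprControls hf) measurable_annotation
    (F := fun x : (EuclideanSpace ℝ (Fin p) × 𝒵) × ℝ => x.2) (by fun_prop) h.annotation_sq.1
  exact ⟨h1, h2.trans h.annotation_sq.2⟩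

lemma IsSurrogateRepresentation.integral_concept_mul [Nonempty 𝒴]
    (hf : IsSurrogateRepresentation P f) {φ : ℝ → ℝ} (hφ : Measurable φ)
    (hi : Integrable (fun x => φ (concept x)) (P : Measure (FullData 𝒴 𝒵)))
    {τ : 𝒴 × 𝒵 → ℝ} (hτ : Measurable τ) {C : ℝ} (hτC : ∀ x, |τ x| ≤ C) :
    ∫ x, φ (concept x) * τ (text x, controls x) ∂(P : Measure (FullData 𝒴 𝒵)) =
      ∫ x, (∫ l, φ l ∂(condDistrib concept (reprControls f) (P : Measure (FullData 𝒴 𝒵))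
        (reprControls f x))) * τ (text x, controls x) ∂(P : Measure (FullData 𝒴 𝒵)) :=
  integral_mul_of_condIndepFun (measurable_reprControls hf.choose) measurable_text
    measurable_concept hf.condIndepFun_concept hφ
    (τ := fun x : (EuclideanSpace ℝ (Fin p) × 𝒵) × 𝒴 => τ (x.2, x.1.2)) (by fun_prop)
    (integrable_mul_of_abs_le hi
      (hτ.comp (by fun_prop : Measurable fun x : FullData 𝒴 𝒵 => (text x, controls x)))
      fun x => hτC _)

/-- The conditional law of `L` given `(T, Y, Z)` is its conditional law given `(f(Y), Z)`: blindness
removes `T` from the conditioning, and the surrogate property then replaces `Y` by `f(Y)`. -/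
lemma IsBlindAnnotation.integral_comp_concept_mul [Nonempty 𝒴] (h : IsBlindAnnotation t 𝓛 p c P)
    (hf : IsSurrogateRepresentation P f) {φ : ℝ → ℝ} (hφ : Measurable φ)
    (hi : Integrable (fun x => φ (concept x)) (P : Measure (FullData 𝒴 𝒵)))
    {τ : Fin 2 × 𝒴 × 𝒵 → ℝ} (hτ : Measurable τ) {C : ℝ} (hτC : ∀ x, |τ x| ≤ C) :
    ∫ x, φ (concept x) * τ (predictor x, text x, controls x) ∂(P : Measure (FullData 𝒴 𝒵)) =
      ∫ x, (∫ l, φ l ∂(condDistrib concept (reprControls f) (P : Measure (FullData 𝒴 𝒵))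
        (reprControls f x))) * τ (predictor x, text x, controls x)
        ∂(P : Measure (FullData 𝒴 𝒵)) := by
  have hfm := hf.choose
  have hk : Measurable fun x : FullData 𝒴 𝒵 => (text x, controls x) := by fun_prop
  set h' : 𝒴 × 𝒵 → ℝ := fun y => ∫ l, φ l ∂(condDistrib concept (fun x => (text x, controls x))
    (P : Measure (FullData 𝒴 𝒵)) y) with hh'
  have h'm : Measurable h' := (StronglyMeasurable.integral_condDistrib
    (f := fun x : (𝒴 × 𝒵) × ℝ => φ x.2) (hφ.comp measurable_snd).stronglyMeasurable).measurable
  set v : 𝒴 × 𝒵 → ℝ := fun y => ∫ l, φ l ∂(condDistrib concept (reprControls f)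
    (P : Measure (FullData 𝒴 𝒵)) (f y.1, y.2)) with hv
  have hv₀ : Measurable fun y : EuclideanSpace ℝ (Fin p) × 𝒵 =>
      ∫ l, φ l ∂(condDistrib concept (reprControls f) (P : Measure (FullData 𝒴 𝒵)) y) :=
    (StronglyMeasurable.integral_condDistrib
      (f := fun x : (EuclideanSpace ℝ (Fin p) × 𝒵) × ℝ => φ x.2)
      (hφ.comp measurable_snd).stronglyMeasurable).measurable
  have hvm : Measurable v := hv₀.comp (by fun_prop : Measurable fun y : 𝒴 × 𝒵 => (f y.1, y.2))
  have key : ∀ {τ : Fin 2 × 𝒴 × 𝒵 → ℝ}, Measurable τ → ∀ {C : ℝ}, (∀ x, |τ x| ≤ C) →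
      ∫ x, φ (concept x) * τ (predictor x, text x, controls x) ∂(P : Measure (FullData 𝒴 𝒵)) =
      ∫ x, h' (text x, controls x) * τ (predictor x, text x, controls x)
        ∂(P : Measure (FullData 𝒴 𝒵)) := fun {τ} hτ {C} hτC =>
    integral_mul_of_condIndepFun hk measurable_predictor measurable_concept h.blind
      hφ (τ := fun x : (𝒴 × 𝒵) × Fin 2 => τ (x.2, x.1.1, x.1.2))
      (by fun_prop) (integrable_mul_of_abs_le hi
        (hτ.comp (by fun_prop : Measurable fun x : FullData 𝒴 𝒵 =>
          (predictor x, text x, controls x))) fun x => hτC _)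
  have hae : ∀ᵐ x ∂(P : Measure (FullData 𝒴 𝒵)), h' (text x, controls x) =
      v (text x, controls x) := by
    refine ae_eq_of_forall_integral_mul_eq hk h'm hvm
      (integrable_condMean hk measurable_concept (F := fun x : (𝒴 × 𝒵) × ℝ => φ x.2)
        (by fun_prop) hi)
      (integrable_condMean (measurable_reprControls hfm) measurable_concept
        (F := fun x : (EuclideanSpace ℝ (Fin p) × 𝒵) × ℝ => φ x.2) (by fun_prop) hi)
      fun τ hτ hτ1 => ?_
    refine Eq.trans ?_ (hf.integral_concept_mul hφ hi hτ hτ1)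
    exact (key (τ := fun x => τ x.2) (by fun_prop) fun x => hτ1 _).symm
  rw [key hτ hτC]
  refine integral_congr_ae ?_
  filter_upwards [hae] with x hx
  rw [hx]
  rfl

lemma IsBlindAnnotation.integral_concept_mul [Nonempty 𝒴] (h : IsBlindAnnotation t 𝓛 p c P)
    (hf : IsSurrogateRepresentation P f) {τ : Fin 2 × 𝒴 × 𝒵 → ℝ} (hτ : Measurable τ) {C : ℝ}
    (hτC : ∀ x, |τ x| ≤ C) :
    ∫ x, concept x * τ (predictor x, text x, controls x) ∂(P : Measure (FullData 𝒴 𝒵)) =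
      ∫ x, outcomeModel f P (f (text x)) (controls x) * τ (predictor x, text x, controls x)
        ∂(P : Measure (FullData 𝒴 𝒵)) := by
  simp only [h.outcomeModel_eq]
  exact h.integral_comp_concept_mul hf measurable_id h.integrable_concept hτ hτC

lemma IsSurrogateRepresentation.integral_arm_mul [Nonempty 𝒴] (hf : IsSurrogateRepresentation P f)
    {τ : 𝒴 × 𝒵 → ℝ} (hτ : Measurable τ)
    (hi : Integrable (fun x => τ (text x, controls x)) (P : Measure (FullData 𝒴 𝒵))) :
    ∫ x, arm t x * τ (text x, controls x) ∂(P : Measure (FullData 𝒴 𝒵)) =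
      ∫ x, surrogacyScore t f P (f (text x)) (controls x) * τ (text x, controls x)
        ∂(P : Measure (FullData 𝒴 𝒵)) := by
  have := integral_mul_of_condIndepFun (measurable_reprControls hf.choose) measurable_text
    measurable_predictor hf.condIndepFun_predictor
    (φ := fun i => if i = t then (1 : ℝ) else 0) (measurable_of_finite _)
    (τ := fun x : (EuclideanSpace ℝ (Fin p) × 𝒵) × 𝒴 => τ (x.2, x.1.2)) (by fun_prop)
    ((integrable_mul_of_abs_le hi (measurable_arm t) (abs_arm_le t)).congr
      (ae_of_all _ fun x => mul_comm _ _))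
  refine this.trans (integral_congr_ae (ae_of_all _ fun x => ?_))
  simp only [integral_ite_eq]
  rfl

end BlindNuisance

section BlindNuisanceFunctions

variable {𝒴 𝒵 : Type*} [MeasurableSpace 𝒴] [MeasurableSpace 𝒵] {t : Fin 2} {𝓛 : Set ℝ} {p : ℕ}
  {c : ℝ≥0 × ℝ≥0} {P : ProbabilityMeasure (FullData 𝒴 𝒵)} {f : 𝒴 → EuclideanSpace ℝ (Fin p)}

lemma surrogacyScore_nonneg (w : EuclideanSpace ℝ (Fin p)) (z : 𝒵) :
    0 ≤ surrogacyScore t f P w z := measureReal_nonneg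

lemma surrogacyScore_le_one (w : EuclideanSpace ℝ (Fin p)) (z : 𝒵) :
    surrogacyScore t f P w z ≤ 1 := measureReal_le_one

lemma measurable_nuisanceOf_outcome [StandardBorelSpace 𝒴] [Nonempty 𝒴] (hf : Measurable f) :
    Measurable (nuisanceOf t f c.2 P).outcome :=
  measurable_outcomeModel.comp (by fun_prop : Measurable fun x : 𝒴 × 𝒵 => (f x.1, x.2))

variable [StandardBorelSpace 𝒴] [StandardBorelSpace 𝒵]

/-- Sampling is independent of `(T, Y, Z, L)`. -/
lemma IsBlindAnnotation.integral_sampled_mul (h : IsBlindAnnotation t 𝓛 p c P)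
    {φ : Fin 2 × 𝒴 × 𝒵 × ℝ → ℝ} (hφ : Measurable φ) :
    ∫ x, (if sampled x = 1 then (1 : ℝ) else 0) * φ (predictor x, text x, controls x, concept x)
        ∂(P : Measure (FullData 𝒴 𝒵)) =
      (P : Measure (FullData 𝒴 𝒵)).real {x | sampled x = 1} *
        ∫ x, φ (predictor x, text x, controls x, concept x) ∂(P : Measure (FullData 𝒴 𝒵)) := by
  have hm : Measurable fun i : Fin 2 => if i = 1 then (1 : ℝ) else 0 := measurable_of_finite _
  have h1 := (h.sampling.comp hφ hm).symm.integral_fun_mul_eq_mul_integral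
    (hm.comp measurable_sampled).aestronglyMeasurable
    (hφ.comp (by fun_prop)).aestronglyMeasurable
  refine h1.trans ?_
  congr 1
  have : ((fun i : Fin 2 => if i = 1 then (1 : ℝ) else 0) ∘ sampled : FullData 𝒴 𝒵 → ℝ) =
      {x | sampled x = 1}.indicator 1 := by
    ext x; simp [Set.indicator_apply]
  rw [this, integral_indicator_one (show MeasurableSet {x : FullData 𝒴 𝒵 | sampled x = 1} from
    measurable_sampled (measurableSet_singleton 1))]

variable [Nonempty 𝒴]

/-- `E[L | T = t, Z] = m̄_t(Z)`. -/
lemma IsBlindAnnotation.condMean_concept_eq (h : IsBlindAnnotation t 𝓛 p c P)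
    (hf : IsSurrogateRepresentation P f) :
    ∀ᵐ x ∂(P : Measure (FullData 𝒴 𝒵)),
      ∫ l, l ∂(condDistrib concept (fun x => (predictor x, controls x))
        (P : Measure (FullData 𝒴 𝒵)) (t, controls x)) = meanOutcome t f P (controls x) := by
  have hfm := hf.choose
  set μ := (P : Measure (FullData 𝒴 𝒵))
  have hX : Measurable fun x : FullData 𝒴 𝒵 => (predictor x, controls x) := by fun_prop
  set m' : 𝒵 → ℝ := fun z => ∫ l, l ∂(condDistrib concept (fun x => (predictor x, controls x))
    μ (t, z)) with hm'
  have m'm : Measurable m' := (StronglyMeasurable.integral_condDistrib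
    (f := fun x : (Fin 2 × 𝒵) × ℝ => x.2) (by fun_prop)).measurable.comp
    (by fun_prop : Measurable fun z : 𝒵 => (t, z))
  have mm : Measurable (meanOutcome t f P) := measurable_meanOutcome hfm
  have hμm : Measurable fun x : 𝒴 × 𝒵 => outcomeModel f P (f x.1) x.2 :=
    measurable_nuisanceOf_outcome (t := t) (c := c) hfm
  have hμi : Integrable (fun x => outcomeModel f P (f (text x)) (controls x)) μ :=
    integrable_of_sq (hμm.comp (by fun_prop : Measurable fun x : FullData 𝒴 𝒵 =>
      (text x, controls x))) (h.outcomeModel_sq hfm).1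
  have hite : Measurable fun i : Fin 2 => if i = t then (1 : ℝ) else 0 := measurable_of_finite _
  -- restriction to the arm `T = t` keeps conditional means integrable
  have hres : ∀ {g : Fin 2 × 𝒵 → ℝ}, Integrable (fun x => g (predictor x, controls x)) μ →
      Integrable (fun x => (if predictor x = t then (1 : ℝ) else 0) * g (t, controls x)) μ :=
    fun {g} hg => by
      refine (integrable_mul_of_abs_le hg (measurable_arm t) (abs_arm_le t)).congr
        (ae_of_all _ fun x => ?_)
      by_cases hx : predictor x = t <;> simp [arm, hx]
  have i1 := hres (g := fun y => ∫ l, l ∂(condDistrib concept (fun x => (predictor x, controls x))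
    μ y)) (integrable_condMean hX measurable_concept (F := fun x : (Fin 2 × 𝒵) × ℝ => x.2)
      (by fun_prop) h.integrable_concept)
  have i2 := hres (g := fun y => ∫ v, outcomeModel f P (f v) y.2 ∂(condDistrib text
    (fun x => (predictor x, controls x)) μ y)) (integrable_condMean hX measurable_text
      (F := fun x : (Fin 2 × 𝒵) × 𝒴 => outcomeModel f P (f x.2) x.1.2)
      (hμm.comp (by fun_prop : Measurable fun x : (Fin 2 × 𝒵) × 𝒴 => (x.2, x.1.2))) hμi)
  have hae := ae_eq_of_forall_integral_mul_eq (μ := μ) hX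
    (u := fun y => (if y.1 = t then (1 : ℝ) else 0) * m' y.2)
    (v := fun y => (if y.1 = t then (1 : ℝ) else 0) * meanOutcome t f P y.2)
    ((hite.comp measurable_fst).mul (m'm.comp measurable_snd))
    ((hite.comp measurable_fst).mul (mm.comp measurable_snd)) i1 i2 fun τ hτ hτ1 => by
      have e1 := integral_arm_mul_condMean (P := P) (t := t) measurable_concept
        (F := fun x : ℝ × 𝒵 => x.1) (by fun_prop) h.integrable_concept hτ hτ1
      have e2 := integral_arm_mul_condMean (P := P) (t := t) measurable_text hμm hμi hτ hτ1
      have e3 := h.integral_concept_mul hf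
        (τ := fun x => (if x.1 = t then (1 : ℝ) else 0) * τ (x.1, x.2.2))
        ((hite.comp measurable_fst).mul (hτ.comp (by fun_prop))) (C := 1) fun x => by
          rw [abs_mul]
          exact mul_le_one₀ (by split_ifs <;> simp) (abs_nonneg _) (hτ1 _)
      refine e1.symm.trans (Eq.trans ?_ e2)
      refine Eq.trans ?_ (e3.trans ?_) <;>
        refine integral_congr_ae (ae_of_all _ fun x => ?_) <;> simp only [arm] <;> ring
  -- the controls of the arm `T = t` dominate the controls
  set B : Set 𝒵 := {z | m' z ≠ meanOutcome t f P z} with hB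
  have hBm : MeasurableSet B := (measurableSet_eq_fun m'm mm).compl
  have h0 : μ (controls ⁻¹' B ∩ predictor ⁻¹' {t}) = 0 := by
    rw [← nonpos_iff_eq_zero, ← ae_iff.1 hae]
    refine measure_mono fun x hx => ?_
    obtain ⟨hx1, hx2⟩ := hx
    have hx1 : m' (controls x) ≠ meanOutcome t f P (controls x) := hx1
    have hx2 : predictor x = t := hx2
    simpa [hx2] using hx1
  have h1 := (positivity_iff.1 h.positivity B hBm).trans h0.le
  have hc : (c.2 : ℝ≥0∞) ≠ 0 := by simpa using h.pos.ne'
  have h2 : μ (controls ⁻¹' B) = 0 := by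
    rcases mul_eq_zero.1 (nonpos_iff_eq_zero.1 h1) with h3 | h3
    · exact absurd h3 hc
    · exact h3
  rw [ae_iff]
  exact h2

/-- The second moment is taken over all controls although `m̄_t` is a regression on the arm `T = t`:
positivity costs the factor `c₂⁻¹`. -/
lemma IsBlindAnnotation.meanOutcome_sq (h : IsBlindAnnotation t 𝓛 p c P) (hf : Measurable f) :
    Integrable (fun x => meanOutcome t f P (controls x) ^ 2) (P : Measure (FullData 𝒴 𝒵)) ∧
      ∫ x, meanOutcome t f P (controls x) ^ 2 ∂(P : Measure (FullData 𝒴 𝒵)) ≤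
        (c.1 : ℝ) ^ 2 / c.2 := by
  set μ := (P : Measure (FullData 𝒴 𝒵))
  have hc : 0 < (c.2 : ℝ) := h.pos
  have hX : Measurable fun x : FullData 𝒴 𝒵 => (predictor x, controls x) := by fun_prop
  have hμm : Measurable fun x : 𝒴 × 𝒵 => outcomeModel f P (f x.1) x.2 :=
    measurable_nuisanceOf_outcome (t := t) (c := c) hf
  have mm : Measurable (meanOutcome t f P) := measurable_meanOutcome hf
  obtain ⟨h1, h2⟩ := condMean_sq (μ := μ) hX measurable_text
    (F := fun x : (Fin 2 × 𝒵) × 𝒴 => outcomeModel f P (f x.2) x.1.2)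
    (hμm.comp (by fun_prop : Measurable fun x : (Fin 2 × 𝒵) × 𝒴 => (x.2, x.1.2)))
    (h.outcomeModel_sq hf).1
  have h3 := h2.trans (h.outcomeModel_sq hf).2
  have hle : ∀ x : FullData 𝒴 𝒵, ENNReal.ofReal (arm t x) *
      ENNReal.ofReal (meanOutcome t f P (controls x) ^ 2) ≤ ENNReal.ofReal
        ((∫ v, outcomeModel f P (f v) (controls x) ∂(condDistrib text
          (fun x => (predictor x, controls x)) μ (predictor x, controls x))) ^ 2) := fun x => by
    by_cases hx : predictor x = t
    · have h1 : arm t x = 1 := by simp [arm, hx]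
      rw [h1, hx, ENNReal.ofReal_one, one_mul]
      exact le_rfl
    · have h1 : arm t x = 0 := by simp [arm, hx]
      simp [h1]
  have h4 := (mul_lintegral_controls_le h.positivity
    (F := fun z => ENNReal.ofReal (meanOutcome t f P z ^ 2)) (by fun_prop)).trans
    (lintegral_mono hle)
  rw [← ofReal_integral_eq_lintegral_ofReal h1 (ae_of_all _ fun x => sq_nonneg _)] at h4
  have h5 : ∫⁻ x, ENNReal.ofReal (meanOutcome t f P (controls x) ^ 2) ∂μ ≤
      ENNReal.ofReal ((c.1 : ℝ) ^ 2 / c.2) := by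
    rw [ENNReal.ofReal_div_of_pos hc, ENNReal.ofReal_coe_nnreal,
      ENNReal.le_div_iff_mul_le (Or.inl (by simpa using h.pos.ne')) (Or.inl (by simp)), mul_comm]
    exact h4.trans (ENNReal.ofReal_le_ofReal h3)
  have m2 : Measurable fun x : FullData 𝒴 𝒵 => meanOutcome t f P (controls x) ^ 2 :=
    (mm.comp measurable_controls).pow_const 2
  refine ⟨⟨m2.aestronglyMeasurable, ?_⟩, ?_⟩
  · rw [hasFiniteIntegral_iff_ofReal (ae_of_all _ fun x => sq_nonneg _)]
    exact h5.trans_lt ENNReal.ofReal_lt_top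
  · rw [integral_eq_lintegral_of_nonneg_ae (ae_of_all _ fun x => sq_nonneg _)
      m2.aestronglyMeasurable]
    exact ENNReal.toReal_le_of_le_ofReal (by positivity) h5

/-- Under blind annotation, the outcome model, the surrogacy score, the propensity score and the
mean outcome are the nuisance functions of the observed law, whatever surrogate representation they
are computed from. -/
theorem IsBlindAnnotation.isNuisance (h : IsBlindAnnotation t 𝓛 p c P)
    (hf : IsSurrogateRepresentation P f) :
    IsNuisance t c.2 ((c.1 : ℝ) ^ 2 / c.2) ((P : Measure (FullData 𝒴 𝒵)).map observe)
      (nuisanceOf t f c.2 P) (targetParameter t P) := by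
  have hfm := hf.choose
  set μ := (P : Measure (FullData 𝒴 𝒵)) with hμ
  set N := nuisanceOf t f c.2 P with hN
  have hc : 0 < (c.2 : ℝ) := h.pos
  have hc1 := h.pos_le_one
  have mO : Measurable N.outcome := measurable_nuisanceOf_outcome hfm
  have mR : Measurable N.surrogacy := measurable_surrogacyScore.comp
    (by fun_prop : Measurable fun x : 𝒴 × 𝒵 => (f x.1, x.2))
  have mP : Measurable N.propensity := measurable_const.max measurable_propensityScore
  have mM : Measurable N.armMean := measurable_meanOutcome hfm
  have hpr : ∀ᵐ x ∂μ, N.propensity (controls x) = propensityScore t P (controls x) := by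
    filter_upwards [h.positivity] with x hx using max_eq_right hx
  have hcK : (c.1 : ℝ) ^ 2 ≤ (c.1 : ℝ) ^ 2 / c.2 := by
    rw [le_div_iff₀ hc]
    exact mul_le_of_le_one_right (sq_nonneg _) hc1
  have hmap : ∀ {F : ObsData 𝒴 𝒵 → ℝ}, Measurable F →
      ∫ o, F o ∂(μ.map observe) = ∫ x, F (observe x) ∂μ := fun hF =>
    integral_map measurable_observe.aemeasurable hF.aestronglyMeasurable
  have hmapi : ∀ {F : ObsData 𝒴 𝒵 → ℝ}, Measurable F →
      (Integrable F (μ.map observe) ↔ Integrable (fun x => F (observe x)) μ) := fun hF =>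
    integrable_map_measure hF.aestronglyMeasurable measurable_observe.aemeasurable
  have hlab : ∀ x : FullData 𝒴 𝒵, obsLabel (observe x) ^ 2 ≤ annotation x ^ 2 := fun x => by
    rw [obsLabel_observe]
    split_ifs
    · exact le_rfl
    · nlinarith [sq_nonneg (annotation x)]
  have hlabi : Integrable (fun x => obsLabel (observe x) ^ 2) μ :=
    h.annotation_sq.1.mono'
      ((measurable_obsLabel.comp measurable_observe).pow_const 2).aestronglyMeasurable
          (ae_of_all _ fun x => by
      rw [Real.norm_eq_abs, abs_of_nonneg (sq_nonneg _)]; exact hlab x)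
  refine {
    measurable_outcome := mO
    measurable_surrogacy := mR
    measurable_propensity := mP
    measurable_armMean := mM
    labelProb_pos := ENNReal.toReal_pos h.sampled_pos.ne' (measure_ne_top _ _)
    surrogacy_nonneg := fun x => surrogacyScore_nonneg _ _
    surrogacy_le_one := fun x => surrogacyScore_le_one _ _
    le_propensity := fun z => le_max_left _ _
    propensity_le_one := fun z => max_le hc1 measureReal_le_one
    integral_sampled := fun τ hτ _ => ?_
    integral_label := fun τ hτ hτC => ?_
    integral_arm_text := fun τ hτ hi => ?_
    integral_arm := fun τ hτ hi => ?_
    integral_armMean := fun τ hτ hτC => ?_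
    target := ?_
    label_sq := ?_
    label_sq_le := ?_
    outcome_sq := ?_
    outcome_sq_le := ?_
    armMean_sq := ?_
    armMean_sq_le := ?_ }
  · rw [hmap (by fun_prop), hmap (by fun_prop)]
    exact h.integral_sampled_mul (φ := fun x => τ (x.1, x.2.1, x.2.2.1)) (by fun_prop)
  · obtain ⟨C, hC⟩ := hτC
    rw [hmap (by fun_prop), hmap (by fun_prop)]
    have e := h.integral_sampled_mul (φ := fun x => x.2.2.2 * τ (x.1, x.2.1, x.2.2.1))
      (by fun_prop)
    simp only at e
    rw [h.integral_concept_mul hf hτ hC] at e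
    refine Eq.trans (integral_congr_ae ?_) e
    filter_upwards [h.perfect] with x hx
    rw [obsLabel_observe, obsSampled_observe, obsDesign_observe, hx]
    split_ifs <;> ring
  · have hi' := (hmapi (by fun_prop)).1 hi
    rw [hmap (by fun_prop), hmap (by fun_prop)]
    exact hf.integral_arm_mul hτ hi'
  · have hi' := (hmapi (by fun_prop)).1 hi
    rw [hmap (by fun_prop), hmap (by fun_prop)]
    refine (integral_arm_mul_controls (P := P) (t := t) hτ hi').trans (integral_congr_ae ?_)
    filter_upwards [hpr] with x hx
    rw [obsControls_observe, hx]
  · obtain ⟨C, hC⟩ := hτC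
    rw [hmap (by fun_prop), hmap (by fun_prop)]
    exact integral_arm_mul_condMean (P := P) (t := t) (V := text) measurable_text mO
      (integrable_of_sq (mO.comp (by fun_prop)) (h.outcomeModel_sq hfm).1)
      (τ := fun x => τ x.2) (by fun_prop) fun x => hC _
  · rw [hmap (by fun_prop), targetParameter]
    exact integral_congr_ae (h.condMean_concept_eq hf)
  · exact (hmapi (by fun_prop)).2 hlabi
  · rw [hmap (by fun_prop)]
    exact ((integral_mono hlabi h.annotation_sq.1 hlab).trans h.annotation_sq.2).trans hcK
  · exact (hmapi (by fun_prop)).2 (h.outcomeModel_sq hfm).1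
  · rw [hmap (by fun_prop)]
    exact (h.outcomeModel_sq hfm).2.trans hcK
  · exact (hmapi (by fun_prop)).2 (h.meanOutcome_sq hfm).1
  · rw [hmap (by fun_prop)]
    exact (h.meanOutcome_sq hfm).2

end BlindNuisanceFunctions

/-! ### Pathwise differentiability along regular submodels -/

/-- The observed laws of a regular submodel are differentiable in quadratic mean. -/
lemma IsRegularSubmodel.exists_isDiffQuadraticMean {Ω X κ : Type*} [MeasurableSpace Ω]
    [MeasurableSpace X] {ℳ : κ → Set (ProbabilityMeasure Ω)} {obs : Ω → X}
    {P : ProbabilityMeasure Ω} {γ : ℝ → ProbabilityMeasure Ω}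
    {s : Lp ℝ 2 ((P : Measure Ω).map obs)} (h : IsRegularSubmodel ℳ obs P γ s)
    (hobs : Measurable obs) :
    ∃ (ν : Measure X) (q : ℝ → X → ℝ≥0), IsDiffQuadraticMean ν q s ∧
      ∀ᶠ ε in 𝓝 (0 : ℝ), (γ ε : Measure Ω).map obs = densityLaw ν (q ε) := by
  obtain rfl := h.base
  obtain ⟨ν, _, q, hq, hmap, ht⟩ := h.qmd
  have hs : Measurable s := (Lp.stronglyMeasurable s).measurable
  have hprob : ∀ᶠ ε in 𝓝 (0 : ℝ), IsProbabilityMeasure (densityLaw ν (q ε)) := by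
    filter_upwards [hmap] with ε hε
    rw [densityLaw, ← hε]
    exact Measure.isProbabilityMeasure_map hobs.aemeasurable
  refine ⟨ν, q, ⟨hq, hs, hprob.self_of_nhds, hprob.filter_mono nhdsWithin_le_nhds, ?_, ?_⟩, hmap⟩
  · rw [densityLaw, ← hmap.self_of_nhds]
    exact (Lp.memLp s).integrable_sq
  · have h1 := (ENNReal.tendsto_toReal ENNReal.zero_ne_top).comp ht
    rw [ENNReal.toReal_zero] at h1
    refine h1.congr' ?_
    filter_upwards [eventually_ne_zero_nhdsNE] with ε hε
    rw [Function.comp_apply, ← integral_eq_lintegral_of_nonneg_ae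
      (ae_of_all _ fun x => sq_nonneg _)
      (by have := hq ε; have := hq 0; fun_prop), ← integral_div]
    refine integral_congr_ae (ae_of_all _ fun x => ?_)
    simp only
    field_simp

lemma IsRegularSubmodel.mono {Ω X κ : Type*} [MeasurableSpace Ω] [MeasurableSpace X]
    {ℳ ℳ' : κ → Set (ProbabilityMeasure Ω)} {obs : Ω → X} {P : ProbabilityMeasure Ω}
    {γ : ℝ → ProbabilityMeasure Ω} {s : Lp ℝ 2 ((P : Measure Ω).map obs)}
    (h : IsRegularSubmodel ℳ obs P γ s) (hℳ : ∀ k, ℳ k ⊆ ℳ' k) :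
    IsRegularSubmodel ℳ' obs P γ s where
  base := h.base
  mem := h.mem.imp fun k hk => hk.mono fun _ hε => hℳ k hε
  qmd := h.qmd

section Gradient

variable {𝒴 𝒵 : Type*} [MeasurableSpace 𝒴] [MeasurableSpace 𝒵] [StandardBorelSpace 𝒴]
  [Nonempty 𝒴] {t : Fin 2} {𝓛 : Set ℝ} {p : ℕ} {c : ℝ≥0 × ℝ≥0}
  {P : ProbabilityMeasure (FullData 𝒴 𝒵)} {f : 𝒴 → EuclideanSpace ℝ (Fin p)}

lemma influenceFunction_eq {c : ℝ≥0} {o : ObsData 𝒴 𝒵}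
    (ho : (c : ℝ) ≤ propensityScore t P (obsControls o)) :
    influenceFunction t f P o =
      doublyRobust t (nuisanceOf t f c P) (nuisanceOf t f c P).outcome
        (nuisanceOf t f c P).armMean o - targetParameter t P := by
  obtain ⟨T, Y, Z, S, l⟩ := o
  have ho' : (c : ℝ) ≤ propensityScore t P Z := ho
  simp only [doublyRobust, nuisanceOf, influenceFunction, obsControls, obsTextControls, obsSampled,
    obsArm, obsLabel, max_eq_right ho']

variable [StandardBorelSpace 𝒵]

variable (f) in
/-- The influence function is the centred doubly robust moment; truncating the propensity score at its
lower bound only matters on a null set. -/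
lemma CommonConditions.influenceFunction_ae_eq (h : CommonConditions t p c P) :
    influenceFunction t f P =ᵐ[(P : Measure (FullData 𝒴 𝒵)).map observe] fun o =>
      doublyRobust t (nuisanceOf t f c.2 P) (nuisanceOf t f c.2 P).outcome
        (nuisanceOf t f c.2 P).armMean o - targetParameter t P := by
  have h1 : ∀ᵐ o ∂((P : Measure (FullData 𝒴 𝒵)).map observe),
      (c.2 : ℝ) ≤ propensityScore t P (obsControls o) :=
    (ae_map_iff measurable_observe.aemeasurable (measurableSet_le measurable_const
      (measurable_propensityScore.comp measurable_obsControls))).2 h.positivity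
  filter_upwards [h1] with o ho using influenceFunction_eq ho

lemma IsBlindAnnotation.memLp_influenceFunction (h : IsBlindAnnotation t 𝓛 p c P)
    (hf : IsSurrogateRepresentation P f) :
    MemLp (influenceFunction t f P) 2 ((P : Measure (FullData 𝒴 𝒵)).map observe) := by
  have hN := h.isNuisance hf
  set N := nuisanceOf t f c.2 P
  have : IsProbabilityMeasure ((P : Measure (FullData 𝒴 𝒵)).map observe) :=
    Measure.isProbabilityMeasure_map measurable_observe.aemeasurable
  have m1 := hN.measurable_outcome
  have m2 := hN.measurable_armMean
  set Q := (P : Measure (FullData 𝒴 𝒵)).map observe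
  have l1 : MemLp (fun o : ObsData 𝒴 𝒵 => |obsLabel o|) 2 Q :=
    ((memLp_two_iff_integrable_sq measurable_obsLabel.aestronglyMeasurable).2 hN.label_sq).abs
  have l2 : MemLp (fun o : ObsData 𝒴 𝒵 => |N.outcome (obsTextControls o)|) 2 Q :=
    ((memLp_two_iff_integrable_sq
      (m1.comp measurable_obsTextControls).aestronglyMeasurable).2 hN.outcome_sq).abs
  have l3 : MemLp (fun o : ObsData 𝒴 𝒵 => |N.armMean (obsControls o)|) 2 Q :=
    ((memLp_two_iff_integrable_sq
      (m2.comp measurable_obsControls).aestronglyMeasurable).2 hN.armMean_sq).abs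
  have h1 : MemLp (doublyRobust t N N.outcome N.armMean) 2 Q := by
    refine MemLp.of_le_mul ((l1.add l2).add l3)
      (hN.measurable_doublyRobust m1 m2).aestronglyMeasurable
      (c := N.labelProb⁻¹ * (c.2 : ℝ)⁻¹ + (c.2 : ℝ)⁻¹ + 1) (ae_of_all _ fun o => ?_)
    refine (hN.abs_doublyRobust_le h.pos _ _ o).trans (le_of_eq ?_)
    exact congrArg _ (abs_of_nonneg (add_nonneg (add_nonneg (abs_nonneg _) (abs_nonneg _))
      (abs_nonneg _))).symm
  exact MemLp.ae_eq (h.influenceFunction_ae_eq f).symm (h1.sub (memLp_const (targetParameter t P)))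

/-- The parameter is differentiable along regular submodels of the blind-annotation model, with
gradient the influence function of any surrogate representation of the base law. Different laws of
the submodel may need different surrogate representations. -/
lemma IsRegularSubmodel.hasDerivAt_targetParameter {γ : ℝ → ProbabilityMeasure (FullData 𝒴 𝒵)}
    {s : Lp ℝ 2 ((P : Measure (FullData 𝒴 𝒵)).map observe)}
    (h : IsRegularSubmodel (blindAnnotationModel 𝒴 𝒵 t 𝓛 p) observe P γ s)
    (hf : IsSurrogateRepresentation P f) :
    HasDerivAt (fun ε => targetParameter t (γ ε))
      (∫ o, influenceFunction t f P o * s o ∂((P : Measure (FullData 𝒴 𝒵)).map observe)) 0 := by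
  obtain ⟨ν, q, D, hq⟩ := h.exists_isDiffQuadraticMean measurable_observe
  obtain ⟨k, hk⟩ := h.mem
  obtain rfl := h.base
  have hk0 : IsBlindAnnotation t 𝓛 p k (γ 0) := hk.self_of_nhds
  have hq0 := hq.self_of_nhds
  classical
  -- a surrogate representation for each law, the given one at the base law; the moduli of
  -- differentiability do not depend on these choices
  set F : ℝ → 𝒴 → EuclideanSpace ℝ (Fin p) := fun ε =>
    if ε = 0 then f else
      if he : ∃ g : 𝒴 → EuclideanSpace ℝ (Fin p), IsSurrogateRepresentation (γ ε) g
        then he.choose else f with hF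
  have hF0 : F 0 = f := by simp [hF]
  set N : ℝ → NuisanceFunctions 𝒴 𝒵 := fun ε => nuisanceOf t (F ε) k.2 (γ ε) with hN
  have hN0 : N 0 = nuisanceOf t f k.2 (γ 0) := by rw [hN]; simp only [hF0]
  have n0 : IsNuisance t k.2 ((k.1 : ℝ) ^ 2 / k.2) (densityLaw ν (q 0)) (N 0)
      (targetParameter t (γ 0)) := by
    rw [hN0, ← hq0]
    exact hk0.isNuisance hf
  have nε : ∀ᶠ ε in 𝓝[≠] (0 : ℝ), IsNuisance t k.2 ((k.1 : ℝ) ^ 2 / k.2)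
      (densityLaw ν (q ε)) (N ε) (targetParameter t (γ ε)) := by
    filter_upwards [eventually_ne_zero_nhdsNE, hk.filter_mono nhdsWithin_le_nhds,
      hq.filter_mono nhdsWithin_le_nhds] with ε hε hkε hqε
    have hkε : IsBlindAnnotation t 𝓛 p k (γ ε) := hkε
    have hs : IsSurrogateRepresentation (γ ε) (F ε) := by
      simp only [hF, hε, if_false, dif_pos hkε.sufficiency]
      exact hkε.sufficiency.choose_spec
    rw [← hqε]
    exact hkε.isNuisance hs
  have main := hasDerivAt_of_isNuisance D hk0.pos n0 nε
  rw [← hq0] at main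
  convert main using 1
  rw [hN0]
  have hQp : IsProbabilityMeasure ((γ 0 : Measure (FullData 𝒴 𝒵)).map observe) :=
    Measure.isProbabilityMeasure_map measurable_observe.aemeasurable
  have hsi : Integrable s ((γ 0 : Measure (FullData 𝒴 𝒵)).map observe) :=
      (Lp.memLp s).integrable (by norm_num)
  -- scores have mean zero
  have hs0 : ∫ o, s o ∂((γ 0 : Measure (FullData 𝒴 𝒵)).map observe) = 0 := by
    have h1 := D.tendsto_integral_sub_div (f := fun _ => 1) measurable_const (K := 1)
      (by
        filter_upwards [D.prob] with ε hε
        simp) (by have := D.prob_zero; simp) (by have := D.prob_zero; simp)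
    rw [← hq0] at h1
    simp only [one_mul] at h1
    refine tendsto_nhds_unique h1 (tendsto_const_nhds.congr' ?_)
    filter_upwards [D.prob] with ε hε
    simp
  set G := doublyRobust t (nuisanceOf t f k.2 (γ 0)) (nuisanceOf t f k.2 (γ 0)).outcome
        (nuisanceOf t f k.2 (γ 0)).armMean with hG
  have hφ := hk0.influenceFunction_ae_eq f
  have hint : Integrable (fun o => influenceFunction t f (γ 0) o * s o)
      ((γ 0 : Measure (FullData 𝒴 𝒵)).map observe) :=
    (hk0.memLp_influenceFunction hf).integrable_mul (Lp.memLp s)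
  have e : (fun o => influenceFunction t f (γ 0) o * s o + targetParameter t (γ 0) * s o)
      =ᵐ[((γ 0 : Measure (FullData 𝒴 𝒵)).map observe)]
      fun o => G o * s o := by
    filter_upwards [hφ] with o ho
    rw [ho]; ring
  rw [← integral_congr_ae e, integral_add hint (hsi.const_mul _), integral_const_mul, hs0, mul_zero,
    add_zero]

end Gradient

/-! ### Reweighting a law -/

section Reweight

variable {Ω β β' γ : Type*} [MeasurableSpace Ω] {μ : Measure Ω}
  [MeasurableSpace β] [MeasurableSpace β'] [MeasurableSpace γ]

/-- Conditional independence of `G` and `V` given `k` survives reweighting by a function of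
`(k, G)`: the conditional law of `V` given `(k, G)` does not change. -/
lemma condIndepFun_withDensity [StandardBorelSpace Ω] [IsFiniteMeasure μ] [StandardBorelSpace β']
    [Nonempty β'] [StandardBorelSpace γ] [Nonempty γ] {k : Ω → β} {G : Ω → β'} {V : Ω → γ}
    (hk : Measurable k) (hG : Measurable G) (hV : Measurable V)
    (h : CondIndepFun (MeasurableSpace.comap k inferInstance) hk.comap_le G V μ)
    {w : β × β' → ℝ≥0∞} (hw : Measurable w) {Q : Measure Ω} [IsFiniteMeasure Q]
    (hQ : Q = μ.withDensity fun ω => w (k ω, G ω)) :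
    CondIndepFun (MeasurableSpace.comap k inferInstance) hk.comap_le G V Q := by
  have hX : Measurable fun ω => (k ω, G ω) := hk.prodMk hG
  have hae := (condIndepFun_iff_condDistrib_prod_ae_eq_prodMkRight hV hG hk).1 h
  set κ := condDistrib V k μ with hκ
  have hκm : ∀ {F : (β × β') × γ → ℝ≥0∞}, Measurable F →
      Measurable fun x : β × β' => ∫⁻ v, F (x, v) ∂(κ x.1) := fun hF =>
    Measurable.lintegral_kernel_prod_right' (κ := κ.prodMkRight β') hF
  have e1 : ∀ {F : (β × β') × γ → ℝ≥0∞}, Measurable F →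
      ∫⁻ ω, F ((k ω, G ω), V ω) ∂μ = ∫⁻ ω, (∫⁻ v, F ((k ω, G ω), v) ∂(κ (k ω))) ∂μ :=
          fun {F} hF => by
    rw [← lintegral_map (g := fun ω => ((k ω, G ω), V ω)) hF (hX.prodMk hV),
      ← compProd_map_condDistrib hV.aemeasurable, Measure.compProd_congr hae,
      Measure.lintegral_compProd hF]
    exact lintegral_map (hκm hF) hX
  have hwX : Measurable fun ω => w (k ω, G ω) := hw.comp hX
  have e2 : ∀ {F : (β × β') × γ → ℝ≥0∞}, Measurable F →
      ∫⁻ ω, F ((k ω, G ω), V ω) ∂Q = ∫⁻ ω, (∫⁻ v, F ((k ω, G ω), v) ∂(κ (k ω))) ∂Q :=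
          fun {F} hF => by
    have hFX : Measurable fun ω => F ((k ω, G ω), V ω) := hF.comp (hX.prodMk hV)
    have hκX : Measurable fun ω => ∫⁻ v, F ((k ω, G ω), v) ∂(κ (k ω)) := (hκm hF).comp hX
    rw [hQ, lintegral_withDensity_eq_lintegral_mul _ hwX hFX,
      lintegral_withDensity_eq_lintegral_mul _ hwX hκX]
    refine (e1 (F := fun y => w y.1 * F y) (by fun_prop)).trans (lintegral_congr fun ω => ?_)
    have hFω : Measurable fun v => F ((k ω, G ω), v) := hF.comp measurable_prodMk_left
    exact lintegral_const_mul (w (k ω, G ω)) hFω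
  have a1 : condDistrib V (fun ω => (k ω, G ω)) Q =ᵐ[Q.map fun ω => (k ω, G ω)]
      κ.prodMkRight β' := by
    refine condDistrib_ae_eq_of_measure_eq_compProd _ hV.aemeasurable (Measure.ext fun s hs => ?_)
    rw [Measure.map_apply (hX.prodMk hV) hs, Measure.compProd_apply hs,
      lintegral_map (Kernel.measurable_kernel_prodMk_left hs) hX,
      ← lintegral_indicator_one (hX.prodMk hV hs)]
    refine (e2 (F := s.indicator 1) (measurable_one.indicator hs)).trans
      (lintegral_congr fun ω => ?_)
    rw [← lintegral_indicator_one (measurable_prodMk_left hs)]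
    rfl
  have a2 : condDistrib V k Q =ᵐ[Q.map k] κ := by
    refine condDistrib_ae_eq_of_measure_eq_compProd _ hV.aemeasurable (Measure.ext fun s hs => ?_)
    rw [Measure.map_apply (hk.prodMk hV) hs, Measure.compProd_apply hs,
      lintegral_map (Kernel.measurable_kernel_prodMk_left hs) hk,
      ← lintegral_indicator_one (hk.prodMk hV hs)]
    have hp : Measurable fun y : (β × β') × γ => (y.1.1, y.2) := by fun_prop
    refine (e2 (F := fun y => s.indicator 1 (y.1.1, y.2))
      ((measurable_one.indicator hs).comp hp)).trans (lintegral_congr fun ω => ?_)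
    rw [← lintegral_indicator_one (measurable_prodMk_left hs)]
    rfl
  rw [condIndepFun_iff_condDistrib_prod_ae_eq_prodMkRight hV hG hk]
  have a3 : Q.map k = (Q.map fun ω => (k ω, G ω)).map Prod.fst := by
    rw [Measure.map_map measurable_fst hX]; rfl
  rw [a3] at a2
  filter_upwards [a1, ae_of_ae_map measurable_fst.aemeasurable a2] with x h1 h2
  rw [h1, Kernel.prodMkRight_apply, Kernel.prodMkRight_apply, h2]

/-- Independence of `A` and `S` survives reweighting by a function of `A`. -/
lemma indepFun_withDensity [IsProbabilityMeasure μ] {A : Ω → β} {S : Ω → γ} (hA : Measurable A)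
    (hS : Measurable S) (h : IndepFun A S μ) {w : β → ℝ≥0∞} (hw : Measurable w) {Q : Measure Ω}
    [IsProbabilityMeasure Q] (hQ : Q = μ.withDensity fun ω => w (A ω)) : IndepFun A S Q := by
  have key : ∀ s u, MeasurableSet s → MeasurableSet u →
      Q (A ⁻¹' s ∩ S ⁻¹' u) = Q (A ⁻¹' s) * μ (S ⁻¹' u) := fun s u hs hu => by
    have e := lintegral_mul_eq_lintegral_mul_lintegral_of_indepFun''
      (f := fun ω => s.indicator w (A ω)) (g := fun ω => u.indicator 1 (S ω))
      ((hw.indicator hs).comp hA).aemeasurable ((measurable_one.indicator hu).comp hS).aemeasurable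
      (h.comp (hw.indicator hs) (measurable_one.indicator hu))
    rw [hQ, withDensity_apply _ ((hA hs).inter (hS hu)), withDensity_apply _ (hA hs),
      ← lintegral_indicator ((hA hs).inter (hS hu)), ← lintegral_indicator (hA hs),
      ← lintegral_indicator_one (hS hu)]
    refine Eq.trans (lintegral_congr fun ω => ?_) e
    by_cases h1 : A ω ∈ s <;> by_cases h2 : S ω ∈ u <;> simp [h1, h2]
  rw [indepFun_iff_measure_inter_preimage_eq_mul]
  intro s u hs hu
  have h1 := key Set.univ u MeasurableSet.univ hu
  rw [Set.preimage_univ, Set.univ_inter, measure_univ, one_mul] at h1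
  rw [key s u hs hu, h1]

end Reweight

section ReweightModel

variable {𝒴 𝒵 : Type*} [MeasurableSpace 𝒴] [MeasurableSpace 𝒵] [StandardBorelSpace 𝒴]
  [StandardBorelSpace 𝒵] {t : Fin 2} {𝓛 : Set ℝ} {p : ℕ} {c : ℝ≥0 × ℝ≥0}
  {P Q : ProbabilityMeasure (FullData 𝒴 𝒵)} {f : 𝒴 → EuclideanSpace ℝ (Fin p)}

lemma IsSurrogateRepresentation.reweight [Nonempty 𝒴] (hf : IsSurrogateRepresentation P f)
    {w : (EuclideanSpace ℝ (Fin p) × 𝒵) × ℝ × Fin 2 → ℝ≥0∞} (hw : Measurable w)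
    (hQ : (Q : Measure (FullData 𝒴 𝒵)) = (P : Measure (FullData 𝒴 𝒵)).withDensity fun x =>
      w (reprControls f x, (concept x, predictor x))) : IsSurrogateRepresentation Q f := by
  refine ⟨hf.choose, CondIndepFun.symm ?_⟩
  exact condIndepFun_withDensity (measurable_reprControls hf.choose) (by fun_prop) (by fun_prop)
    hf.choose_spec.symm hw hQ

/-- The shared conditions survive reweighting by a function of `(W, Z, L, T)` that is bounded above
and away from zero, with worse constants. -/
lemma CommonConditions.reweight [Nonempty 𝒴] (h : CommonConditions t p c P)
    (hf : IsSurrogateRepresentation P f)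
    {w : (EuclideanSpace ℝ (Fin p) × 𝒵) × ℝ × Fin 2 → ℝ≥0∞} (hw : Measurable w)
    (hQ : (Q : Measure (FullData 𝒴 𝒵)) = (P : Measure (FullData 𝒴 𝒵)).withDensity fun x =>
      w (reprControls f x, (concept x, predictor x)))
    (hlow : ∀ y, 2⁻¹ ≤ w y) (hup : ∀ y, w y ≤ 2) :
    CommonConditions t p (2 * c.1, c.2 / 4) Q := by
  have hac : (Q : Measure (FullData 𝒴 𝒵)) ≪ (P : Measure (FullData 𝒴 𝒵)) :=
    hQ ▸ withDensity_absolutelyContinuous _ _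
  have hQle : (Q : Measure (FullData 𝒴 𝒵)) ≤ (2 : ℝ≥0∞) • (P : Measure (FullData 𝒴 𝒵)) := by
    rw [hQ, ← withDensity_const]
    exact withDensity_mono (ae_of_all _ fun x => hup _)
  have hleQ : (2⁻¹ : ℝ≥0∞) • (P : Measure (FullData 𝒴 𝒵)) ≤ (Q : Measure (FullData 𝒴 𝒵)) := by
    rw [hQ, ← withDensity_const]
    exact withDensity_mono (ae_of_all _ fun x => hlow _)
  refine ⟨hac.ae_le h.perfect, ?_, ⟨f, hf.reweight hw hQ⟩, ?_, ?_, ?_⟩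
  · refine lt_of_lt_of_le ?_ (hleQ _)
    rw [Measure.smul_apply, smul_eq_mul]
    exact ENNReal.mul_pos (by simp) h.sampled_pos.ne'
  · refine (eLpNorm_mono_measure _ hQle).trans ?_
    rw [eLpNorm_smul_measure_of_ne_zero (by norm_num), smul_eq_mul, ENNReal.coe_mul]
    refine mul_le_mul' ?_ h.moment
    calc (2 : ℝ≥0∞) ^ (1 / (2 : ℝ≥0∞)).toReal ≤ 2 ^ (1 : ℝ) :=
          ENNReal.rpow_le_rpow_of_exponent_le (by norm_num) (by simp; norm_num)
      _ = _ := by simp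
  · exact div_pos h.pos (by norm_num)
  · refine positivity_iff.2 fun C hC => ?_
    have h1 := positivity_iff.1 h.positivity C hC
    have h2 := hQle (controls ⁻¹' C)
    have h3 := hleQ (controls ⁻¹' C ∩ predictor ⁻¹' {t})
    rw [Measure.smul_apply, smul_eq_mul] at h2 h3
    have h4 : ((c.2 / 4 : ℝ≥0) : ℝ≥0∞) * 2 = 2⁻¹ * c.2 := by
      have : c.2 / 4 * 2 = 2⁻¹ * c.2 := by ext; push_cast; ring
      have h5 := congrArg (fun r : ℝ≥0 => (r : ℝ≥0∞)) this
      simpa [ENNReal.coe_mul] using h5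
    calc _ ≤ ((c.2 / 4 : ℝ≥0) : ℝ≥0∞) * (2 * (P : Measure (FullData 𝒴 𝒵)) (controls ⁻¹' C)) :=
          mul_le_mul_right h2 _
      _ = 2⁻¹ * (c.2 * (P : Measure (FullData 𝒴 𝒵)) (controls ⁻¹' C)) := by
          rw [← mul_assoc, h4, mul_assoc]
      _ ≤ 2⁻¹ * (P : Measure (FullData 𝒴 𝒵)) (controls ⁻¹' C ∩ predictor ⁻¹' {t}) :=
          mul_le_mul_right h1 _
      _ ≤ _ := h3

end ReweightModel

/-! ### Linear tilts as regular submodels -/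

/-- The density `1 + ε b` of the linear tilt in direction `b`. -/
def tiltDensity {Ω : Type*} (b : Ω → ℝ) (ε : ℝ) (x : Ω) : ℝ≥0 := Real.toNNReal (1 + ε * b x)

section Tilt

variable {Ω X κ : Type*} {b : Ω → ℝ} {C ε : ℝ}

lemma abs_mul_le_half (hbC : ∀ x, |b x| ≤ C) (hε : |ε| * C ≤ 1 / 2) (x : Ω) :
    |ε * b x| ≤ 1 / 2 := by
  rw [abs_mul]
  exact (mul_le_mul_of_nonneg_left (hbC x) (abs_nonneg _)).trans hε

lemma coe_tiltDensity (hbC : ∀ x, |b x| ≤ C) (hε : |ε| * C ≤ 1 / 2) (x : Ω) :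
    (tiltDensity b ε x : ℝ) = 1 + ε * b x := by
  have := (abs_le.1 (abs_mul_le_half hbC hε x)).1
  exact Real.coe_toNNReal _ (by linarith)

lemma two_inv_le_tiltDensity (hbC : ∀ x, |b x| ≤ C) (hε : |ε| * C ≤ 1 / 2) (x : Ω) :
    2⁻¹ ≤ (tiltDensity b ε x : ℝ≥0∞) := by
  have h1 := (abs_le.1 (abs_mul_le_half hbC hε x)).1
  have h2 : (2⁻¹ : ℝ≥0) ≤ tiltDensity b ε x := by
    rw [← NNReal.coe_le_coe, coe_tiltDensity hbC hε]
    push_cast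
    linarith
  simpa using ENNReal.coe_le_coe.2 h2

lemma tiltDensity_le_two (hbC : ∀ x, |b x| ≤ C) (hε : |ε| * C ≤ 1 / 2) (x : Ω) :
    (tiltDensity b ε x : ℝ≥0∞) ≤ 2 := by
  have h1 := (abs_le.1 (abs_mul_le_half hbC hε x)).2
  have h2 : tiltDensity b ε x ≤ 2 := by
    rw [← NNReal.coe_le_coe, coe_tiltDensity hbC hε]
    push_cast
    linarith
  simpa using ENNReal.coe_le_coe.2 h2

variable [MeasurableSpace Ω] [MeasurableSpace X]

lemma measurable_tiltDensity (hb : Measurable b) : Measurable (tiltDensity b ε) := by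
  unfold tiltDensity; fun_prop

lemma withDensity_tiltDensity_apply {μ : Measure Ω} [IsFiniteMeasure μ] (hb : Measurable b)
    (hbC : ∀ x, |b x| ≤ C) (hε : |ε| * C ≤ 1 / 2) {A : Set Ω} (hA : MeasurableSet A) :
    μ.withDensity (fun x => (tiltDensity b ε x : ℝ≥0∞)) A =
      ENNReal.ofReal (μ.real A + ε * ∫ x in A, b x ∂μ) := by
  have hbi : Integrable b (μ.restrict A) := integrable_of_abs_le hb hbC
  rw [withDensity_apply _ hA]
  have h1 : ∀ x, (tiltDensity b ε x : ℝ≥0∞) = ENNReal.ofReal (1 + ε * b x) := fun x => rfl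
  simp only [h1]
  have hi : Integrable (fun x => 1 + ε * b x) (μ.restrict A) :=
    (integrable_const _).add (hbi.const_mul ε)
  rw [← ofReal_integral_eq_lintegral_ofReal hi (ae_of_all _ fun x => ?_),
      integral_add (integrable_const _) (hbi.const_mul ε),
    integral_const_mul]
  · simp
  · have := (abs_le.1 (abs_mul_le_half hbC hε x)).1
    simp only [Pi.zero_apply]
    linarith

lemma isProbabilityMeasure_tilt {μ : Measure Ω} [IsProbabilityMeasure μ] (hb : Measurable b)
    (hbC : ∀ x, |b x| ≤ C) (hb0 : ∫ x, b x ∂μ = 0) (hε : |ε| * C ≤ 1 / 2) :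
    IsProbabilityMeasure (μ.withDensity fun x => (tiltDensity b ε x : ℝ≥0∞)) := by
  constructor
  rw [withDensity_tiltDensity_apply hb hbC hε MeasurableSet.univ]
  simp [hb0]

/-- Square-root Taylor bound behind the differentiability in quadratic mean of linear tilts. -/
lemma abs_sqrt_one_add_sub_le {u : ℝ} (hu : |u| ≤ 1 / 2) : |√(1 + u) - 1 - u / 2| ≤ u ^ 2 / 2 := by
  have h0 : 0 ≤ 1 + u := by linarith [(abs_le.1 hu).1]
  have hs := Real.sq_sqrt h0
  have hs0 := Real.sqrt_nonneg (1 + u)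
  have h1 : √(1 + u) - 1 - u / 2 = -((√(1 + u) - 1) ^ 2 / 2) := by nlinarith
  have h2 : u ^ 2 = (√(1 + u) - 1) ^ 2 * (√(1 + u) + 1) ^ 2 := by
    rw [← mul_pow]; congr 1; nlinarith
  rw [h1, abs_neg, abs_of_nonneg (by positivity), h2]
  have h3 : 1 ≤ (√(1 + u) + 1) ^ 2 := by nlinarith
  have := mul_le_mul_of_nonneg_left h3 (sq_nonneg (√(1 + u) - 1))
  linarith

/-- The linear tilts `(1 + ε b) P` form a regular submodel with score `b' = E[b | obs]`, provided
that the tilts stay in the model. -/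
lemma exists_isRegularSubmodel_tilt {ℳ : κ → Set (ProbabilityMeasure Ω)} {obs : Ω → X}
    (hobs : Measurable obs) {P : ProbabilityMeasure Ω} (hb : Measurable b)
    (hbC : ∀ x, |b x| ≤ C) (hb0 : ∫ x, b x ∂(P : Measure Ω) = 0) {b' : X → ℝ}
    (hb' : Measurable b') (hb'C : ∀ x, |b' x| ≤ C)
    (hproj : ∀ A, MeasurableSet A → ∫ x in obs ⁻¹' A, b x ∂(P : Measure Ω) =
      ∫ x in obs ⁻¹' A, b' (obs x) ∂(P : Measure Ω))
    (hmem : ∃ k, ∀ (ε : ℝ) (Q : ProbabilityMeasure Ω), |ε| * C ≤ 1 / 2 →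
      (Q : Measure Ω) = (P : Measure Ω).withDensity (fun x => (tiltDensity b ε x : ℝ≥0∞)) →
      Q ∈ ℳ k) (hL : MemLp b' 2 ((P : Measure Ω).map obs)) :
    ∃ γ, IsRegularSubmodel ℳ obs P γ (hL.toLp b') := by
  classical
  set γ : ℝ → ProbabilityMeasure Ω := fun ε => if hε : |ε| * C ≤ 1 / 2 then
    ⟨(P : Measure Ω).withDensity fun x => (tiltDensity b ε x : ℝ≥0∞),
      isProbabilityMeasure_tilt hb hbC hb0 hε⟩ else P with hγ
  have hγε : ∀ ε, |ε| * C ≤ 1 / 2 → (γ ε : Measure Ω) =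
      (P : Measure Ω).withDensity fun x => (tiltDensity b ε x : ℝ≥0∞) := fun ε hε =>
    congrArg (fun Q : ProbabilityMeasure Ω => (Q : Measure Ω)) (dif_pos hε)
  have hsmall : ∀ᶠ ε in 𝓝 (0 : ℝ), |ε| * C ≤ 1 / 2 := by
    have h : Tendsto (fun ε : ℝ => |ε| * C) (𝓝 0) (𝓝 (|0| * C)) :=
      (Continuous.tendsto (by fun_prop) 0)
    rw [abs_zero, zero_mul] at h
    filter_upwards [h.eventually (gt_mem_nhds (show (0 : ℝ) < 1 / 2 by norm_num))] with ε hε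
    exact hε.le
  obtain ⟨k, hk⟩ := hmem
  set Q₀ := (P : Measure Ω).map obs with hQ₀
  have hQ₀p : IsProbabilityMeasure Q₀ := Measure.isProbabilityMeasure_map hobs.aemeasurable
  refine ⟨γ, ?_, ⟨k, ?_⟩, Q₀, inferInstance, tiltDensity b', fun ε => measurable_tiltDensity hb',
    ?_, ?_⟩
  · refine Subtype.ext ((hγε 0 (by simp)).trans ?_)
    simp [tiltDensity]
  · filter_upwards [hsmall] with ε hε using hk ε _ hε (hγε ε hε)
  · filter_upwards [hsmall] with ε hε
    refine Measure.ext fun A hA => ?_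
    rw [Measure.map_apply hobs hA, hγε ε hε, withDensity_tiltDensity_apply hb hbC hε (hobs hA),
      withDensity_tiltDensity_apply hb' hb'C hε hA, hproj A hA,
      setIntegral_map hA hb'.aestronglyMeasurable hobs.aemeasurable, map_measureReal_apply hobs hA]
  · have hlim : Tendsto (fun ε : ℝ => ENNReal.ofReal ((|ε| * C ^ 2 / 2) ^ 2)) (𝓝[≠] 0) (𝓝 0) := by
      have h : Tendsto (fun ε : ℝ => ENNReal.ofReal ((|ε| * C ^ 2 / 2) ^ 2)) (𝓝 0)
          (𝓝 (ENNReal.ofReal ((|0| * C ^ 2 / 2) ^ 2))) :=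
        (ENNReal.continuous_ofReal.comp (by fun_prop)).tendsto 0
      simp only [abs_zero, zero_mul, zero_div, ne_eq, OfNat.ofNat_ne_zero, not_false_eq_true,
        zero_pow, ENNReal.ofReal_zero] at h
      exact h.mono_left nhdsWithin_le_nhds
    refine tendsto_of_tendsto_of_tendsto_of_le_of_le' tendsto_const_nhds hlim
      (Eventually.of_forall fun ε => zero_le) ?_
    filter_upwards [hsmall.filter_mono nhdsWithin_le_nhds, eventually_ne_zero_nhdsNE] with ε hε hε0
    calc _ ≤ ∫⁻ _, ENNReal.ofReal ((|ε| * C ^ 2 / 2) ^ 2) ∂Q₀ := ?_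
      _ = _ := by simp
    refine lintegral_mono_ae ?_
    filter_upwards [hL.coeFn_toLp] with x hx
    refine ENNReal.ofReal_le_ofReal ?_
    have h0 : (tiltDensity b' 0 x : ℝ) = 1 := by simp [tiltDensity]
    rw [hx, h0, coe_tiltDensity hb'C hε, Real.sqrt_one]
    have h1 := abs_sqrt_one_add_sub_le (abs_mul_le_half hb'C hε x)
    have h2 : (√(1 + ε * b' x) - 1) / ε - b' x * 1 / 2 =
        (√(1 + ε * b' x) - 1 - ε * b' x / 2) / ε := by field_simp
    have hε' : 0 < |ε| := abs_pos.2 hε0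
    rw [h2, ← sq_abs, abs_div]
    refine pow_le_pow_left₀ (by positivity) ?_ 2
    rw [div_le_iff₀ hε']
    refine h1.trans ?_
    have h3 : b' x ^ 2 ≤ C ^ 2 := by
      rw [← sq_abs]; exact pow_le_pow_left₀ (abs_nonneg _) (hb'C x) 2
    have h4 := mul_le_mul_of_nonneg_left h3 (sq_nonneg ε)
    have h5 : |ε| * C ^ 2 / 2 * |ε| = ε ^ 2 * C ^ 2 / 2 := by rw [← sq_abs ε]; ring
    rw [h5, mul_pow]
    linarith

end Tilt

/-! ### Square-integrable approximation -/

section Approximation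

variable {X : Type*} [MeasurableSpace X] {Q : Measure X}

lemma tendsto_integral_sub_clamp_sq {g : X → ℝ} (hg : Measurable g)
    (hi : Integrable (fun x => g x ^ 2) Q) :
    Tendsto (fun n : ℕ => ∫ x, (clamp n (g x) - g x) ^ 2 ∂Q) atTop (𝓝 0) := by
  have : Tendsto (fun n : ℕ => ∫ x, (clamp n (g x) - g x) ^ 2 ∂Q) atTop (𝓝 (∫ _, 0 ∂Q)) := by
    refine tendsto_integral_of_dominated_convergence (fun x => 4 * g x ^ 2) (fun n => ?_)
      (hi.const_mul 4) (fun n => ae_of_all _ fun x => ?_) (ae_of_all _ fun x => ?_)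
    · exact ((((measurable_clamp n).comp hg).sub hg).pow_const 2).aestronglyMeasurable
    · rw [Real.norm_eq_abs, abs_of_nonneg (sq_nonneg _), ← sq_abs]
      have h1 : |clamp n (g x) - g x| ≤ 2 * |g x| :=
        (abs_sub _ _).trans (by linarith [abs_clamp_le_abs n (g x)])
      calc _ ≤ (2 * |g x|) ^ 2 := pow_le_pow_left₀ (abs_nonneg _) h1 2
        _ = _ := by rw [mul_pow, sq_abs]; norm_num
    · refine tendsto_const_nhds.congr' ?_
      filter_upwards [eventually_clamp_eq (g x)] with n hn
      simp [hn]
  simpa using this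

/-- A function belongs to a closed subspace of `L²` if it is a mean-square limit of functions that
do. -/
lemma toLp_mem_of_tendsto {T : Submodule ℝ (Lp ℝ 2 Q)} (hT : IsClosed (T : Set (Lp ℝ 2 Q)))
    {g : X → ℝ} (hg : MemLp g 2 Q) {G : ℕ → X → ℝ} (hG : ∀ n, MemLp (G n) 2 Q)
    (hmem : ∀ n, (hG n).toLp (G n) ∈ T)
    (hlim : Tendsto (fun n => ∫ x, (G n x - g x) ^ 2 ∂Q) atTop (𝓝 0)) : hg.toLp g ∈ T := by
  refine hT.mem_of_tendsto (f := fun n => (hG n).toLp (G n)) (b := atTop) ?_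
    (Eventually.of_forall hmem)
  rw [tendsto_iff_norm_sub_tendsto_zero]
  have h1 : ∀ n, ‖(hG n).toLp (G n) - hg.toLp g‖ = √(∫ x, (G n x - g x) ^ 2 ∂Q) := fun n => by
    rw [← MemLp.toLp_sub, ← Real.sqrt_sq (norm_nonneg _), ← real_inner_self_eq_norm_sq,
        L2.inner_def]
    congr 1
    refine integral_congr_ae ?_
    filter_upwards [((hG n).sub hg).coeFn_toLp] with x hx
    rw [hx, real_inner_self_eq_norm_sq, Real.norm_eq_abs, sq_abs, Pi.sub_apply]
  simp only [h1]
  have := (Real.continuous_sqrt.tendsto 0).comp hlim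
  rwa [Real.sqrt_zero] at this

end Approximation

/-! ### Tilts that stay in the models -/

section ModelTilts

variable {𝒴 𝒵 : Type*} [MeasurableSpace 𝒴] [MeasurableSpace 𝒵] [StandardBorelSpace 𝒴]
  [Nonempty 𝒴] [StandardBorelSpace 𝒵] {t : Fin 2} {𝓛 : Set ℝ} {p : ℕ} {c : ℝ≥0 × ℝ≥0}
  {P Q : ProbabilityMeasure (FullData 𝒴 𝒵)} {f : 𝒴 → EuclideanSpace ℝ (Fin p)}

/-- Weights in `(W, Z, T)` preserve the surrogate property and the independence of the sampling;
`L = g(Y)` survives every absolutely continuous change of law. -/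
lemma IsPerfectAnnotation.reweight (h : IsPerfectAnnotation t 𝓛 p c P)
    (hf : IsSurrogateRepresentation P f)
    {w : Fin 2 × EuclideanSpace ℝ (Fin p) × 𝒵 → ℝ≥0∞} (hw : Measurable w)
    (hQ : (Q : Measure (FullData 𝒴 𝒵)) = (P : Measure (FullData 𝒴 𝒵)).withDensity fun x =>
      w (predictor x, reprControls f x))
    (hlow : ∀ y, 2⁻¹ ≤ w y) (hup : ∀ y, w y ≤ 2) :
    IsPerfectAnnotation t 𝓛 p (2 * c.1, c.2 / 4) Q := by
  have hac : (Q : Measure (FullData 𝒴 𝒵)) ≪ (P : Measure (FullData 𝒴 𝒵)) :=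
    hQ ▸ withDensity_absolutelyContinuous _ _
  have hfm := hf.choose
  refine { h.toCommonConditions.reweight hf (w := fun y => w (y.2.2, y.1)) (by fun_prop) hQ
    (fun y => hlow _) (fun y => hup _) with coding := ?_, sampling := ?_ }
  · obtain ⟨g, hg, hg𝓛, hgL⟩ := h.coding
    exact ⟨g, hg, hg𝓛, hac.ae_le hgL⟩
  · exact indepFun_withDensity (by fun_prop) measurable_sampled h.sampling
      (w := fun d => w (d.1, f d.2.1, d.2.2)) (by fun_prop) hQ

/-- Blindness is the only condition of the blind-annotation model that reweighting by a function of
`(W, Z, L, T)` may destroy. -/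
lemma IsBlindAnnotation.reweight (h : IsBlindAnnotation t 𝓛 p c P)
    (hf : IsSurrogateRepresentation P f)
    {w : (EuclideanSpace ℝ (Fin p) × 𝒵) × ℝ × Fin 2 → ℝ≥0∞} (hw : Measurable w)
    (hQ : (Q : Measure (FullData 𝒴 𝒵)) = (P : Measure (FullData 𝒴 𝒵)).withDensity fun x =>
      w (reprControls f x, (concept x, predictor x)))
    (hlow : ∀ y, 2⁻¹ ≤ w y) (hup : ∀ y, w y ≤ 2)
    (hblind : CondIndepFun
      (MeasurableSpace.comap (fun x : FullData 𝒴 𝒵 => (text x, controls x)) inferInstance)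
      (measurable_text.prodMk measurable_controls).comap_le
      predictor concept (Q : Measure (FullData 𝒴 𝒵))) :
    IsBlindAnnotation t 𝓛 p (2 * c.1, c.2 / 4) Q := by
  have hac : (Q : Measure (FullData 𝒴 𝒵)) ≪ (P : Measure (FullData 𝒴 𝒵)) :=
    hQ ▸ withDensity_absolutelyContinuous _ _
  have hfm := hf.choose
  refine { h.toCommonConditions.reweight hf hw hQ hlow hup with
    support := hac.ae_le h.support, blind := hblind, sampling := ?_ }
  exact indepFun_withDensity (by fun_prop) measurable_sampled h.sampling
    (w := fun d => w ((f d.2.1, d.2.2.1), (d.2.2.2, d.1))) (by fun_prop) hQ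

/-- Weights in `(T, W, Z)` do not change the conditional law of `L` given `(T, Y, Z)`. -/
lemma IsBlindAnnotation.reweight_predictor (h : IsBlindAnnotation t 𝓛 p c P)
    (hf : IsSurrogateRepresentation P f)
    {w : Fin 2 × EuclideanSpace ℝ (Fin p) × 𝒵 → ℝ≥0∞} (hw : Measurable w)
    (hQ : (Q : Measure (FullData 𝒴 𝒵)) = (P : Measure (FullData 𝒴 𝒵)).withDensity fun x =>
      w (predictor x, reprControls f x))
    (hlow : ∀ y, 2⁻¹ ≤ w y) (hup : ∀ y, w y ≤ 2) :
    IsBlindAnnotation t 𝓛 p (2 * c.1, c.2 / 4) Q := by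
  have hfm := hf.choose
  refine h.reweight hf (w := fun y => w (y.2.2, y.1)) (by fun_prop) hQ (fun y => hlow _)
    (fun y => hup _) ?_
  exact condIndepFun_withDensity (by fun_prop) measurable_predictor measurable_concept h.blind
    (w := fun y => w (y.2, f y.1.1, y.1.2)) (by fun_prop) hQ

/-- Weights in `(L, W, Z)` do not change the conditional law of `T` given `(L, Y, Z)`. -/
lemma IsBlindAnnotation.reweight_concept (h : IsBlindAnnotation t 𝓛 p c P)
    (hf : IsSurrogateRepresentation P f)
    {w : ℝ × EuclideanSpace ℝ (Fin p) × 𝒵 → ℝ≥0∞} (hw : Measurable w)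
    (hQ : (Q : Measure (FullData 𝒴 𝒵)) = (P : Measure (FullData 𝒴 𝒵)).withDensity fun x =>
      w (concept x, reprControls f x))
    (hlow : ∀ y, 2⁻¹ ≤ w y) (hup : ∀ y, w y ≤ 2) :
    IsBlindAnnotation t 𝓛 p (2 * c.1, c.2 / 4) Q := by
  have hfm := hf.choose
  refine h.reweight hf (w := fun y => w (y.2.1, y.1)) (by fun_prop) hQ (fun y => hlow _)
    (fun y => hup _) ?_
  exact (condIndepFun_withDensity (by fun_prop) measurable_concept measurable_predictor
    h.blind.symm (w := fun y => w (y.2, f y.1.1, y.1.2)) (by fun_prop) hQ).symm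

end ModelTilts

/-! ### Scores of the law of the predictor, the representation and the controls -/

section PredictorScores

variable {𝒴 𝒵 : Type*} [MeasurableSpace 𝒴] [MeasurableSpace 𝒵] {p : ℕ}
  {P : ProbabilityMeasure (FullData 𝒴 𝒵)} {f : 𝒴 → EuclideanSpace ℝ (Fin p)}

/-- `(T, f(Y), Z)` as a function of the observed data. -/
def obsReduced (f : 𝒴 → EuclideanSpace ℝ (Fin p)) (o : ObsData 𝒴 𝒵) :
    Fin 2 × EuclideanSpace ℝ (Fin p) × 𝒵 :=
  ((obsDesign o).1, f (obsTextControls o).1, obsControls o)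

lemma measurable_obsReduced (hf : Measurable f) :
    Measurable (obsReduced f : ObsData 𝒴 𝒵 → _) := by
  unfold obsReduced; fun_prop

/-- Recentring a truncation of a mean-zero function does not increase its mean-square error. -/
lemma integral_centered_clamp_sq_le {X : Type*} [MeasurableSpace X] {Q : Measure X}
    [IsProbabilityMeasure Q] {g : X → ℝ} (hg : Measurable g) (hi : MemLp g 2 Q)
    (h0 : ∫ x, g x ∂Q = 0) (n : ℕ) :
    ∫ x, (clamp n (g x) - ∫ y, clamp n (g y) ∂Q - g x) ^ 2 ∂Q ≤
      ∫ x, (clamp n (g x) - g x) ^ 2 ∂Q := by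
  have hgi : Integrable g Q := hi.integrable (by norm_num)
  have hci : Integrable (fun x => clamp n (g x)) Q :=
    integrable_of_abs_le ((measurable_clamp n).comp hg) fun x => abs_clamp_le n _
  have hm : Measurable fun x => clamp n (g x) - g x := ((measurable_clamp n).comp hg).sub hg
  have h1 : ∫ x, (clamp n (g x) - g x) ∂Q = ∫ x, clamp n (g x) ∂Q := by
    rw [integral_sub hci hgi, h0, sub_zero]
  have h2 := variance_le_expectation_sq (μ := Q) (X := fun x => clamp n (g x) - g x)
    hm.aestronglyMeasurable
  rw [variance_eq_integral hm.aemeasurable, h1] at h2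
  refine le_trans (le_of_eq (integral_congr_ae (ae_of_all _ fun x => ?_))) h2
  simp only
  ring

/-- If bounded tilts by functions of `(T, W, Z)` stay in the model, then all mean-zero
square-integrable functions of `(T, W, Z)` belong to the tangent space. -/
lemma toLp_obsReduced_mem_tangentSpace {κ : Type*}
    {ℳ : κ → Set (ProbabilityMeasure (FullData 𝒴 𝒵))} (hf : Measurable f)
    (hℳ : ∀ (B : Fin 2 × EuclideanSpace ℝ (Fin p) × 𝒵 → ℝ) (C : ℝ), Measurable B →
      (∀ y, |B y| ≤ C) → ∃ k, ∀ (ε : ℝ) (Q : ProbabilityMeasure (FullData 𝒴 𝒵)),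
        |ε| * C ≤ 1 / 2 → (Q : Measure (FullData 𝒴 𝒵)) =
          (P : Measure (FullData 𝒴 𝒵)).withDensity (fun x =>
            (tiltDensity (fun x => B (predictor x, reprControls f x)) ε x : ℝ≥0∞)) → Q ∈ ℳ k)
    {B : Fin 2 × EuclideanSpace ℝ (Fin p) × 𝒵 → ℝ} (hB : Measurable B)
    (hL : MemLp (fun o => B (obsReduced f o)) 2 ((P : Measure (FullData 𝒴 𝒵)).map observe))
    (h0 : ∫ o, B (obsReduced f o) ∂((P : Measure (FullData 𝒴 𝒵)).map observe) = 0) :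
    hL.toLp _ ∈ tangentSpace ℳ observe P := by
  have hp : IsProbabilityMeasure ((P : Measure (FullData 𝒴 𝒵)).map observe) :=
    Measure.isProbabilityMeasure_map measurable_observe.aemeasurable
  have hr := measurable_obsReduced (𝒵 := 𝒵) hf
  have hr' := measurable_reprControls (𝒵 := 𝒵) hf
  set m : ℕ → ℝ := fun n =>
    ∫ o, clamp n (B (obsReduced f o)) ∂((P : Measure (FullData 𝒴 𝒵)).map observe) with hm
  set Bn : ℕ → Fin 2 × EuclideanSpace ℝ (Fin p) × 𝒵 → ℝ := fun n y => clamp n (B y) - m n with hBn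
  have mBn : ∀ n, Measurable (Bn n) := fun n => ((measurable_clamp n).comp hB).sub measurable_const
  have bBn : ∀ n y, |Bn n y| ≤ n + |m n| := fun n y =>
    (abs_sub _ _).trans (by linarith [abs_clamp_le n (B y)])
  have hLn : ∀ n, MemLp (fun o => Bn n (obsReduced f o)) 2
      ((P : Measure (FullData 𝒴 𝒵)).map observe) := fun n =>
    MemLp.of_bound ((mBn n).comp hr).aestronglyMeasurable (n + |m n|)
      (ae_of_all _ fun o => by rw [Real.norm_eq_abs]; exact bBn n _)
  refine toLp_mem_of_tendsto (Submodule.isClosed_topologicalClosure _) hL hLn (fun n => ?_) ?_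
  · refine Submodule.le_topologicalClosure _ (Submodule.subset_span ?_)
    have mb : Measurable fun x : FullData 𝒴 𝒵 => Bn n (predictor x, reprControls f x) :=
      (mBn n).comp (by fun_prop)
    refine exists_isRegularSubmodel_tilt (b := fun x => Bn n (predictor x, reprControls f x))
      (C := n + |m n|) measurable_observe mb (fun x => bBn n _) ?_ ((mBn n).comp hr)
      (fun o => bBn n _) (fun A hA => rfl) (hℳ _ _ (mBn n) (bBn n)) (hLn n)
    have h1 : ∫ o, Bn n (obsReduced f o) ∂((P : Measure (FullData 𝒴 𝒵)).map observe) = 0 := by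
      have hci : Integrable (fun o => clamp n (B (obsReduced f o)))
          ((P : Measure (FullData 𝒴 𝒵)).map observe) :=
        integrable_of_abs_le ((measurable_clamp n).comp (hB.comp hr)) fun x => abs_clamp_le n _
      simp only [hBn]
      rw [integral_sub hci (integrable_const _)]
      simp [hm]
    exact (integral_map measurable_observe.aemeasurable
      ((mBn n).comp hr).aestronglyMeasurable).symm.trans h1
  · exact squeeze_zero (fun n => integral_nonneg fun o => sq_nonneg _)
      (fun n => integral_centered_clamp_sq_le (hB.comp hr) hL h0 n)
      (tendsto_integral_sub_clamp_sq (hB.comp hr)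
        ((memLp_two_iff_integrable_sq (hB.comp hr).aestronglyMeasurable).1 hL))

end PredictorScores

/-! ### Scores of the law of the concept under blind annotation -/

section ConceptScores

variable {𝒴 𝒵 : Type*} [MeasurableSpace 𝒴] [MeasurableSpace 𝒵] {p : ℕ}
  {P : ProbabilityMeasure (FullData 𝒴 𝒵)} {f : 𝒴 → EuclideanSpace ℝ (Fin p)}

/-- `R(L, W, Z) - E[R(L, W, Z) | W, Z]`. -/
def conceptResidual (f : 𝒴 → EuclideanSpace ℝ (Fin p)) (P : ProbabilityMeasure (FullData 𝒴 𝒵))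
    (R : ℝ × EuclideanSpace ℝ (Fin p) × 𝒵 → ℝ) (y : ℝ × EuclideanSpace ℝ (Fin p) × 𝒵) : ℝ :=
  R y - ∫ l, R (l, y.2) ∂(condDistrib concept (reprControls f) (P : Measure (FullData 𝒴 𝒵)) y.2)

lemma measurable_conceptResidual {R : ℝ × EuclideanSpace ℝ (Fin p) × 𝒵 → ℝ} (hR : Measurable R) :
    Measurable (conceptResidual f P R) := by
  have h := (StronglyMeasurable.integral_condDistrib (Y := (concept : FullData 𝒴 𝒵 → ℝ))
    (X := reprControls f) (μ := (P : Measure (FullData 𝒴 𝒵)))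
    (f := fun x : (EuclideanSpace ℝ (Fin p) × 𝒵) × ℝ => R (x.2, x.1))
    (hR.comp measurable_swap).stronglyMeasurable).measurable
  exact hR.sub (h.comp measurable_snd)

lemma abs_conceptResidual_le {R : ℝ × EuclideanSpace ℝ (Fin p) × 𝒵 → ℝ} {C : ℝ}
    (hRC : ∀ y, |R y| ≤ C) (y : ℝ × EuclideanSpace ℝ (Fin p) × 𝒵) :
    |conceptResidual f P R y| ≤ C + C := by
  refine (abs_sub _ _).trans (add_le_add (hRC y) ?_)
  have := norm_integral_le_of_norm_le_const (μ := condDistrib concept (reprControls f)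
    (P : Measure (FullData 𝒴 𝒵)) y.2) (f := fun l => R (l, y.2)) (C := C)
    (ae_of_all _ fun l => hRC _)
  simpa using this

lemma integral_conceptResidual {R : ℝ × EuclideanSpace ℝ (Fin p) × 𝒵 → ℝ} (hR : Measurable R)
    {C : ℝ} (hRC : ∀ y, |R y| ≤ C) (w : EuclideanSpace ℝ (Fin p) × 𝒵) :
    ∫ l, conceptResidual f P R (l, w)
      ∂(condDistrib concept (reprControls f) (P : Measure (FullData 𝒴 𝒵)) w) = 0 := by
  have hi : Integrable (fun l => R (l, w))
      (condDistrib concept (reprControls f) (P : Measure (FullData 𝒴 𝒵)) w) :=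
    integrable_of_abs_le (hR.comp (by fun_prop)) fun l => hRC _
  refine (integral_sub hi (integrable_const (∫ l, R (l, w)
    ∂(condDistrib concept (reprControls f) (P : Measure (FullData 𝒴 𝒵)) w)))).trans ?_
  simp

/-- The mean square of the residual is at most four times the mean square, in the form needed to
pass to limits. -/
lemma integral_conceptResidual_sub_sq_le (hf : Measurable f)
    {R R' : ℝ × EuclideanSpace ℝ (Fin p) × 𝒵 → ℝ} (hR : Measurable R) (hR' : Measurable R')
    (hi : Integrable (fun x => R (concept x, reprControls f x) ^ 2) (P : Measure (FullData 𝒴 𝒵)))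
    (hi' : Integrable (fun x => R' (concept x, reprControls f x) ^ 2)
      (P : Measure (FullData 𝒴 𝒵))) :
    Integrable (fun x => (conceptResidual f P R (concept x, reprControls f x) -
        conceptResidual f P R' (concept x, reprControls f x)) ^ 2) (P : Measure (FullData 𝒴 𝒵)) ∧
      ∫ x, (conceptResidual f P R (concept x, reprControls f x) -
        conceptResidual f P R' (concept x, reprControls f x)) ^ 2 ∂(P : Measure (FullData 𝒴 𝒵)) ≤
      4 * ∫ x, (R (concept x, reprControls f x) - R' (concept x, reprControls f x)) ^ 2
        ∂(P : Measure (FullData 𝒴 𝒵)) := by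
  set μ := (P : Measure (FullData 𝒴 𝒵))
  have hX := measurable_reprControls (𝒵 := 𝒵) hf
  have hW : Measurable fun x : FullData 𝒴 𝒵 => (concept x, reprControls f x) := by fun_prop
  have hκ : ∀ {R : ℝ × EuclideanSpace ℝ (Fin p) × 𝒵 → ℝ}, Measurable R →
      Integrable (fun x => R (concept x, reprControls f x) ^ 2) μ →
      ∀ᵐ x ∂μ, Integrable (fun l => R (l, reprControls f x))
        (condDistrib concept (reprControls f) μ (reprControls f x)) := fun {R} hR hi => by
    have h1 : Integrable (fun x => R (concept x, reprControls f x)) μ :=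
      integrable_of_sq (hR.comp hW) hi
    have h2 : Integrable (fun y : (EuclideanSpace ℝ (Fin p) × 𝒵) × ℝ => R (y.2, y.1))
        (μ.map fun x => (reprControls f x, concept x)) :=
      (integrable_map_measure (hR.comp measurable_swap).aestronglyMeasurable
        (hX.prodMk measurable_concept).aemeasurable).2 h1
    exact h2.condDistrib_ae hX.aemeasurable measurable_concept.aemeasurable
  have hD : Measurable fun y : (EuclideanSpace ℝ (Fin p) × 𝒵) × ℝ =>
      R (y.2, y.1) - R' (y.2, y.1) := (hR.comp measurable_swap).sub (hR'.comp measurable_swap)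
  have hDi : Integrable (fun x => (R (concept x, reprControls f x) -
      R' (concept x, reprControls f x)) ^ 2) μ :=
    ((memLp_two_iff_integrable_sq ((hR.comp hW).sub (hR'.comp hW)).aestronglyMeasurable).1
      (((memLp_two_iff_integrable_sq (hR.comp hW).aestronglyMeasurable).2 hi).sub
        ((memLp_two_iff_integrable_sq (hR'.comp hW).aestronglyMeasurable).2 hi')))
  obtain ⟨h1, h2⟩ := condMean_sq hX measurable_concept hD hDi
  have hle : ∀ᵐ x ∂μ, (conceptResidual f P R (concept x, reprControls f x) -
      conceptResidual f P R' (concept x, reprControls f x)) ^ 2 ≤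
      2 * (R (concept x, reprControls f x) - R' (concept x, reprControls f x)) ^ 2 +
      2 * (∫ l, (R (l, reprControls f x) - R' (l, reprControls f x))
        ∂(condDistrib concept (reprControls f) μ (reprControls f x))) ^ 2 := by
    filter_upwards [hκ hR hi, hκ hR' hi'] with x hx hx'
    rw [integral_sub hx hx']
    simp only [conceptResidual]
    set a := R (concept x, reprControls f x)
    set a' := R' (concept x, reprControls f x)
    set I := ∫ l, R (l, reprControls f x)
        ∂(condDistrib concept (reprControls f) μ (reprControls f x))
    set I' := ∫ l, R' (l, reprControls f x)
      ∂(condDistrib concept (reprControls f) μ (reprControls f x))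
    nlinarith [sq_nonneg ((a - a') + (I - I'))]
  have hbi := (hDi.const_mul 2).add (h1.const_mul 2)
  have hm : Measurable fun x => (conceptResidual f P R (concept x, reprControls f x) -
      conceptResidual f P R' (concept x, reprControls f x)) ^ 2 :=
    (((measurable_conceptResidual hR).comp hW).sub
      ((measurable_conceptResidual hR').comp hW)).pow_const 2
  have hint : Integrable (fun x => (conceptResidual f P R (concept x, reprControls f x) -
      conceptResidual f P R' (concept x, reprControls f x)) ^ 2) μ := by
    refine hbi.mono' hm.aestronglyMeasurable ?_
    filter_upwards [hle] with x hx
    rw [Real.norm_eq_abs, abs_of_nonneg (sq_nonneg _)]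
    exact hx
  refine ⟨hint, (integral_mono_ae hint hbi hle).trans ?_⟩
  have h3 := integral_add (hDi.const_mul 2) (h1.const_mul 2)
  simp only [Pi.add_apply, integral_const_mul] at h3 ⊢
  rw [h3]
  linarith

/-- `(L, f(Y), Z)` as a function of the observed data, meaningful on the labelled units. -/
def obsLabelled (f : 𝒴 → EuclideanSpace ℝ (Fin p)) (o : ObsData 𝒴 𝒵) :
    ℝ × EuclideanSpace ℝ (Fin p) × 𝒵 :=
  (obsLabel o, f (obsTextControls o).1, obsControls o)

lemma measurable_obsLabelled (hf : Measurable f) :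
    Measurable (obsLabelled f : ObsData 𝒴 𝒵 → _) := by
  unfold obsLabelled; fun_prop

variable [StandardBorelSpace 𝒴] [Nonempty 𝒴] [StandardBorelSpace 𝒵] {t : Fin 2} {𝓛 : Set ℝ}
  {c : ℝ≥0 × ℝ≥0}

/-- The residual of a bounded function of `(L, W, Z)` has conditional mean zero given
`(T, Y, Z)`. -/
lemma IsBlindAnnotation.integral_conceptResidual_mul (h : IsBlindAnnotation t 𝓛 p c P)
    (hf : IsSurrogateRepresentation P f) {R : ℝ × EuclideanSpace ℝ (Fin p) × 𝒵 → ℝ}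
    (hR : Measurable R) {C : ℝ} (hRC : ∀ y, |R y| ≤ C) {τ : Fin 2 × 𝒴 × 𝒵 → ℝ} (hτ : Measurable τ)
    (hτC : ∀ d, |τ d| ≤ 1) :
    ∫ x, conceptResidual f P R (concept x, reprControls f x) *
      τ (predictor x, text x, controls x) ∂(P : Measure (FullData 𝒴 𝒵)) = 0 := by
  have hfm := hf.choose
  set μ := (P : Measure (FullData 𝒴 𝒵))
  have hD : Measurable fun x : FullData 𝒴 𝒵 => (predictor x, text x, controls x) := by fun_prop
  have hg : Measurable fun d : Fin 2 × 𝒴 × 𝒵 => (f d.2.1, d.2.2) := by fun_prop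
  set κ := condDistrib (concept : FullData 𝒴 𝒵 → ℝ) (reprControls f) μ with hκ
  -- the conditional law of `L` given `(T, Y, Z)`
  have hlaw : condDistrib concept (fun x => (predictor x, text x, controls x)) μ
      =ᵐ[μ.map fun x => (predictor x, text x, controls x)] κ.comap _ hg := by
    refine condDistrib_ae_eq_of_measure_eq_compProd _ measurable_concept.aemeasurable
      (Measure.ext_prod fun {s u} hs hu => ?_)
    have hκu : Measurable fun w => κ w u := Kernel.measurable_coe κ hu
    have hκu' : Measurable fun x : FullData 𝒴 𝒵 => (κ (reprControls f x)).real u :=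
      (hκu.comp (measurable_reprControls hfm)).ennreal_toReal
    have e := h.integral_comp_concept_mul hf (φ := u.indicator 1) (τ := s.indicator 1) (C := 1)
      (measurable_one.indicator hu)
      (integrable_of_abs_le (C := 1) ((measurable_one.indicator hu).comp measurable_concept)
        fun x => by by_cases hx : concept x ∈ u <;> simp [hx])
      (measurable_one.indicator hs) fun d => by by_cases hd : d ∈ s <;> simp [hd]
    simp only [integral_indicator_one hu] at e
    rw [Measure.map_apply (hD.prodMk measurable_concept) (hs.prod hu),
      Measure.compProd_apply_prod hs hu, setLIntegral_map hs ((κ.comap _ hg).measurable_coe hu) hD,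
      ← lintegral_indicator (hD hs)]
    have e1 : ∫ x, u.indicator (1 : ℝ → ℝ) (concept x) *
        s.indicator 1 (predictor x, text x, controls x) ∂μ =
        μ.real ((fun x => ((predictor x, text x, controls x), concept x)) ⁻¹' s ×ˢ u) := by
      rw [← integral_indicator_one (hD.prodMk measurable_concept (hs.prod hu))]
      refine integral_congr_ae (ae_of_all _ fun x => ?_)
      by_cases h1 : (predictor x, text x, controls x) ∈ s <;> by_cases h2 : concept x ∈ u <;>
        simp [h1, h2]
    have e2 : ∫⁻ x, ((fun x => (predictor x, text x, controls x)) ⁻¹' s).indicator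
        (fun x => (κ.comap _ hg) (predictor x, text x, controls x) u) x ∂μ =
        ENNReal.ofReal (∫ x, (κ (reprControls f x)).real u *
          s.indicator 1 (predictor x, text x, controls x) ∂μ) := by
      rw [ofReal_integral_eq_lintegral_ofReal]
      · refine lintegral_congr fun x => ?_
        by_cases h1 : (predictor x, text x, controls x) ∈ s
        · simp [h1, Kernel.comap_apply, reprControls]
        · simp [h1]
      · refine integrable_of_abs_le (C := 1)
          (hκu'.mul ((measurable_one.indicator hs).comp hD)) fun x => ?_
        have h2 : |(κ (reprControls f x)).real u| ≤ 1 := by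
          rw [abs_of_nonneg measureReal_nonneg]; exact measureReal_le_one
        by_cases h1 : (predictor x, text x, controls x) ∈ s
        · simpa [h1] using h2
        · simp [h1]
      · refine ae_of_all _ fun x => mul_nonneg measureReal_nonneg ?_
        exact Set.indicator_nonneg (fun _ _ => zero_le_one) _
    rw [e2, ← e, e1, ofReal_measureReal]
  have hlaw' := ae_of_ae_map hD.aemeasurable hlaw
  have mR := measurable_conceptResidual (f := f) (P := P) hR
  have mF : Measurable fun y : (Fin 2 × 𝒴 × 𝒵) × ℝ =>
      conceptResidual f P R (y.2, f y.1.2.1, y.1.2.2) * τ y.1 := by fun_prop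
  have hRi : Integrable (fun x => conceptResidual f P R (concept x, reprControls f x) *
      τ (predictor x, text x, controls x)) μ :=
    integrable_of_abs_le (C := (C + C) * 1)
      (mF.comp (by fun_prop : Measurable fun x : FullData 𝒴 𝒵 =>
        ((predictor x, text x, controls x), concept x))) fun x => by
      rw [abs_mul]
      exact mul_le_mul (abs_conceptResidual_le hRC _) (hτC _) (abs_nonneg _)
        ((abs_nonneg _).trans (abs_conceptResidual_le (f := f) (P := P) hRC (0, reprControls f x)))
  refine (integral_condDistrib_uncurry hD measurable_concept mF hRi).trans ?_
  refine integral_eq_zero_of_ae ?_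
  filter_upwards [hlaw'] with x hx
  rw [hx, integral_mul_const, Kernel.comap_apply,
    integral_conceptResidual hR hRC (f := f) (P := P) (f (text x), controls x), zero_mul]
  rfl

end ConceptScores

section ConceptTangent

variable {𝒴 𝒵 : Type*} [MeasurableSpace 𝒴] [MeasurableSpace 𝒵] [StandardBorelSpace 𝒴]
  [Nonempty 𝒴] [StandardBorelSpace 𝒵] {t : Fin 2} {𝓛 : Set ℝ} {p : ℕ} {c : ℝ≥0 × ℝ≥0}
  {P : ProbabilityMeasure (FullData 𝒴 𝒵)} {f : 𝒴 → EuclideanSpace ℝ (Fin p)}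

/-- The conditional expectation of the residual given the observed data is the residual on the
labelled units and zero on the unlabelled ones. -/
lemma IsBlindAnnotation.setIntegral_conceptResidual (h : IsBlindAnnotation t 𝓛 p c P)
    (hf : IsSurrogateRepresentation P f) {R : ℝ × EuclideanSpace ℝ (Fin p) × 𝒵 → ℝ}
    (hR : Measurable R) {C : ℝ} (hRC : ∀ y, |R y| ≤ C) {A : Set (ObsData 𝒴 𝒵)}
    (hA : MeasurableSet A) :
    ∫ x in observe ⁻¹' A, conceptResidual f P R (concept x, reprControls f x)
        ∂(P : Measure (FullData 𝒴 𝒵)) =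
      ∫ x in observe ⁻¹' A, obsSampled (observe x) * conceptResidual f P R
        (obsLabelled f (observe x)) ∂(P : Measure (FullData 𝒴 𝒵)) := by
  have hfm := hf.choose
  set μ := (P : Measure (FullData 𝒴 𝒵))
  have mR := measurable_conceptResidual (f := f) (P := P) hR
  have bR := abs_conceptResidual_le (f := f) (P := P) hRC
  have hC : 0 ≤ C + C := (abs_nonneg _).trans (bR (0, 0, (P.nonempty).some.2.2.1))
  -- the observation of an unlabelled unit depends only on `(T, Y, Z)`
  set A' : Set (Fin 2 × 𝒴 × 𝒵) := {d | (d.1, d.2.1, d.2.2, 0, 0) ∈ A} with hA'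
  have mA' : MeasurableSet A' := (by fun_prop : Measurable fun d : Fin 2 × 𝒴 × 𝒵 =>
    ((d.1, d.2.1, d.2.2, 0, 0) : ObsData 𝒴 𝒵)) hA
  have mτ : Measurable (A'.indicator (1 : Fin 2 × 𝒴 × 𝒵 → ℝ)) := measurable_one.indicator mA'
  have bτ : ∀ d, |A'.indicator (1 : Fin 2 × 𝒴 × 𝒵 → ℝ) d| ≤ 1 := fun d => by
    by_cases hd : d ∈ A' <;> simp [hd]
  set φ : Fin 2 × 𝒴 × 𝒵 × ℝ → ℝ := fun y =>
    conceptResidual f P R (y.2.2.2, f y.2.1, y.2.2.1) * A'.indicator 1 (y.1, y.2.1, y.2.2.1) with hφ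
  have mφ : Measurable φ := (mR.comp (by fun_prop)).mul (mτ.comp (by fun_prop))
  have mφ' : Measurable fun x : FullData 𝒴 𝒵 =>
      φ (predictor x, text x, controls x, concept x) := mφ.comp (by fun_prop)
  have bφ : ∀ y, |φ y| ≤ C + C := fun y => by
    rw [hφ, abs_mul]
    exact (mul_le_mul (bR _) (bτ _) (abs_nonneg _) hC).trans (mul_one _).le
  have h0 : ∫ x, φ (predictor x, text x, controls x, concept x) ∂μ = 0 :=
    h.integral_conceptResidual_mul hf hR hRC mτ bτ
  have h1 : ∫ x, (if sampled x = 1 then (1 : ℝ) else 0) *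
      φ (predictor x, text x, controls x, concept x) ∂μ = 0 :=
    (h.integral_sampled_mul mφ).trans (by rw [h0, mul_zero])
  have i0 : Integrable (fun x => φ (predictor x, text x, controls x, concept x)) μ :=
    integrable_of_abs_le mφ' fun x => bφ _
  have mS : Measurable fun x : FullData 𝒴 𝒵 => if sampled x = 1 then (1 : ℝ) else 0 :=
    measurable_obsSampled.comp measurable_observe
  have i1 : Integrable (fun x => (if sampled x = 1 then (1 : ℝ) else 0) *
      φ (predictor x, text x, controls x, concept x)) μ :=
    integrable_of_abs_le (C := C + C) (mS.mul mφ') fun x => by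
      rw [abs_mul]
      refine (mul_le_mul (c := |φ _|) (b := 1) ?_ (bφ _) (abs_nonneg _) zero_le_one).trans
        (one_mul _).le
      split_ifs <;> simp
  have mb' : Measurable fun x : FullData 𝒴 𝒵 => obsSampled (observe x) *
      conceptResidual f P R (obsLabelled f (observe x)) :=
    mS.mul (mR.comp ((measurable_obsLabelled hfm).comp measurable_observe))
  have i2 : Integrable ((observe ⁻¹' A).indicator fun x => obsSampled (observe x) *
      conceptResidual f P R (obsLabelled f (observe x))) μ := by
    refine Integrable.indicator ?_ (measurable_observe hA)
    refine integrable_of_abs_le (C := C + C) mb' fun x => ?_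
    rw [abs_mul, obsSampled_observe]
    refine (mul_le_mul (b := 1) ?_ (bR _) (abs_nonneg _) zero_le_one).trans (one_mul _).le
    split_ifs <;> simp
  have hae : (observe ⁻¹' A).indicator
      (fun x => conceptResidual f P R (concept x, reprControls f x)) =ᵐ[μ] fun x =>
      (observe ⁻¹' A).indicator (fun x => obsSampled (observe x) *
        conceptResidual f P R (obsLabelled f (observe x))) x +
      (φ (predictor x, text x, controls x, concept x) -
        (if sampled x = 1 then (1 : ℝ) else 0) *
          φ (predictor x, text x, controls x, concept x)) := by
    filter_upwards [h.perfect] with x hx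
    by_cases hs : sampled x = 1
    · have e1 : obsLabelled f (observe x) = (concept x, reprControls f x) := by
        rw [obsLabelled, obsLabel_observe, if_pos hs, hx]; rfl
      by_cases hxA : x ∈ observe ⁻¹' A
      · rw [Set.indicator_of_mem hxA, Set.indicator_of_mem hxA, obsSampled_observe, if_pos hs, e1]
        ring
      · rw [Set.indicator_of_notMem hxA, Set.indicator_of_notMem hxA, if_pos hs]
        ring
    · have hs0 : sampled x = 0 := by omega
      have e1 : observe x = (predictor x, text x, controls x, 0, 0) := by
        simp [observe, hs0]
      have e2 : x ∈ observe ⁻¹' A ↔ (predictor x, text x, controls x) ∈ A' := by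
        rw [Set.mem_preimage, e1]; rfl
      rw [if_neg hs, zero_mul, sub_zero]
      by_cases hxA : (predictor x, text x, controls x) ∈ A'
      · rw [Set.indicator_of_mem (e2.2 hxA), Set.indicator_of_mem (e2.2 hxA)]
        simp [hφ, hxA, reprControls, obsSampled_observe, hs]
      · rw [Set.indicator_of_notMem (mt e2.1 hxA), Set.indicator_of_notMem (mt e2.1 hxA)]
        simp [hφ, hxA]
  rw [← integral_indicator (measurable_observe hA), ← integral_indicator (measurable_observe hA)]
  refine (integral_congr_ae hae).trans ((integral_add i2 (i0.sub i1)).trans ?_)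
  simp only [Pi.sub_apply]
  rw [integral_sub i0 i1, h0, h1, sub_zero, add_zero]

/-- Residuals of square-integrable functions of `(L, W, Z)`, observed on the labelled units, belong
to the tangent space of the blind-annotation model. -/
lemma IsBlindAnnotation.toLp_conceptResidual_mem_tangentSpace (h : IsBlindAnnotation t 𝓛 p c P)
    (hf : IsSurrogateRepresentation P f) {R : ℝ × EuclideanSpace ℝ (Fin p) × 𝒵 → ℝ}
    (hR : Measurable R)
    (hi : Integrable (fun x => R (concept x, reprControls f x) ^ 2) (P : Measure (FullData 𝒴 𝒵)))
    (hL : MemLp (fun o => obsSampled o * conceptResidual f P R (obsLabelled f o)) 2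
      ((P : Measure (FullData 𝒴 𝒵)).map observe)) :
    hL.toLp _ ∈ tangentSpace (blindAnnotationModel 𝒴 𝒵 t 𝓛 p) observe P := by
  have hfm := hf.choose
  have hp : IsProbabilityMeasure ((P : Measure (FullData 𝒴 𝒵)).map observe) :=
    Measure.isProbabilityMeasure_map measurable_observe.aemeasurable
  have hW : Measurable fun x : FullData 𝒴 𝒵 => (concept x, reprControls f x) :=
    measurable_concept.prodMk (measurable_reprControls hfm)
  have hob := measurable_obsLabelled (𝒵 := 𝒵) hfm
  set Rn : ℕ → ℝ × EuclideanSpace ℝ (Fin p) × 𝒵 → ℝ := fun n y => clamp n (R y) with hRn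
  have mRn : ∀ n, Measurable (Rn n) := fun n => (measurable_clamp n).comp hR
  have bRn : ∀ n y, |Rn n y| ≤ n := fun n y => abs_clamp_le n _
  have bS : ∀ o : ObsData 𝒴 𝒵, |obsSampled o| ≤ 1 := fun o => by
    unfold obsSampled; split_ifs <;> simp
  have mG : ∀ {R : ℝ × EuclideanSpace ℝ (Fin p) × 𝒵 → ℝ}, Measurable R →
      Measurable fun o => obsSampled o * conceptResidual f P R (obsLabelled f o) := fun hR =>
    measurable_obsSampled.mul ((measurable_conceptResidual hR).comp hob)
  have bG : ∀ n (o : ObsData 𝒴 𝒵),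
      |obsSampled o * conceptResidual f P (Rn n) (obsLabelled f o)| ≤ n + n := fun n o => by
    rw [abs_mul]
    exact (mul_le_mul (bS o) (abs_conceptResidual_le (bRn n) _) (abs_nonneg _) zero_le_one).trans
      (one_mul _).le
  have hLn : ∀ n, MemLp (fun o => obsSampled o * conceptResidual f P (Rn n) (obsLabelled f o)) 2
      ((P : Measure (FullData 𝒴 𝒵)).map observe) := fun n =>
    MemLp.of_bound (mG (mRn n)).aestronglyMeasurable (n + n)
      (ae_of_all _ fun o => by rw [Real.norm_eq_abs]; exact bG n o)
  refine toLp_mem_of_tendsto (Submodule.isClosed_topologicalClosure _) hL hLn (fun n => ?_) ?_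
  · refine Submodule.le_topologicalClosure _ (Submodule.subset_span ?_)
    have bn := abs_conceptResidual_le (f := f) (P := P) (bRn n)
    have mn := measurable_conceptResidual (f := f) (P := P) (mRn n)
    refine exists_isRegularSubmodel_tilt
      (b := fun x => conceptResidual f P (Rn n) (concept x, reprControls f x)) (C := n + n)
      measurable_observe (mn.comp hW) (fun x => bn _) ?_ (mG (mRn n)) (bG n)
      (fun A hA => h.setIntegral_conceptResidual hf (mRn n) (bRn n) hA)
      ⟨(2 * c.1, c.2 / 4), fun ε Q hε hQ => ?_⟩ (hLn n)
    · have := h.integral_conceptResidual_mul hf (mRn n) (bRn n) (τ := fun _ => 1) measurable_const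
        (by simp)
      simpa only [mul_one] using this
    · exact h.reweight_concept hf
        (w := fun y => (tiltDensity (conceptResidual f P (Rn n)) ε y : ℝ≥0∞))
        (measurable_tiltDensity mn).coe_nnreal_ennreal hQ
        (fun y => two_inv_le_tiltDensity bn hε y) (fun y => tiltDensity_le_two bn hε y)
  · have hin : ∀ n, Integrable (fun x => Rn n (concept x, reprControls f x) ^ 2)
        (P : Measure (FullData 𝒴 𝒵)) := fun n =>
      integrable_of_abs_le (C := (n : ℝ) ^ 2) (((mRn n).comp hW).pow_const 2) fun x => by
        rw [abs_pow]; exact pow_le_pow_left₀ (abs_nonneg _) (bRn n _) 2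
    have hlim := (tendsto_integral_sub_clamp_sq (hR.comp hW) hi).const_mul 4
    rw [mul_zero] at hlim
    refine squeeze_zero (fun n => integral_nonneg fun o => sq_nonneg _) (fun n => ?_) hlim
    obtain ⟨h1, h2⟩ := integral_conceptResidual_sub_sq_le (P := P) hfm (mRn n) hR (hin n) hi
    refine le_trans ?_ h2
    have mD : Measurable fun o : ObsData 𝒴 𝒵 =>
        (obsSampled o * conceptResidual f P (Rn n) (obsLabelled f o) -
          obsSampled o * conceptResidual f P R (obsLabelled f o)) ^ 2 :=
      ((mG (mRn n)).sub (mG hR)).pow_const 2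
    rw [integral_map measurable_observe.aemeasurable mD.aestronglyMeasurable]
    refine integral_mono_of_nonneg (ae_of_all _ fun x => sq_nonneg _) h1 ?_
    filter_upwards [h.perfect] with x hx
    by_cases hs : sampled x = 1
    · have e1 : obsLabelled f (observe x) = (concept x, reprControls f x) := by
        rw [obsLabelled, obsLabel_observe, if_pos hs, hx]; rfl
      simp only [e1, obsSampled_observe, if_pos hs, one_mul]
      exact le_rfl
    · simp only [obsSampled_observe, if_neg hs, zero_mul, sub_zero]
      exact (zero_pow two_ne_zero).trans_le (sq_nonneg _)

end ConceptTangent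

/-! ### The influence function lies in the tangent space -/

section Efficient

variable {𝒴 𝒵 : Type*} [MeasurableSpace 𝒴] [MeasurableSpace 𝒵] [StandardBorelSpace 𝒴]
  [Nonempty 𝒴] {t : Fin 2} {𝓛 : Set ℝ} {p : ℕ} {c : ℝ≥0 × ℝ≥0}
  {P : ProbabilityMeasure (FullData 𝒴 𝒵)} {f : 𝒴 → EuclideanSpace ℝ (Fin p)}

/-- `L` times the weight `ρ_t(W, Z) / (π_t(Z) P(S = 1))` that a labelled unit has in the influence
function. -/
def labelDirection (t : Fin 2) (f : 𝒴 → EuclideanSpace ℝ (Fin p)) (c : ℝ≥0)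
    (P : ProbabilityMeasure (FullData 𝒴 𝒵)) (y : ℝ × EuclideanSpace ℝ (Fin p) × 𝒵) : ℝ :=
  (nuisanceOf t f c P).labelProb⁻¹ *
    (surrogacyScore t f P y.2.1 y.2.2 / (nuisanceOf t f c P).propensity y.2.2) * y.1

/-- The part of the influence function that depends on `(T, W, Z)` only. -/
def predictorDirection (t : Fin 2) (f : 𝒴 → EuclideanSpace ℝ (Fin p)) (c : ℝ≥0)
    (P : ProbabilityMeasure (FullData 𝒴 𝒵)) (y : Fin 2 × EuclideanSpace ℝ (Fin p) × 𝒵) : ℝ :=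
  (if y.1 = t then 1 else 0) / (nuisanceOf t f c P).propensity y.2.2 *
      (outcomeModel f P y.2.1 y.2.2 - meanOutcome t f P y.2.2) +
    meanOutcome t f P y.2.2 - targetParameter t P

lemma measurable_labelDirection {c : ℝ≥0} : Measurable (labelDirection t f c P) := by
  have h1 : Measurable fun y : ℝ × EuclideanSpace ℝ (Fin p) × 𝒵 =>
      surrogacyScore t f P y.2.1 y.2.2 := measurable_surrogacyScore.comp measurable_snd
  have h2 : Measurable (nuisanceOf t f c P).propensity :=
    measurable_const.max measurable_propensityScore
  exact (((h1.div (h2.comp (measurable_snd.comp measurable_snd))).const_mul _).mul measurable_fst)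

lemma measurable_predictorDirection (hf : Measurable f) {c : ℝ≥0} :
    Measurable (predictorDirection t f c P) := by
  have h1 : Measurable fun y : Fin 2 × EuclideanSpace ℝ (Fin p) × 𝒵 =>
      outcomeModel f P y.2.1 y.2.2 := measurable_outcomeModel.comp measurable_snd
  have h2 : Measurable (nuisanceOf t f c P).propensity :=
    measurable_const.max measurable_propensityScore
  have hz : Measurable fun y : Fin 2 × EuclideanSpace ℝ (Fin p) × 𝒵 => y.2.2 := by fun_prop
  have h3 := (measurable_meanOutcome (t := t) (P := P) hf).comp hz
  have h4 : Measurable fun y : Fin 2 × EuclideanSpace ℝ (Fin p) × 𝒵 =>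
      if y.1 = t then (1 : ℝ) else 0 :=
    Measurable.ite (measurable_fst (measurableSet_singleton t)) measurable_const measurable_const
  exact (((h4.div (h2.comp hz)).mul (h1.sub h3)).add h3).sub_const _

variable [StandardBorelSpace 𝒵]

lemma CommonConditions.conceptResidual_labelDirection (h : CommonConditions t p c P)
    (y : ℝ × EuclideanSpace ℝ (Fin p) × 𝒵) :
    conceptResidual f P (labelDirection t f c.2 P) y =
      (nuisanceOf t f c.2 P).labelProb⁻¹ *
        (surrogacyScore t f P y.2.1 y.2.2 / (nuisanceOf t f c.2 P).propensity y.2.2) *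
        (y.1 - outcomeModel f P y.2.1 y.2.2) := by
  simp only [conceptResidual, labelDirection]
  rw [integral_const_mul, h.outcomeModel_eq, mul_sub]

variable (f) in
lemma CommonConditions.influenceFunction_ae_eq_add (h : CommonConditions t p c P) :
    influenceFunction t f P =ᵐ[(P : Measure (FullData 𝒴 𝒵)).map observe] fun o =>
      obsSampled o * conceptResidual f P (labelDirection t f c.2 P) (obsLabelled f o) +
        predictorDirection t f c.2 P (obsReduced f o) := by
  filter_upwards [h.influenceFunction_ae_eq f] with o ho
  rw [ho, h.conceptResidual_labelDirection]
  have e1 : obsArm t o = if (obsReduced f o).1 = t then 1 else 0 := rfl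
  simp only [doublyRobust, predictorDirection, ← e1]
  simp only [nuisanceOf, obsLabelled, obsReduced, obsTextControls, obsControls]
  ring

lemma IsBlindAnnotation.memLp_conceptResidual (h : IsBlindAnnotation t 𝓛 p c P)
    (hf : IsSurrogateRepresentation P f) :
    MemLp (fun o => obsSampled o *
      conceptResidual f P (labelDirection t f c.2 P) (obsLabelled f o)) 2
      ((P : Measure (FullData 𝒴 𝒵)).map observe) := by
  have hN := h.isNuisance hf
  have hfm := hf.choose
  set N := nuisanceOf t f c.2 P with hN'
  set Q := (P : Measure (FullData 𝒴 𝒵)).map observe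
  have hc : 0 < (c.2 : ℝ) := h.pos
  have mo : Measurable fun o : ObsData 𝒴 𝒵 => N.outcome (obsTextControls o) :=
    hN.measurable_outcome.comp measurable_obsTextControls
  have l1 : MemLp (fun o : ObsData 𝒴 𝒵 => obsLabel o) 2 Q :=
    (memLp_two_iff_integrable_sq measurable_obsLabel.aestronglyMeasurable).2 hN.label_sq
  have l2 : MemLp (fun o : ObsData 𝒴 𝒵 => N.outcome (obsTextControls o)) 2 Q :=
    (memLp_two_iff_integrable_sq mo.aestronglyMeasurable).2 hN.outcome_sq
  refine MemLp.of_le_mul (l1.sub l2) (c := N.labelProb⁻¹ * (c.2 : ℝ)⁻¹)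
    (measurable_obsSampled.mul ((measurable_conceptResidual measurable_labelDirection).comp
      (measurable_obsLabelled hfm))).aestronglyMeasurable (ae_of_all _ fun o => ?_)
  rw [h.conceptResidual_labelDirection, Real.norm_eq_abs, Real.norm_eq_abs]
  have hα := hN.labelProb_pos
  have hS : |obsSampled o| ≤ 1 := by unfold obsSampled; split_ifs <;> simp
  have hπ := hN.le_propensity (obsControls o)
  have hρ := surrogacyScore_le_one (t := t) (P := P) (f := f) (obsLabelled f o).2.1
    (obsLabelled f o).2.2
  have hρ0 := surrogacyScore_nonneg (t := t) (P := P) (f := f) (obsLabelled f o).2.1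
    (obsLabelled f o).2.2
  have hw : surrogacyScore t f P (obsLabelled f o).2.1 (obsLabelled f o).2.2 /
      N.propensity (obsLabelled f o).2.2 ≤ (c.2 : ℝ)⁻¹ := by
    rw [← one_div]
    exact div_le_div₀ zero_le_one hρ hc hπ
  have hw0 : 0 ≤ surrogacyScore t f P (obsLabelled f o).2.1 (obsLabelled f o).2.2 /
      N.propensity (obsLabelled f o).2.2 := div_nonneg hρ0 (hc.le.trans hπ)
  rw [abs_mul, abs_mul, abs_mul, abs_of_nonneg hw0, abs_of_pos (inv_pos.2 hα)]
  refine (mul_le_mul hS (mul_le_mul_of_nonneg_right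
    (mul_le_mul_of_nonneg_left hw (inv_pos.2 hα).le) (abs_nonneg _)) (by positivity)
    zero_le_one).trans ?_
  rw [one_mul]
  exact le_rfl

lemma IsBlindAnnotation.integral_predictorDirection (h : IsBlindAnnotation t 𝓛 p c P)
    (hf : IsSurrogateRepresentation P f) :
    ∫ o, predictorDirection t f c.2 P (obsReduced f o)
      ∂((P : Measure (FullData 𝒴 𝒵)).map observe) = 0 := by
  have hN := h.isNuisance hf
  set N := nuisanceOf t f c.2 P with hN'
  set Q := (P : Measure (FullData 𝒴 𝒵)).map observe
  have hp : IsProbabilityMeasure Q :=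
    Measure.isProbabilityMeasure_map measurable_observe.aemeasurable
  have hc : 0 < (c.2 : ℝ) := h.pos
  have mτ : Measurable fun z => (N.propensity z)⁻¹ := hN.measurable_propensity.inv
  have bτ : ∀ z, |(N.propensity z)⁻¹| ≤ (c.2 : ℝ)⁻¹ := fun z => by
    have := hN.le_propensity z
    rw [abs_of_pos (inv_pos.2 (hc.trans_le this))]
    exact inv_anti₀ hc this
  have e := hN.integral_armMean (fun z => (N.propensity z)⁻¹) mτ ⟨_, bτ⟩
  have mw : Measurable fun o : ObsData 𝒴 𝒵 => obsArm t o * (N.propensity (obsControls o))⁻¹ :=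
    (measurable_obsArm t).mul (mτ.comp measurable_obsControls)
  have bw : ∀ o : ObsData 𝒴 𝒵, |obsArm t o * (N.propensity (obsControls o))⁻¹| ≤ (c.2 : ℝ)⁻¹ :=
    fun o => by
      rw [abs_mul]
      refine (mul_le_mul (b := 1) ?_ (bτ _) (abs_nonneg _) zero_le_one).trans (one_mul _).le
      unfold obsArm; split_ifs <;> simp
  have i1 : Integrable (fun o => obsArm t o * N.outcome (obsTextControls o) *
      (N.propensity (obsControls o))⁻¹) Q :=
    (integrable_mul_of_abs_le hN.integrable_outcome mw bw).congr
      (ae_of_all _ fun o => by simp only; ring)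
  have i2 : Integrable (fun o => obsArm t o * N.armMean (obsControls o) *
      (N.propensity (obsControls o))⁻¹) Q :=
    (integrable_mul_of_abs_le hN.integrable_armMean mw bw).congr
      (ae_of_all _ fun o => by simp only; ring)
  have i3 := hN.integrable_armMean
  have e2 : ∀ o, predictorDirection t f c.2 P (obsReduced f o) =
      (obsArm t o * N.outcome (obsTextControls o) * (N.propensity (obsControls o))⁻¹ -
        obsArm t o * N.armMean (obsControls o) * (N.propensity (obsControls o))⁻¹) +
      (N.armMean (obsControls o) - targetParameter t P) := fun o => by
    have e1 : obsArm t o = if (obsReduced f o).1 = t then 1 else 0 := rfl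
    simp only [predictorDirection, ← e1]
    simp only [hN', nuisanceOf, obsReduced, obsTextControls, obsControls]
    ring
  simp only [e2]
  refine (integral_add (i1.sub i2) (i3.sub (integrable_const _))).trans ?_
  simp only [Pi.sub_apply]
  rw [integral_sub i1 i2, e, sub_self, integral_sub i3 (integrable_const _), ← hN.target]
  simp

lemma IsBlindAnnotation.memLp_predictorDirection (h : IsBlindAnnotation t 𝓛 p c P)
    (hf : IsSurrogateRepresentation P f) :
    MemLp (fun o => predictorDirection t f c.2 P (obsReduced f o)) 2
      ((P : Measure (FullData 𝒴 𝒵)).map observe) := by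
  refine ((h.memLp_influenceFunction hf).sub (h.memLp_conceptResidual hf)).ae_eq ?_
  filter_upwards [h.influenceFunction_ae_eq_add f] with o ho
  rw [Pi.sub_apply, ho]
  ring

lemma IsBlindAnnotation.toLp_influenceFunction_mem_tangentSpace (h : IsBlindAnnotation t 𝓛 p c P)
    (hf : IsSurrogateRepresentation P f) :
    (h.memLp_influenceFunction hf).toLp _ ∈
      tangentSpace (blindAnnotationModel 𝒴 𝒵 t 𝓛 p) observe P := by
  have hfm := hf.choose
  have hN := h.isNuisance hf
  have e := (MemLp.toLp_congr (h.memLp_influenceFunction hf)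
    ((h.memLp_conceptResidual hf).add (h.memLp_predictorDirection hf))
    (h.influenceFunction_ae_eq_add f)).trans
    (MemLp.toLp_add (h.memLp_conceptResidual hf) (h.memLp_predictorDirection hf))
  rw [e]
  refine Submodule.add_mem _ ?_ ?_
  · refine h.toLp_conceptResidual_mem_tangentSpace hf measurable_labelDirection ?_ _
    have hW : Measurable fun x : FullData 𝒴 𝒵 => (concept x, reprControls f x) :=
      measurable_concept.prodMk (measurable_reprControls hfm)
    have hα := hN.labelProb_pos
    have hc : 0 < (c.2 : ℝ) := h.pos
    refine (h.concept_sq.1.const_mul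
      (((nuisanceOf t f c.2 P).labelProb⁻¹ * (c.2 : ℝ)⁻¹) ^ 2)).mono'
      ((measurable_labelDirection.comp hW).pow_const 2).aestronglyMeasurable
      (ae_of_all _ fun x => ?_)
    rw [Real.norm_eq_abs, abs_of_nonneg (sq_nonneg _), labelDirection, mul_pow]
    refine mul_le_mul_of_nonneg_right ?_ (sq_nonneg _)
    have hπ := hN.le_propensity (controls x)
    have hρ0 := surrogacyScore_nonneg (t := t) (P := P) (f := f) (f (text x)) (controls x)
    refine pow_le_pow_left₀ (mul_nonneg (inv_pos.2 hα).le
      (div_nonneg hρ0 (hc.le.trans hπ))) (mul_le_mul_of_nonneg_left ?_ (inv_pos.2 hα).le) 2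
    rw [← one_div]
    exact div_le_div₀ zero_le_one (surrogacyScore_le_one _ _) hc hπ
  · refine toLp_obsReduced_mem_tangentSpace hfm (fun B C hB hBC => ⟨(2 * c.1, c.2 / 4),
      fun ε Q hε hQ => ?_⟩) (measurable_predictorDirection hfm) _
      (h.integral_predictorDirection hf)
    exact h.reweight_predictor hf (w := fun y => (tiltDensity B ε y : ℝ≥0∞))
      (measurable_tiltDensity hB).coe_nnreal_ennreal hQ
      (fun y => two_inv_le_tiltDensity hBC hε y) (fun y => tiltDensity_le_two hBC hε y)

/-- Under perfect annotation the concept is a function of the representation and the controls. -/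
lemma IsPerfectAnnotation.concept_ae_eq (h : IsPerfectAnnotation t 𝓛 p c P)
    (hf : IsSurrogateRepresentation P f) :
    ∀ᵐ x ∂(P : Measure (FullData 𝒴 𝒵)),
      concept x = outcomeModel f P (f (text x)) (controls x) := by
  have hfm := hf.choose
  obtain ⟨g, hg, -, hgL⟩ := h.coding
  have hgi : Integrable (fun x => g (text x)) (P : Measure (FullData 𝒴 𝒵)) :=
    h.integrable_concept.congr hgL
  have hX : Measurable fun x : FullData 𝒴 𝒵 => (text x, controls x) := by fun_prop
  have mo := measurable_nuisanceOf_outcome (t := t) (c := c) (P := P) hfm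
  have hae := ae_eq_of_forall_integral_mul_eq hX (u := fun y => g y.1)
    (v := fun y => outcomeModel f P (f y.1) y.2) (hg.comp measurable_fst) mo hgi
    (integrable_of_sq (mo.comp hX) (h.outcomeModel_sq hfm).1) fun τ hτ hτ1 => by
      have := hf.integral_concept_mul measurable_id h.integrable_concept hτ hτ1
      refine Eq.trans ?_ (this.trans ?_)
      · refine integral_congr_ae ?_
        filter_upwards [hgL] with x hx
        rw [← hx]; rfl
      · refine integral_congr_ae (ae_of_all _ fun x => ?_)
        simp only [h.outcomeModel_eq]
        rfl
  filter_upwards [hae, hgL] with x hx hx'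
  rw [hx', hx]

lemma IsPerfectAnnotation.toLp_influenceFunction_mem_tangentSpace
    (h : IsPerfectAnnotation t 𝓛 p c P) (hf : IsSurrogateRepresentation P f) :
    (h.isBlindAnnotation.memLp_influenceFunction hf).toLp _ ∈
      tangentSpace (perfectAnnotationModel 𝒴 𝒵 t 𝓛 p) observe P := by
  have hfm := hf.choose
  have hb := h.isBlindAnnotation
  -- the residual vanishes because the concept equals its conditional mean
  have hae : influenceFunction t f P =ᵐ[(P : Measure (FullData 𝒴 𝒵)).map observe] fun o =>
      predictorDirection t f c.2 P (obsReduced f o) := by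
    have m0 : Measurable fun o : ObsData 𝒴 𝒵 => obsSampled o *
        conceptResidual f P (labelDirection t f c.2 P) (obsLabelled f o) :=
      measurable_obsSampled.mul ((measurable_conceptResidual measurable_labelDirection).comp
        (measurable_obsLabelled hfm))
    have h0 : ∀ᵐ o ∂((P : Measure (FullData 𝒴 𝒵)).map observe), obsSampled o *
        conceptResidual f P (labelDirection t f c.2 P) (obsLabelled f o) = 0 := by
      refine (ae_map_iff measurable_observe.aemeasurable
        (measurableSet_eq_fun m0 measurable_const)).2 ?_
      filter_upwards [h.perfect, h.concept_ae_eq hf] with x hx hx'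
      by_cases hs : sampled x = 1
      · have e1 : obsLabelled f (observe x) = (concept x, reprControls f x) := by
          rw [obsLabelled, obsLabel_observe, if_pos hs, hx]; rfl
        rw [e1, h.conceptResidual_labelDirection]
        simp only [reprControls]
        rw [← hx', sub_self, mul_zero, mul_zero]
      · rw [obsSampled_observe, if_neg hs, zero_mul]
    filter_upwards [h.influenceFunction_ae_eq_add f, h0] with o ho ho'
    rw [ho, ho', zero_add]
  rw [MemLp.toLp_congr (hb.memLp_influenceFunction hf) (hb.memLp_predictorDirection hf) hae]
  refine toLp_obsReduced_mem_tangentSpace hfm (fun B C hB hBC => ⟨(2 * c.1, c.2 / 4),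
      fun ε Q hε hQ => ?_⟩) (measurable_predictorDirection hfm) _
      (hb.integral_predictorDirection hf)
  exact h.reweight hf (w := fun y => (tiltDensity B ε y : ℝ≥0∞))
    (measurable_tiltDensity hB).coe_nnreal_ennreal hQ
    (fun y => two_inv_le_tiltDensity hBC hε y) (fun y => tiltDensity_le_two hBC hε y)

end Efficient

end SRI

end

theorem theorem1 {𝒴 𝒵 : Type*} [MeasurableSpace 𝒴] [StandardBorelSpace 𝒴] [Nonempty 𝒴]
    [MeasurableSpace 𝒵] [StandardBorelSpace 𝒵] (t : Fin 2) (𝓛 : Set ℝ) (p : ℕ) :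
    (∀ (c : ℝ≥0 × ℝ≥0) (P : ProbabilityMeasure (SRI.FullData 𝒴 𝒵))
        (f : 𝒴 → EuclideanSpace ℝ (Fin p)),
      P ∈ SRI.perfectAnnotationModel 𝒴 𝒵 t 𝓛 p c → SRI.IsSurrogateRepresentation P f →
        SRI.IsEfficientInfluenceFunction (SRI.perfectAnnotationModel 𝒴 𝒵 t 𝓛 p) SRI.observe
          (SRI.targetParameter t) P (SRI.influenceFunction t f P)) ∧
    (∀ (c : ℝ≥0 × ℝ≥0) (P : ProbabilityMeasure (SRI.FullData 𝒴 𝒵))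
        (f : 𝒴 → EuclideanSpace ℝ (Fin p)),
      P ∈ SRI.blindAnnotationModel 𝒴 𝒵 t 𝓛 p c → SRI.IsSurrogateRepresentation P f →
        SRI.IsEfficientInfluenceFunction (SRI.blindAnnotationModel 𝒴 𝒵 t 𝓛 p) SRI.observe
          (SRI.targetParameter t) P (SRI.influenceFunction t f P)) := by
  constructor
  · intro c P f hP hf
    have h : SRI.IsPerfectAnnotation t 𝓛 p c P := hP
    exact ⟨h.isBlindAnnotation.memLp_influenceFunction hf,
      fun γ s hs => (hs.mono fun k Q hQ =>
        SRI.IsPerfectAnnotation.isBlindAnnotation hQ).hasDerivAt_targetParameter hf,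
      h.toLp_influenceFunction_mem_tangentSpace hf⟩
  · intro c P f hP hf
    have h : SRI.IsBlindAnnotation t 𝓛 p c P := hP
    exact ⟨h.memLp_influenceFunction hf, fun γ s hs => hs.hasDerivAt_targetParameter hf,
      h.toLp_influenceFunction_mem_tangentSpace hf⟩
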